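/- **Setting.** For each sample size $n\ge 1$ let $p=p(n)$ and $r=r(n)$ be positive integers with $p,r\to\infty$ as $n\to\infty$, let $\epsilon=\epsilon(n)>0$, $\delta=\delta(n)\in(0,1/e)$, $b_n>0$, and let $\sigma>0$, $b>0$ be fixed. Let $\mathcal D$ be a fixed probability distribution on $[-b,b]$ with mean $0$ and variance $1$, and assume $b_n=O(\sigma\sqrt{\log n})$ and $b_n/\sigma-\sqrt{2\log(2n)}\to\infty$. Let $\theta_0=\theta_0^{(n)}\in\mathbb R^p$ with $\|\theta_0\|_2=1$, $S_0=\{j:\theta_{0,j}\ne0\}$, $s_0=|S_0|$. Put $$B=\sqrt{2pb^2+(b\sqrt{s_0}+b_n)^2},\qquad w^2=\frac{4B^2}{\epsilon}\Big(\sqrt{2r\log(4/\delta)}+\log(4/\delta)\Big),\qquad \rho_n^2=\frac{n+r+1}{nr}+\frac{w^2}{nr}.$$ Let $X,\widetilde X\in\mathbb R^{n\times p}$ have entries with law $\mathcal D$, let $\xi\in\mathbb R^n$ have entries with the law of $N(0,\sigma^2)$ conditioned on $[-b_n,b_n]$, and let $R\in\mathbb R^{r\times(n+2p+1)}$ have entries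 with law $N(0,1/r)$, all these entries being independent. Let $y=X\theta_0+\xi$, $A=[X\ \widetilde X\ y]$, and let $[X^*\ \widetilde X^*\ y^*]=R\begin{bmatrix}A\\ wI_{2p+1}\end{bmatrix}$ be the privatized data. With a penalty $\lambda$, let $$\widehat\theta^*\in\arg\min_{\theta\in\mathbb R^{2p}}\frac1{2n}\big\|[X^*\ \widetilde X^*]\theta-y^*\big\|_2^2+\lambda\|\theta\|_1,\qquad \widehat\theta^u=\widehat\theta^*+\frac1n[X^*\ \widetilde X^*]^\top\big(y^*-[X^*\ \widetilde X^*]\widehat\theta^*\big)+\frac{w^2}{n}\widehat\theta^*.$$ Let $f:\mathbb R^2\to\mathbb R_{\ge0}$, $(x,a)\mapsto f(x;a)$, be such that for some $L>0$ and every $a\in\mathbb R$: $f(\cdot;a)$ is $L$-Lipschitz; $k f(x;a)=f(kx;ka)$ for all $k>0$; $f(-x;a)=f(x;a)$; $f(\cdot;a)$ is non-decreasing on $[0,\infty)$; and there are $c_a,c_x>0$ (possibly depending on $a$) with $f(x;a)\ge c_a x$ for $x\ge c_x$. For $j\in[p]$ put $W_j=f(\widehat\theta^u_j;\sigma\rho_n)-f(\widehat\theta^u_{j+p};\sigma\rho_n)$,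 and $$\widehat{\rm FDP}(t)=\frac{1+|\{j:W_j\le -t\}|}{|\{j:W_j\ge t\}|\vee1},\quad {\rm FDP}(t)=\frac{|\{j:\theta_{0,j}=0,\,W_j\ge t\}|}{|\{j:W_j\ge t\}|\vee 1},\quad {\rm Power}(t)=\frac{|\{j:\theta_{0,j}\ne0,\,W_j\ge t\}|}{s_0}.$$ **Theorem.** There is an absolute constant $C_\lambda>0$ such that the following holds for every such setting with $\lambda=C_\lambda\sigma\max\{\sqrt{\log(2p)/n},\sqrt{(\log(2p))^3/r}\}$. Let $\phi_w=1+w^2/n$, $\kappa_n=2\lambda\sqrt{s_0}+w^2/n$, and assume, as $n\to\infty$, 1. $\dfrac{\kappa_n^2}{\lambda^2\phi_w}=o\Big(\sqrt{\tfrac{n}{\log(2p)}}\min\big\{1,\sqrt{\tfrac rn},\tfrac{\sqrt{rn}}{w^2}\big\}\Big)$; 2. $\sqrt{s_0}=O\Big(\max\{\tfrac1{\sqrt n},\tfrac{\log(2p)}{\sqrt r}\}\Big/\max\{\tfrac{w\log(2p)}{\sqrt{nr}},\tfrac{w^2}{n}\sqrt{\tfrac{\log(2p)}{r}}\}\Big)$;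 3. $\dfrac{\sqrt{s_0}}{\sigma\rho_n}=o\Big(\min\big\{\tfrac n{w^2}\sqrt{\tfrac r{\log(2p)}},\tfrac{\sqrt{nr}}{w\log(2p)}\big\}\Big)$; 4. $\dfrac1{\sigma\rho_n}\dfrac{4\kappa_n^2}{\lambda\phi_w}=o\Big(\min\big\{\sqrt{\tfrac n{\log(2p)}},\sqrt{\tfrac r{\log(2p)}},\tfrac n{w^2}\sqrt{\tfrac r{\log(2p)}},\tfrac{\sqrt{nr}}{w\log(2p)}\big\}\Big)$. Assume moreover that $s_0/p\to c_0$ for some $c_0\in(0,1)$, and that there are $\mu_n>0$ with $\theta_{0,j}\ge\mu_n$ for all $j\in S_0$ and $\mu_n/(\sigma\rho_n)\to\mu_0\in\mathbb R$. Let $Z,Z'$ be independent $N(0,1)$ variables and, for $t_0>0$, $$\widehat\alpha(\mu_0,t_0)=\frac{c_0\mathbb P(f(\mu_0+Z;1)-f(Z';1)\le-t_0)+(1-c_0)\mathbb P(f(Z;1)-f(Z';1)\le-t_0)}{c_0\mathbb P(f(\mu_0+Z;1)-f(Z';1)\ge t_0)+(1-c_0)\mathbb P(f(Z;1)-f(Z';1)\ge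 t_0)},$$ $$\alpha(\mu_0,t_0)=\frac{(1-c_0)\mathbb P(f(Z;1)-f(Z';1)\ge t_0)}{c_0\mathbb P(f(\mu_0+Z;1)-f(Z';1)\ge t_0)+(1-c_0)\mathbb P(f(Z;1)-f(Z';1)\ge t_0)},$$ $$\beta(\mu_0,t_0)=\mathbb P(f(\mu_0+Z;1)-f(Z';1)\ge t_0).$$ Then for every fixed $t_0>0$, asymptotically with high probability, $\limsup_n\widehat{\rm FDP}(\sigma\rho_nt_0)\le\widehat\alpha(\mu_0,t_0)$, $\limsup_n{\rm FDP}(\sigma\rho_nt_0)\le\alpha(\mu_0,t_0)$ and $\liminf_n{\rm Power}(\sigma\rho_nt_0)\ge\beta(\mu_0,t_0)$, in the sense that for every $\eta>0$, as $n\to\infty$, $$\mathbb P\big(\widehat{\rm FDP}(\sigma\rho_nt_0)\le\widehat\alpha(\mu_0,t_0)+\eta\big)\to1,\quad \mathbb P\big({\rm FDP}(\sigma\rho_nt_0)\le\alpha(\mu_0,t_0)+\eta\big)\to1,\quad \mathbb P\big({\rm Power}(\sigma\rho_nt_0)\ge\beta(\mu_0,t_0)-\eta\big)\to1.$$ -/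

import Mathlib

open MeasureTheory ProbabilityTheory Filter Topology Asymptotics Set
open scoped NNReal

noncomputable section

namespace JLKnockoff

/-- Indices of the columns of `[X X̃]`: `Sum.inl j` is the original feature `j`,
`Sum.inr j` is its knockoff (index `j + p`). -/
abbrev Cols (p : ℕ) : Type := Fin p ⊕ Fin p

/-- Indices of the columns of the augmented data matrix `[X X̃ y]`. -/
abbrev AugCols (p : ℕ) : Type := Cols p ⊕ Unit

/-- The deterministic parameters of the asymptotic regime, indexed by the sample size `n`. -/
structure Params where
  /-- number of features -/
  p : ℕ → ℕ
  /-- number of rows of the random projection -/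
  r : ℕ → ℕ
  /-- privacy parameters -/
  ε : ℕ → ℝ
  δ : ℕ → ℝ
  /-- law of the entries of the design, and a bound for its support -/
  D : Measure ℝ
  b : ℝ
  /-- noise level and truncation level of the noise -/
  σ : ℝ
  bn : ℕ → ℝ
  /-- true regression coefficients -/
  θ₀ : (n : ℕ) → Fin (p n) → ℝ

namespace Params

variable (S : Params)

/-- The sparsity `s₀ = |{j : θ₀ⱼ ≠ 0}|`. -/
def s₀ (n : ℕ) : ℕ := {j | S.θ₀ n j ≠ 0}.ncard

/-- Bound on the `ℓ₂` norms of the rows of `[X X̃ y]`. -/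
def B (n : ℕ) : ℝ :=
  √(2 * (S.p n : ℝ) * S.b ^ 2 + (S.b * √(S.s₀ n : ℝ) + S.bn n) ^ 2)

/-- The scale of the identity block appended to the data before the projection:
`w² = (4B²/ε)(√(2 r log(4/δ)) + log(4/δ))`. -/
def w (n : ℕ) : ℝ :=
  √(4 * S.B n ^ 2 / S.ε n *
    (√(2 * (S.r n : ℝ) * Real.log (4 / S.δ n)) + Real.log (4 / S.δ n)))

/-- `ρₙ² = (n + r + 1)/(nr) + w²/(nr)`. -/
def ρ (n : ℕ) : ℝ :=
  √(((n : ℝ) + S.r n + 1) / (n * S.r n) + S.w n ^ 2 / (n * S.r n))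

/-- Logarithm of the number `2p` of columns of the design `[X X̃]`. -/
def logDim (n : ℕ) : ℝ := Real.log (2 * (S.p n : ℝ))

/-- The Lasso penalty. -/
def lam (C : ℝ) (n : ℕ) : ℝ :=
  C * S.σ * max (√(S.logDim n / n)) (√(S.logDim n ^ 3 / S.r n))

/-- `φ_w = 1 + w²/n`. -/
def φw (n : ℕ) : ℝ := 1 + S.w n ^ 2 / n

/-- `κₙ = 2 λ √s₀ + w²/n`. -/
def κ (C : ℝ) (n : ℕ) : ℝ := 2 * S.lam C n * √(S.s₀ n : ℝ) + S.w n ^ 2 / n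

/-- The law of one noise variable: `N(0, σ²)` conditioned on `[-bₙ, bₙ]`. -/
def noiseLaw (n : ℕ) : Measure ℝ :=
  (gaussianReal 0 (S.σ ^ 2).toNNReal)[|Icc (-S.bn n) (S.bn n)]

/-- The standing assumptions on the parameters. -/
structure Standing : Prop where
  p_tendsto : Tendsto S.p atTop atTop
  r_tendsto : Tendsto S.r atTop atTop
  ε_pos : ∀ n, 0 < S.ε n
  δ_mem : ∀ n, S.δ n ∈ Ioo 0 (Real.exp (-1))
  D_prob : IsProbabilityMeasure S.D
  D_supp : ∀ᵐ x ∂S.D, |x| ≤ S.b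
  D_mean : ∫ x, x ∂S.D = 0
  D_var : Var[fun x : ℝ => x; S.D] = 1
  σ_pos : 0 < S.σ
  bn_pos : ∀ n, 0 < S.bn n
  bn_bigO : S.bn =O[atTop] fun n : ℕ => S.σ * √(Real.log n)
  bn_large : Tendsto (fun n : ℕ => S.bn n / S.σ - √(2 * Real.log (2 * (n : ℝ)))) atTop atTop
  θ₀_norm : ∀ n, ∑ j, S.θ₀ n j ^ 2 = 1

/-- The four sufficient conditions for debiasing, for the design `[X X̃]` with `2p` columns
and the Lasso penalty with constant `C`. -/
structure Debiasing (C : ℝ) : Prop where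
  compatibility :
    (fun n : ℕ => S.κ C n ^ 2 / (S.lam C n ^ 2 * S.φw n)) =o[atTop]
      fun n : ℕ => √(n / S.logDim n) *
        min 1 (min (√(S.r n / n)) (√(S.r n * n) / S.w n ^ 2))
  penalty :
    (fun n : ℕ => √(S.s₀ n : ℝ)) =O[atTop]
      fun n : ℕ => max (1 / √(n : ℝ)) (S.logDim n / √(S.r n : ℝ)) /
        max (S.w n * S.logDim n / √(n * S.r n))
          (S.w n ^ 2 / n * √(S.logDim n / S.r n))
  sparsity :
    (fun n : ℕ => 1 / (S.σ * S.ρ n) * √(S.s₀ n : ℝ)) =o[atTop]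
      fun n : ℕ => min (n / S.w n ^ 2 * √(S.r n / S.logDim n))
        (√(n * S.r n) / (S.w n * S.logDim n))
  error :
    (fun n : ℕ => 1 / (S.σ * S.ρ n) * (4 * S.κ C n ^ 2 / (S.lam C n * S.φw n))) =o[atTop]
      fun n : ℕ => min (√(n / S.logDim n)) (min (√(S.r n / S.logDim n))
        (min (n / S.w n ^ 2 * √(S.r n / S.logDim n))
          (√(n * S.r n) / (S.w n * S.logDim n))))

end Params

/-- The random inputs at sample size `n`: design `X`, knockoffs `Xk`, noise `ξ` and projection
matrix `R` with `n + 2p + 1` columns. -/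
structure Sample (S : Params) (n : ℕ) (Ω : Type*) where
  X : Ω → Matrix (Fin n) (Fin (S.p n)) ℝ
  Xk : Ω → Matrix (Fin n) (Fin (S.p n)) ℝ
  ξ : Ω → Fin n → ℝ
  R : Ω → Matrix (Fin (S.r n)) (Fin n ⊕ AugCols (S.p n)) ℝ

namespace Sample

variable {S : Params} {n : ℕ} {Ω : Type*} (Y : Sample S n Ω)

/-- The design with knockoffs, `[X X̃]`. -/
def design (ω : Ω) : Matrix (Fin n) (Cols (S.p n)) ℝ := Matrix.fromCols (Y.X ω) (Y.Xk ω)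

/-- All scalar random inputs as one family: entries of `[X X̃]`, of `ξ`, and of `R`. -/
def entries : (Fin n × Cols (S.p n)) ⊕ (Fin n ⊕ (Fin (S.r n) × (Fin n ⊕ AugCols (S.p n)))) →
    Ω → ℝ
  | Sum.inl (i, j), ω => Y.design ω i j
  | Sum.inr (Sum.inl i), ω => Y.ξ ω i
  | Sum.inr (Sum.inr (k, l)), ω => Y.R ω k l

/-- The distribution of the inputs: all entries are independent, those of `X` and `X̃` have law `D`,
those of `ξ` are truncated Gaussian, those of `R` are `N(0, 1/r)`. -/
structure IsModel [MeasurableSpace Ω] (P : Measure Ω) : Prop where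
  indep : iIndepFun Y.entries P
  law_X : ∀ i j, HasLaw (fun ω => Y.X ω i j) S.D P
  law_Xk : ∀ i j, HasLaw (fun ω => Y.Xk ω i j) S.D P
  law_ξ : ∀ i, HasLaw (fun ω => Y.ξ ω i) (S.noiseLaw n) P
  law_R : ∀ k l, HasLaw (fun ω => Y.R ω k l) (gaussianReal 0 ((S.r n : ℝ≥0)⁻¹)) P

/-- The response `y = X θ₀ + ξ`. -/
def y (ω : Ω) : Fin n → ℝ := (Y.X ω).mulVec (S.θ₀ n) + Y.ξ ω

/-- The privatized data `A* = R [A; w I]` with `A = [X X̃ y]`. -/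
def priv (ω : Ω) : Matrix (Fin (S.r n)) (AugCols (S.p n)) ℝ :=
  Y.R ω * Matrix.fromRows
    (Matrix.fromCols (Y.design ω) (Matrix.replicateCol Unit (Y.y ω)))
    (S.w n • (1 : Matrix (AugCols (S.p n)) (AugCols (S.p n)) ℝ))

/-- The privatized design `[X* X̃*]`. -/
def privX (ω : Ω) : Matrix (Fin (S.r n)) (Cols (S.p n)) ℝ := (Y.priv ω).toCols₁

/-- The privatized response `y*`. -/
def privY (ω : Ω) : Fin (S.r n) → ℝ := fun k => Y.priv ω k (Sum.inr ())

/-- The objective `(1/2n) ‖[X* X̃*] θ - y*‖₂² + l ‖θ‖₁` of the private Lasso. -/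
def lassoObj (l : ℝ) (ω : Ω) (θ : Cols (S.p n) → ℝ) : ℝ :=
  1 / (2 * (n : ℝ)) * ∑ k, ((Y.privX ω).mulVec θ k - Y.privY ω k) ^ 2 + l * ∑ j, |θ j|

/-- `θ` is a private Lasso estimate with penalty `l`. -/
def IsLasso (l : ℝ) (ω : Ω) (θ : Cols (S.p n) → ℝ) : Prop :=
  ∀ θ', Y.lassoObj l ω θ ≤ Y.lassoObj l ω θ'

/-- The debiased estimate
`θ + (1/n) [X* X̃*]ᵀ (y* - [X* X̃*] θ) + (w²/n) θ` built from a private Lasso estimate `θ`. -/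
def debias (ω : Ω) (θ : Cols (S.p n) → ℝ) : Cols (S.p n) → ℝ :=
  θ + (1 / (n : ℝ)) • (Y.privX ω).transpose.mulVec (Y.privY ω - (Y.privX ω).mulVec θ)
    + (S.w n ^ 2 / n) • θ

/-- The feature statistics `Wⱼ = f(θᵘⱼ; σρₙ) - f(θᵘⱼ₊ₚ; σρₙ)`. -/
def W (f : ℝ → ℝ → ℝ) (ω : Ω) (θ : Cols (S.p n) → ℝ) (j : Fin (S.p n)) : ℝ :=
  f (Y.debias ω θ (Sum.inl j)) (S.σ * S.ρ n) - f (Y.debias ω θ (Sum.inr j)) (S.σ * S.ρ n)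

end Sample

/-- The estimated false discovery proportion at threshold `t`. -/
def FDPhat {p : ℕ} (W : Fin p → ℝ) (t : ℝ) : ℝ :=
  (1 + ({j | W j ≤ -t}.ncard : ℝ)) / max ({j | t ≤ W j}.ncard : ℝ) 1

/-- The false discovery proportion at threshold `t` (equal to `0` if nothing is selected). -/
def FDP {p : ℕ} (θ₀ W : Fin p → ℝ) (t : ℝ) : ℝ :=
  ({j | θ₀ j = 0 ∧ t ≤ W j}.ncard : ℝ) / max ({j | t ≤ W j}.ncard : ℝ) 1

/-- The power at threshold `t`. -/
def Power {p : ℕ} (θ₀ W : Fin p → ℝ) (t : ℝ) : ℝ :=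
  ({j | θ₀ j ≠ 0 ∧ t ≤ W j}.ncard : ℝ) / ({j | θ₀ j ≠ 0}.ncard : ℝ)

/-- The assumptions on the function `f(x; a)`, written `f x a`. -/
structure FeatureFun (f : ℝ → ℝ → ℝ) : Prop where
  nonneg : ∀ x a, 0 ≤ f x a
  lipschitz : ∃ L : ℝ≥0, 0 < L ∧ ∀ a, LipschitzWith L fun x => f x a
  homog : ∀ k x a, 0 < k → k * f x a = f (k * x) (k * a)
  even : ∀ x a, f x a = f (-x) a
  mono : ∀ a, MonotoneOn (fun x => f x a) (Ici 0)
  growth : ∀ a, ∃ ca > 0, ∃ cx > 0, ∀ x ≥ cx, ca * x ≤ f x a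

/-- Probability of an event about two independent standard Gaussians `(Z, Z')`. -/
def gaussProb (E : Set (ℝ × ℝ)) : ℝ := ((gaussianReal 0 1).prod (gaussianReal 0 1)).real E

/-- `P(f(μ + Z; 1) - f(Z'; 1) ≥ t)`. -/
def probGe (f : ℝ → ℝ → ℝ) (μ t : ℝ) : ℝ := gaussProb {z | t ≤ f (μ + z.1) 1 - f z.2 1}

/-- `P(f(μ + Z; 1) - f(Z'; 1) ≤ -t)`. -/
def probLe (f : ℝ → ℝ → ℝ) (μ t : ℝ) : ℝ := gaussProb {z | f (μ + z.1) 1 - f z.2 1 ≤ -t}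

def alphaHat (f : ℝ → ℝ → ℝ) (c₀ μ₀ t₀ : ℝ) : ℝ :=
  (c₀ * probLe f μ₀ t₀ + (1 - c₀) * probLe f 0 t₀) /
    (c₀ * probGe f μ₀ t₀ + (1 - c₀) * probGe f 0 t₀)

def alpha (f : ℝ → ℝ → ℝ) (c₀ μ₀ t₀ : ℝ) : ℝ :=
  ((1 - c₀) * probGe f 0 t₀) / (c₀ * probGe f μ₀ t₀ + (1 - c₀) * probGe f 0 t₀)

def beta (f : ℝ → ℝ → ℝ) (μ₀ t₀ : ℝ) : ℝ := probGe f μ₀ t₀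

/-- The events `E n` hold with high probability: the probabilities of the complements tend to `0`.
(For measurable events this says that the probabilities of `E n` tend to `1`.) -/
def WithHighProb {Ω : ℕ → Type*} [∀ n, MeasurableSpace (Ω n)] (P : ∀ n, Measure (Ω n))
    (E : ∀ n, Set (Ω n)) : Prop :=
  Tendsto (fun n => P n (E n)ᶜ) atTop (𝓝 0)

end JLKnockoff

end

/-! Write v = w²/n. Since s₀/p tends to a positive constant, the error condition of the regime
forces the dimension to be small: v → 0, p v² → 0, p λ → 0, and hence p²/n → 0 and p²/r → 0
(`Params.rates`). Second-moment bounds then suffice, without restricted eigenvalues: the sketched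
Gram matrix of the 2p columns is close to (1 + v) I even in Frobenius norm (`expLE_gramDev`,
`smallP_gramErr`).

On that event the Lasso has a crude ℓ₂ error bound (`lasso_error_le`), and algebra
(`debias_error_eq`, `Inputs.sketch_err_eq`, `Sample.exists_debias_eq`) writes the debiased estimate
as the true coefficients, plus a leading term, plus an error whose sum of squares is o(p ρ²) in
probability (`smallP_debiasErr`). So all but a small fraction of the features have error small
compared with σρ (`withHighProb_approx`). No bound uniform over the features is needed, because the
conclusions only concern proportions.

The leading term of a column x, divided by σρ, is ⟨x, a⟩ with weights a = RᵀRξ/(nσρ). The weights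
depend on the noise and the projection only, so they are independent of the design. Rotation
invariance of the Gaussian matrix (`map_replace_component`) makes RᵀRξ explicit and yields Σ aᵢ² → 1
and Σ aᵢ⁴ → 0. Given the weights, the scores of the 2p columns are independent with a common law,
which is nearly N(0,1) by the central limit theorem (`eventually_lowerClose`). Chebyshev's
inequality given the weights is then a law of large numbers for the number of features whose pair of
scores falls in a prescribed region (`withHighProb_pairCount`).

Homogeneity of f turns events about W at threshold σρt into events about f(·;1) at threshold t. The
resulting planar regions have convex or co-convex sections, so closeness on half-lines controls them
uniformly in the size of the signal (`LowerClose.gapSet`). The approximation error is absorbed by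
moving arguments towards or away from 0 (`exists_inner_perturbation`, `exists_outer_perturbation`),
and signals above the limit μ₀ are compared with a shift by exactly μ₀ (`gaussShift_mono_left`,
`gaussShift_anti_right`). The outcome is `CountBounds`; the three proportions are monotone in the
counts, in the directions these bounds provide. -/

namespace JLKnockoff

/-! ### Linear and quadratic forms in independent Gaussian variables -/

/-- A linear form in independent centred Gaussians is Gaussian. -/
lemma map_pi_gaussian_linear {ι : Type*} [Fintype ι] (v : ℝ≥0) (c : ι → ℝ) :
    (Measure.pi fun _ : ι => gaussianReal 0 v).map (fun x => ∑ i, c i * x i) =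
      gaussianReal 0 (v * (∑ i, c i ^ 2).toNNReal) := by
  apply Measure.ext_of_charFun
  ext t
  have hind : iIndepFun (fun i (x : ι → ℝ) => c i * x i)
      (Measure.pi fun _ : ι => gaussianReal 0 v) :=
    iIndepFun_pi (X := fun i (x : ℝ) => c i * x) (fun i => by fun_prop)
  rw [hind.charFun_map_fun_sum_eq_prod
    (fun i => (by fun_prop : Measurable fun x : ι → ℝ => c i * x i).aemeasurable)]
  have h1 : ∀ i, (Measure.pi fun _ : ι => gaussianReal 0 v).map (fun x => c i * x i) =
      gaussianReal 0 (NNReal.mk (c i ^ 2) (sq_nonneg _) * v) := by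
    intro i
    have : (fun x : ι → ℝ => c i * x i) = (fun y => c i * y) ∘ (Function.eval i) := rfl
    rw [this, ← Measure.map_map (by fun_prop) (by fun_prop),
      (measurePreserving_eval _ i).map_eq, gaussianReal_map_const_mul, mul_zero]
  simp only [h1, Finset.prod_apply, charFun_gaussianReal]
  rw [← Complex.exp_sum]
  congr 1
  have h2 : (0 : ℝ) ≤ ∑ i, c i ^ 2 := Finset.sum_nonneg fun i _ => sq_nonneg _
  simp only [NNReal.coe_mul, Real.coe_toNNReal _ h2, NNReal.coe_mk]
  push_cast
  simp only [mul_zero, zero_mul, zero_sub, Finset.mul_sum, Finset.sum_mul, Finset.sum_div,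
    Finset.sum_neg_distrib]
  congr 1
  exact Finset.sum_congr rfl fun i _ => by ring

/-- The fourth moment of the standard Gaussian. -/
noncomputable def gaussFourth : ℝ := ∫ x, x ^ 4 ∂gaussianReal 0 1

/-- Only the sign and the scaling of this moment matter; its value is never computed. -/
lemma gaussFourth_nonneg : 0 ≤ gaussFourth := integral_nonneg fun x => by positivity

lemma integrable_pow_gaussianReal (v : ℝ≥0) (k : ℕ) :
    Integrable (fun x : ℝ => x ^ k) (gaussianReal 0 v) := by
  have h := (memLp_id_gaussianReal (μ := 0) (v := v) (k : ℝ≥0)).integrable_norm_pow'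
  refine (integrable_norm_iff (by fun_prop)).1 ?_
  simpa [norm_pow] using h

lemma integral_sq_gaussianReal (v : ℝ≥0) : ∫ x, x ^ 2 ∂gaussianReal 0 v = v := by
  have h := variance_fun_id_gaussianReal (μ := 0) (v := v)
  rw [variance_eq_integral (by fun_prop)] at h
  simpa [integral_id_gaussianReal] using h

lemma integral_fourth_gaussianReal (v : ℝ≥0) :
    ∫ x, x ^ 4 ∂gaussianReal 0 v = gaussFourth * v ^ 2 := by
  have h : gaussianReal 0 v = (gaussianReal 0 1).map (fun x => √(v : ℝ) * x) := by
    rw [gaussianReal_map_const_mul]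
    congr 1
    · simp
    · ext; simp [Real.sq_sqrt]
  rw [h, integral_map (by fun_prop) (by fun_prop), gaussFourth, ← integral_mul_const]
  congr 1 with x
  have : √(v : ℝ) ^ 4 = (v : ℝ) ^ 2 := by
    rw [show (4 : ℕ) = 2 * 2 from rfl, pow_mul, Real.sq_sqrt v.coe_nonneg]
  rw [mul_pow, this]; ring

section LinearForm

variable {ι : Type*} [Fintype ι] (v : ℝ≥0) (c : ι → ℝ)

lemma integrable_linear_pow (k : ℕ) :
    Integrable (fun x : ι → ℝ => (∑ i, c i * x i) ^ k)
      (Measure.pi fun _ : ι => gaussianReal 0 v) := by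
  have h := integrable_pow_gaussianReal (v * (∑ i, c i ^ 2).toNNReal) k
  rw [← map_pi_gaussian_linear] at h
  exact h.comp_measurable (by fun_prop)

lemma integral_linear_sq :
    ∫ x : ι → ℝ, (∑ i, c i * x i) ^ 2 ∂(Measure.pi fun _ : ι => gaussianReal 0 v) =
      v * ∑ i, c i ^ 2 := by
  have h := integral_sq_gaussianReal (v * (∑ i, c i ^ 2).toNNReal)
  rw [← map_pi_gaussian_linear,
    integral_map (Measurable.aemeasurable (by fun_prop)) (by fun_prop)] at h
  rw [h, NNReal.coe_mul, Real.coe_toNNReal _ (Finset.sum_nonneg fun i _ => sq_nonneg _)]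

lemma integral_linear_fourth :
    ∫ x : ι → ℝ, (∑ i, c i * x i) ^ 4 ∂(Measure.pi fun _ : ι => gaussianReal 0 v) =
      gaussFourth * (v * ∑ i, c i ^ 2) ^ 2 := by
  have h := integral_fourth_gaussianReal (v * (∑ i, c i ^ 2).toNNReal)
  rw [← map_pi_gaussian_linear,
    integral_map (Measurable.aemeasurable (by fun_prop)) (by fun_prop)] at h
  rw [h, NNReal.coe_mul, Real.coe_toNNReal _ (Finset.sum_nonneg fun i _ => sq_nonneg _)]

variable (a b : ι → ℝ)

/-- Polarization reduces the covariance of two linear forms to the second moment of one. -/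
lemma integral_linear_mul_linear :
    ∫ x : ι → ℝ, (∑ i, a i * x i) * (∑ i, b i * x i)
      ∂(Measure.pi fun _ : ι => gaussianReal 0 v) = v * ∑ i, a i * b i := by
  have h : ∀ x : ι → ℝ, (∑ i, a i * x i) * (∑ i, b i * x i) =
      ((∑ i, (a i + b i) * x i) ^ 2 - (∑ i, (a i - b i) * x i) ^ 2) / 4 := by
    intro x
    simp only [add_mul, sub_mul, Finset.sum_add_distrib, Finset.sum_sub_distrib]
    ring
  simp only [h]
  rw [integral_div, integral_sub (integrable_linear_pow v _ 2) (integrable_linear_pow v _ 2),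
    integral_linear_sq, integral_linear_sq, ← mul_sub, ← Finset.sum_sub_distrib, mul_div_assoc,
    Finset.sum_div]
  congr 1
  exact Finset.sum_congr rfl fun i _ => by ring

lemma memLp_linear_mul_linear :
    MemLp (fun x : ι → ℝ => (∑ i, a i * x i) * (∑ i, b i * x i)) 2
      (Measure.pi fun _ : ι => gaussianReal 0 v) := by
  rw [memLp_two_iff_integrable_sq (by fun_prop)]
  refine ((integrable_linear_pow v a 4).add (integrable_linear_pow v b 4)).mono'
    (by fun_prop) (ae_of_all _ fun x => ?_)
  rw [Real.norm_of_nonneg (sq_nonneg _)]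
  simp only [Pi.add_apply]
  nlinarith [sq_nonneg ((∑ i, a i * x i) ^ 2 - (∑ i, b i * x i) ^ 2),
    sq_nonneg ((∑ i, a i * x i) ^ 2), sq_nonneg ((∑ i, b i * x i) ^ 2)]

/-- Weighted AM–GM with weights B/(2A) and A/(2B), balanced so that the two fourth moments combine
to the product A B. If A or B vanishes, both sides are zero. -/
lemma integral_sq_linear_mul_linear_le :
    ∫ x : ι → ℝ, ((∑ i, a i * x i) * (∑ i, b i * x i)) ^ 2
      ∂(Measure.pi fun _ : ι => gaussianReal 0 v) ≤
      gaussFourth * v ^ 2 * (∑ i, a i ^ 2) * ∑ i, b i ^ 2 := by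
  set A := ∑ i, a i ^ 2 with hA
  set B := ∑ i, b i ^ 2 with hB
  set μ := Measure.pi fun _ : ι => gaussianReal 0 v
  have hA0 : 0 ≤ A := Finset.sum_nonneg fun i _ => sq_nonneg _
  have hB0 : 0 ≤ B := Finset.sum_nonneg fun i _ => sq_nonneg _
  rcases hA0.eq_or_lt with h0 | hApos
  · have : ∀ i, a i = 0 := by
      intro i
      have := (Finset.sum_eq_zero_iff_of_nonneg (fun i _ => sq_nonneg (a i))).1 (hA.symm.trans h0.symm) i (Finset.mem_univ i)
      simpa using this
    simp [this, ← h0]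
  rcases hB0.eq_or_lt with h0 | hBpos
  · have : ∀ i, b i = 0 := by
      intro i
      have := (Finset.sum_eq_zero_iff_of_nonneg (fun i _ => sq_nonneg (b i))).1 (hB.symm.trans h0.symm) i (Finset.mem_univ i)
      simpa using this
    simp [this, ← h0]
  have hle : ∀ x : ι → ℝ, ((∑ i, a i * x i) * (∑ i, b i * x i)) ^ 2 ≤
      (B / (2 * A)) * (∑ i, a i * x i) ^ 4 + (A / (2 * B)) * (∑ i, b i * x i) ^ 4 := by
    intro x
    set s := ∑ i, a i * x i
    set t := ∑ i, b i * x i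
    have : (B / (2 * A)) * s ^ 4 + (A / (2 * B)) * t ^ 4 - (s * t) ^ 2 =
        (B * s ^ 2 - A * t ^ 2) ^ 2 / (2 * A * B) := by field_simp; ring
    have h2 : 0 ≤ (B * s ^ 2 - A * t ^ 2) ^ 2 / (2 * A * B) := by positivity
    linarith
  calc ∫ x, ((∑ i, a i * x i) * (∑ i, b i * x i)) ^ 2 ∂μ
      ≤ ∫ x, ((B / (2 * A)) * (∑ i, a i * x i) ^ 4 + (A / (2 * B)) * (∑ i, b i * x i) ^ 4) ∂μ :=
        integral_mono ((memLp_two_iff_integrable_sq (by fun_prop)).1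
          (memLp_linear_mul_linear v a b)) (((integrable_linear_pow v a 4).const_mul _).add
          ((integrable_linear_pow v b 4).const_mul _)) hle
    _ = gaussFourth * v ^ 2 * A * B := by
        rw [integral_add ((integrable_linear_pow v a 4).const_mul _)
          ((integrable_linear_pow v b 4).const_mul _), integral_const_mul, integral_const_mul,
          integral_linear_fourth, integral_linear_fourth]
        field_simp
        ring

end LinearForm

/-- The product law of a matrix with independent `N(0, v)` entries. -/
noncomputable abbrev gaussMatrix (κ ι : Type*) [Fintype κ] [Fintype ι] (v : ℝ≥0) : Measure (κ → ι → ℝ) :=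
  Measure.pi fun _ : κ => Measure.pi fun _ : ι => gaussianReal 0 v

/-- The inner product of two Gaussian sketches concentrates around its mean. -/
lemma integral_sq_sketch_le {κ ι : Type*} [Fintype κ] [Fintype ι] (v : ℝ≥0) (a b : ι → ℝ) :
    ∫⁻ R, ENNReal.ofReal (((∑ k, (∑ i, a i * R k i) * (∑ i, b i * R k i)) -
        Fintype.card κ * (v * ∑ i, a i * b i)) ^ 2) ∂gaussMatrix κ ι v ≤
      ENNReal.ofReal (Fintype.card κ * (gaussFourth * v ^ 2 * (∑ i, a i ^ 2) * ∑ i, b i ^ 2)) := by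
  classical
  set ν := Measure.pi fun _ : ι => gaussianReal 0 v with hν
  set q : (ι → ℝ) → ℝ := fun x => (∑ i, a i * x i) * (∑ i, b i * x i) with hq
  have hqm : Measurable q := by fun_prop
  set Z : κ → (κ → ι → ℝ) → ℝ := fun k R => q (R k) with hZ
  have hmp : ∀ k, MeasurePreserving (Function.eval k) (gaussMatrix κ ι v) ν := fun k =>
    measurePreserving_eval _ k
  have hL : ∀ k, MemLp (Z k) 2 (gaussMatrix κ ι v) := fun k =>
    (memLp_linear_mul_linear v a b).comp_measurePreserving (hmp k)
  have hind : iIndepFun Z (gaussMatrix κ ι v) :=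
    iIndepFun_pi (X := fun _ : κ => q) (fun _ => hqm.aemeasurable)
  have hmean : ∀ k, ∫ R, Z k R ∂gaussMatrix κ ι v = v * ∑ i, a i * b i := by
    intro k
    have h := integral_linear_mul_linear v a b
    rw [← hν, ← (hmp k).map_eq,
      integral_map (measurable_pi_apply k).aemeasurable (by fun_prop)] at h
    exact h
  have hvar : ∀ k, Var[Z k; gaussMatrix κ ι v] ≤
      gaussFourth * v ^ 2 * (∑ i, a i ^ 2) * ∑ i, b i ^ 2 := by
    intro k
    refine (variance_le_expectation_sq (hL k).aestronglyMeasurable).trans ?_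
    have h := integral_sq_linear_mul_linear_le v a b
    rw [← hν, ← (hmp k).map_eq,
      integral_map (measurable_pi_apply k).aemeasurable (by fun_prop)] at h
    exact h
  -- The rows of the matrix are independent, so variances add: one factor `card κ`, not its square.
  have hsum : Var[∑ k, Z k; gaussMatrix κ ι v] = ∑ k, Var[Z k; gaussMatrix κ ι v] :=
    IndepFun.variance_sum (fun k _ => hL k) fun i _ j _ hij => hind.indepFun hij
  have hLs : MemLp (∑ k, Z k) 2 (gaussMatrix κ ι v) := memLp_finsetSum' _ fun k _ => hL k
  have hm : ∫ R, (∑ k, Z k) R ∂gaussMatrix κ ι v = Fintype.card κ * (v * ∑ i, a i * b i) := by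
    simp only [Finset.sum_apply]
    rw [integral_finsetSum _ fun k _ => (hL k).integrable (by norm_num)]
    simp [hmean]
  have hev := evariance_eq_lintegral_ofReal (∑ k, Z k) (gaussMatrix κ ι v)
  rw [hm] at hev
  have : ∫⁻ R, ENNReal.ofReal (((∑ k, (∑ i, a i * R k i) * (∑ i, b i * R k i)) -
        Fintype.card κ * (v * ∑ i, a i * b i)) ^ 2) ∂gaussMatrix κ ι v =
      eVar[∑ k, Z k; gaussMatrix κ ι v] := by
    rw [hev]; simp [hZ, hq]
  rw [this, ← hLs.ofReal_variance_eq, hsum]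
  refine ENNReal.ofReal_le_ofReal ((Finset.sum_le_sum fun k _ => hvar k).trans ?_)
  simp

/-! ### Product measures of matrices -/

section PiPi

variable {κ ι α : Type*} [Fintype κ] [Fintype ι] [MeasurableSpace α]
  (μ : Measure α) [IsProbabilityMeasure μ]

lemma map_uncurry_pi_pi :
    (Measure.pi fun _ : κ => Measure.pi fun _ : ι => μ).map
      (fun R (p : κ × ι) => R p.1 p.2) = Measure.pi fun _ : κ × ι => μ := by
  refine (Measure.pi_eq fun s hs => ?_).symm
  rw [Measure.map_apply (by fun_prop) (MeasurableSet.univ_pi hs)]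
  have : (fun (R : κ → ι → α) (p : κ × ι) => R p.1 p.2) ⁻¹' (univ.pi s) =
      univ.pi fun k => univ.pi fun i => s (k, i) := by
    ext R; simp
  rw [this, Measure.pi_pi]
  simp_rw [Measure.pi_pi]
  rw [Fintype.prod_prod_type]

lemma map_uncurry_swap_pi_pi :
    (Measure.pi fun _ : κ => Measure.pi fun _ : ι => μ).map
      (fun R (p : ι × κ) => R p.2 p.1) = Measure.pi fun _ : ι × κ => μ := by
  refine (Measure.pi_eq fun s hs => ?_).symm
  rw [Measure.map_apply (by fun_prop) (MeasurableSet.univ_pi hs)]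
  have : (fun (R : κ → ι → α) (p : ι × κ) => R p.2 p.1) ⁻¹' (univ.pi s) =
      univ.pi fun k => univ.pi fun i => s (i, k) := by
    ext R; simp; exact forall_comm
  rw [this, Measure.pi_pi]
  simp_rw [Measure.pi_pi]
  rw [Fintype.prod_prod_type, Finset.prod_comm]

/-- Allows the columns of a matrix with i.i.d. entries to play the role of independent rows; both
laws are compared after uncurrying. -/
lemma map_transpose_pi_pi :
    (Measure.pi fun _ : κ => Measure.pi fun _ : ι => μ).map (fun R i k => R k i) =
      Measure.pi fun _ : ι => Measure.pi fun _ : κ => μ := by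
  apply (MeasurableEquiv.curry ι κ α).symm.map_measurableEquiv_injective
  have h1 := map_uncurry_pi_pi (κ := ι) (ι := κ) μ
  have h2 := map_uncurry_swap_pi_pi (κ := κ) (ι := ι) μ
  have h3 : ((MeasurableEquiv.curry ι κ α).symm : (ι → κ → α) → ι × κ → α) =
      fun R p => R p.1 p.2 := rfl
  rw [h3, h1, Measure.map_map (by fun_prop) (by fun_prop), ← h2]
  rfl

end PiPi

/-! ### Rotation invariance -/

/-- An isometric linear image of a vector of independent Gaussians is again one. -/
lemma map_pi_gaussian_orthonormal {ι ι' : Type*} [Fintype ι] [Fintype ι'] [DecidableEq ι]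
    (v : ℝ≥0) (A : ι → ι' → ℝ) (hA : ∀ i j, ∑ l, A i l * A j l = if i = j then 1 else 0) :
    (Measure.pi fun _ : ι' => gaussianReal 0 v).map (fun x i => ∑ l, A i l * x l) =
      Measure.pi fun _ : ι => gaussianReal 0 v := by
  have : IsFiniteMeasure ((Measure.pi fun _ : ι' => gaussianReal 0 v).map
      (fun x i => ∑ l, A i l * x l)) := Measure.isFiniteMeasure_map _ _
  rw [← charFun_eq_pi_iff]
  intro t
  -- Pairing t with Ax is pairing Aᵀt with x, and orthonormal rows give ‖Aᵀt‖ = ‖t‖, the only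
  -- quantity a centred isotropic Gaussian characteristic function sees.
  set c : ι' → ℝ := fun l => ∑ i, t i * A i l with hc
  have hcs : ∑ l, c l ^ 2 = ∑ i, t i ^ 2 := by
    have h1 : ∀ l, c l ^ 2 = ∑ i, ∑ j, t i * t j * (A i l * A j l) := by
      intro l
      simp only [hc, sq, Finset.sum_mul_sum]
      exact Finset.sum_congr rfl fun i _ => Finset.sum_congr rfl fun j _ => by ring
    simp only [h1]
    rw [Finset.sum_comm]
    simp_rw [Finset.sum_comm (s := Finset.univ (α := ι')), ← Finset.mul_sum, hA]
    simp [sq]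
  have h1 : charFun (((Measure.pi fun _ : ι' => gaussianReal 0 v).map
      (fun x i => ∑ l, A i l * x l)).map (WithLp.toLp 2)) t =
      charFun ((Measure.pi fun _ : ι' => gaussianReal 0 v).map (fun x => ∑ l, c l * x l)) 1 := by
    rw [Measure.map_map (by fun_prop) (by fun_prop), charFun_apply, charFun_apply,
      integral_map (Measurable.aemeasurable (by fun_prop)) (by fun_prop),
      integral_map (Measurable.aemeasurable (by fun_prop)) (by fun_prop)]
    congr 1 with x
    congr 3
    simp only [Function.comp, PiLp.inner_apply, hc, Finset.sum_mul]
    simp only [Inner.inner, one_mul]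
    rw [Finset.sum_comm]
    simp [mul_assoc, Finset.mul_sum]
  rw [h1, map_pi_gaussian_linear, charFun_gaussianReal]
  simp only [charFun_gaussianReal]
  rw [← Complex.exp_sum, hcs]
  congr 1
  have h2 : (0 : ℝ) ≤ ∑ i, t i ^ 2 := Finset.sum_nonneg fun i _ => sq_nonneg _
  simp only [NNReal.coe_mul, Real.coe_toNNReal _ h2]
  push_cast
  simp only [mul_zero, zero_mul, zero_sub, one_pow, mul_one, Finset.mul_sum, Finset.sum_div,
    Finset.sum_neg_distrib]

/-- Replacing the component of each row along a unit vector `e` by an independent Gaussian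
preserves the law of a Gaussian matrix. -/
lemma map_replace_component {κ ι : Type*} [Fintype κ] [Fintype ι]
    (v : ℝ≥0) (e : ι → ℝ) (he : ∑ i, e i ^ 2 = 1) :
    ((gaussMatrix κ ι v).prod (Measure.pi fun _ : κ => gaussianReal 0 v)).map
      (fun z k i => z.1 k i - (∑ l, e l * z.1 k l) * e i + z.2 k * e i) = gaussMatrix κ ι v := by
  classical
  have hrow : ((Measure.pi fun _ : ι => gaussianReal 0 v).prod (gaussianReal 0 v)).map
      (fun z i => z.1 i - (∑ l, e l * z.1 l) * e i + z.2 * e i) =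
      Measure.pi fun _ : ι => gaussianReal 0 v := by
    -- The map (x, g) ↦ x - ⟨e, x⟩e + g e has matrix [e | I - eeᵀ], whose rows are orthonormal
    -- because eeᵀ + (I - eeᵀ)² = I. The index `none` carries the fresh variable g.
    have h := map_pi_gaussian_orthonormal (ι := ι) (ι' := Option ι) v
      (fun i l => l.elim (e i) (fun l => (if i = l then 1 else 0) - e l * e i)) (by
        intro i j
        simp only [Fintype.sum_option, Option.elim]
        simp only [sub_mul, mul_sub, ite_mul, one_mul, zero_mul, mul_ite, mul_one, mul_zero,
          Finset.sum_sub_distrib, Finset.sum_ite_eq, Finset.mem_univ, if_true]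
        have : ∑ x, e x * e i * (e x * e j) = e i * e j := by
          rw [← mul_one (e i * e j), ← he, Finset.mul_sum]
          exact Finset.sum_congr rfl fun x _ => by ring
        rw [this]
        by_cases hij : i = j
        · subst hij; simp
        · simp [hij]; ring)
    have h2 := Measure.pi_map_piOptionEquivProd (fun _ : Option ι => gaussianReal 0 v)
    rw [← h2, Measure.map_map (by fun_prop) (by fun_prop)] at h
    refine Eq.trans ?_ h
    congr 1
    ext z i
    simp only [Function.comp, Fintype.sum_option, Option.elim]
    simp only [sub_mul, ite_mul, one_mul, zero_mul, Finset.sum_sub_distrib, Finset.sum_ite_eq,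
      Finset.mem_univ, if_true]
    have hnone : (MeasurableEquiv.piOptionEquivProd fun _ : Option ι => ℝ).symm z none = z.2 := rfl
    have hsome : ∀ l, (MeasurableEquiv.piOptionEquivProd fun _ : Option ι => ℝ).symm z (some l) =
      z.1 l := fun _ => rfl
    simp only [hnone, hsome]
    rw [Finset.sum_mul, Finset.sum_congr rfl fun l _ => mul_right_comm (e l) (z.1 l) (e i)]
    ring
  have h3 := (measurePreserving_arrowProdEquivProdArrow (ι → ℝ) ℝ κ
    (fun _ => Measure.pi fun _ : ι => gaussianReal 0 v) (fun _ => gaussianReal 0 v)).map_eq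
  rw [← h3, Measure.map_map (by fun_prop) (by fun_prop)]
  have h4 := Measure.pi_map_pi (ι := κ)
    (μ := fun _ => (Measure.pi fun _ : ι => gaussianReal 0 v).prod (gaussianReal 0 v))
    (f := fun _ z i => z.1 i - (∑ l, e l * z.1 l) * e i + z.2 * e i)
    (hμ := fun _ => by rw [hrow]; infer_instance) (fun _ => by fun_prop)
  rw [hrow] at h4
  exact h4

/-! ### Upper bounds for expectations of nonnegative functions -/

/-- The expectation of the positive part of `f` is at most `a`. -/
def ExpLE {α : Type*} [MeasurableSpace α] (μ : Measure α) (f : α → ℝ) (a : ℝ) : Prop :=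
  ∫⁻ x, ENNReal.ofReal (f x) ∂μ ≤ ENNReal.ofReal a

namespace ExpLE

variable {α β : Type*} [MeasurableSpace α] [MeasurableSpace β] {μ : Measure α} {ν : Measure β}
  {f g : α → ℝ} {a b : ℝ}

lemma mono (hg : ExpLE μ g a) (h : ∀ᵐ x ∂μ, f x ≤ g x) : ExpLE μ f a :=
  (lintegral_mono_ae (h.mono fun _ hx => ENNReal.ofReal_le_ofReal hx)).trans hg

lemma mono_right (hf : ExpLE μ f a) (h : a ≤ b) : ExpLE μ f b :=
  le_trans hf (ENNReal.ofReal_le_ofReal h)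

lemma add (hf : ExpLE μ f a) (hg : ExpLE μ g b) (hm : Measurable f) (ha : 0 ≤ a) (hb : 0 ≤ b) :
    ExpLE μ (fun x => f x + g x) (a + b) := by
  unfold ExpLE
  rw [ENNReal.ofReal_add ha hb]
  calc ∫⁻ x, ENNReal.ofReal (f x + g x) ∂μ
      ≤ ∫⁻ x, (ENNReal.ofReal (f x) + ENNReal.ofReal (g x)) ∂μ :=
        lintegral_mono fun x => ENNReal.ofReal_add_le
    _ = ∫⁻ x, ENNReal.ofReal (f x) ∂μ + ∫⁻ x, ENNReal.ofReal (g x) ∂μ :=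
        lintegral_add_left (by fun_prop) _
    _ ≤ _ := add_le_add hf hg

lemma const_mul (hf : ExpLE μ f a) {c : ℝ} (hc : 0 ≤ c) : ExpLE μ (fun x => c * f x) (c * a) := by
  unfold ExpLE
  simp_rw [ENNReal.ofReal_mul hc]
  rw [lintegral_const_mul' _ _ ENNReal.ofReal_ne_top]
  exact mul_le_mul_right hf _

lemma const [IsProbabilityMeasure μ] (a : ℝ) : ExpLE μ (fun _ => a) a := by simp [ExpLE]

lemma sum {ι : Type*} (s : Finset ι) {f : ι → α → ℝ} {a : ι → ℝ}
    (hf : ∀ i ∈ s, ExpLE μ (f i) (a i)) (hm : ∀ i, Measurable (f i)) (ha : ∀ i, 0 ≤ a i) :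
    ExpLE μ (fun x => ∑ i ∈ s, f i x) (∑ i ∈ s, a i) := by
  classical
  induction s using Finset.induction_on with
  | empty => simp [ExpLE]
  | insert i s hi ih =>
    simp only [Finset.sum_insert hi]
    exact (hf i (Finset.mem_insert_self i s)).add
      (ih fun j hj => hf j (Finset.mem_insert_of_mem hj)) (hm i) (ha i)
      (Finset.sum_nonneg fun j _ => ha j)

/-- Tonelli: the first factor is averaged with the second one frozen; `prod_left` is the opposite
order. The order chosen decides which source of randomness is conditioned on. -/
lemma prod_right [SFinite μ] [SFinite ν] {F : α × β → ℝ} {g : β → ℝ} (hF : Measurable F)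
    (h : ∀ᵐ y ∂ν, ExpLE μ (fun x => F (x, y)) (g y)) (hg : ExpLE ν g a) :
    ExpLE (μ.prod ν) F a := by
  unfold ExpLE
  rw [lintegral_prod_symm _ (by fun_prop)]
  exact (lintegral_mono_ae h).trans hg

lemma prod_left [SFinite μ] [SFinite ν] {F : α × β → ℝ} {g : α → ℝ} (hF : Measurable F)
    (h : ∀ᵐ x ∂μ, ExpLE ν (fun y => F (x, y)) (g x)) (hg : ExpLE μ g a) :
    ExpLE (μ.prod ν) F a := by
  unfold ExpLE
  rw [lintegral_prod _ (by fun_prop)]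
  exact (lintegral_mono_ae h).trans hg

lemma of_map {T : α → β} (hT : Measurable T) (hTμ : μ.map T = ν) {F : β → ℝ} (hF : Measurable F) :
    ExpLE ν F a ↔ ExpLE μ (fun x => F (T x)) a := by
  unfold ExpLE
  rw [← hTμ, lintegral_map (by fun_prop) hT]

lemma of_integral (hf : Integrable f μ) (h0 : ∀ x, 0 ≤ f x) (h : ∫ x, f x ∂μ ≤ a) :
    ExpLE μ f a := by
  unfold ExpLE
  rw [← ofReal_integral_eq_lintegral_ofReal hf (ae_of_all _ h0)]
  exact ENNReal.ofReal_le_ofReal h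

lemma meas_ge_le (hf : ExpLE μ f a) (hm : Measurable f) {c : ℝ} (hc : 0 < c) :
    μ {x | c ≤ f x} ≤ ENNReal.ofReal (a / c) := by
  rw [ENNReal.ofReal_div_of_pos hc]
  have h1 := meas_ge_le_lintegral_div (μ := μ) (f := fun x => ENNReal.ofReal (f x))
    (by fun_prop) (ε := ENNReal.ofReal c) (by simpa using hc) ENNReal.ofReal_ne_top
  refine (measure_mono fun x hx => ?_).trans (h1.trans (ENNReal.div_le_div_right hf _))
  exact ENNReal.ofReal_le_ofReal hx

end ExpLE

/-! ### Linear forms in a Gaussian matrix -/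

section MatrixForm

variable {κ ι : Type*} [Fintype κ] [Fintype ι] (v : ℝ≥0)

lemma sketch_expLE (a b : ι → ℝ) :
    ExpLE (gaussMatrix κ ι v) (fun R => ((∑ k, (∑ i, a i * R k i) * (∑ i, b i * R k i)) -
        Fintype.card κ * (v * ∑ i, a i * b i)) ^ 2)
      (Fintype.card κ * (gaussFourth * v ^ 2 * (∑ i, a i ^ 2) * ∑ i, b i ^ 2)) :=
  integral_sq_sketch_le v a b

lemma expLE_matrixForm_sq (c : κ → ι → ℝ) :
    ExpLE (gaussMatrix κ ι v) (fun R => (∑ k, ∑ i, c k i * R k i) ^ 2)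
      (v * ∑ k, ∑ i, c k i ^ 2) := by
  have h := integral_linear_sq v (fun p : κ × ι => c p.1 p.2)
  have h2 := ExpLE.of_integral (integrable_linear_pow v (fun p : κ × ι => c p.1 p.2) 2)
    (fun x => by positivity) h.le
  rw [ExpLE.of_map (by fun_prop) (map_uncurry_pi_pi (κ := κ) (ι := ι) (gaussianReal 0 v))
    (by fun_prop)] at h2
  simpa only [Fintype.sum_prod_type] using h2

lemma expLE_matrixForm_fourth (c : κ → ι → ℝ) :
    ExpLE (gaussMatrix κ ι v) (fun R => (∑ k, ∑ i, c k i * R k i) ^ 4)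
      (gaussFourth * (v * ∑ k, ∑ i, c k i ^ 2) ^ 2) := by
  have h := integral_linear_fourth v (fun p : κ × ι => c p.1 p.2)
  have h2 := ExpLE.of_integral (integrable_linear_pow v (fun p : κ × ι => c p.1 p.2) 4)
    (fun x => by positivity) h.le
  rw [ExpLE.of_map (by fun_prop) (map_uncurry_pi_pi (κ := κ) (ι := ι) (gaussianReal 0 v))
    (by fun_prop)] at h2
  simpa only [Fintype.sum_prod_type] using h2

/-- The squared norm of `Rᵀ g` for a fixed vector `g`. -/
lemma expLE_transpose_norm (g : κ → ℝ) :
    ExpLE (gaussMatrix κ ι v) (fun R => (∑ i, (∑ k, g k * R k i) ^ 2 -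
        Fintype.card ι * (v * ∑ k, g k ^ 2)) ^ 2)
      (Fintype.card ι * (gaussFourth * v ^ 2 * (∑ k, g k ^ 2) ^ 2)) := by
  have h := sketch_expLE (κ := ι) (ι := κ) v g g
  rw [ExpLE.of_map (by fun_prop) (map_transpose_pi_pi (κ := κ) (ι := ι) (gaussianReal 0 v))
    (by fun_prop)] at h
  convert h using 1
  · simp only [sq]
  · ring

/-- The eighth moment of the standard Gaussian. -/
noncomputable def gaussEighth : ℝ := ∫ x, x ^ 8 ∂gaussianReal 0 1

lemma gaussEighth_nonneg : 0 ≤ gaussEighth := integral_nonneg fun x => by positivity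

lemma integral_eighth_gaussianReal (v : ℝ≥0) :
    ∫ x, x ^ 8 ∂gaussianReal 0 v = gaussEighth * v ^ 4 := by
  have h : gaussianReal 0 v = (gaussianReal 0 1).map (fun x => √(v : ℝ) * x) := by
    rw [gaussianReal_map_const_mul]
    congr 1
    · simp
    · ext; simp [Real.sq_sqrt]
  rw [h, integral_map (by fun_prop) (by fun_prop), gaussEighth, ← integral_mul_const]
  congr 1 with x
  have : √(v : ℝ) ^ 8 = (v : ℝ) ^ 4 := by
    rw [show (8 : ℕ) = 2 * 4 from rfl, pow_mul, Real.sq_sqrt v.coe_nonneg]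
  rw [mul_pow, this]; ring

/-- A Gaussian vector is a Gaussian matrix with a single column, so the sketch bound applies with
both vectors equal to 1. -/
lemma expLE_gauss_norm_sub :
    ExpLE (Measure.pi fun _ : κ => gaussianReal 0 v)
      (fun g => (∑ k, g k ^ 2 - Fintype.card κ * v) ^ 2)
      (Fintype.card κ * (gaussFourth * v ^ 2)) := by
  have h := sketch_expLE (κ := κ) (ι := Unit) v (fun _ => 1) (fun _ => 1)
  have hmp := Measure.pi_map_pi (ι := κ) (μ := fun _ => Measure.pi fun _ : Unit => gaussianReal 0 v)
    (f := fun _ x => x ()) (hμ := fun _ => by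
      have := (measurePreserving_eval (fun _ : Unit => gaussianReal 0 v) ()).map_eq
      rw [show (fun x : Unit → ℝ => x ()) = Function.eval () from rfl, this]
      infer_instance) (fun _ => (measurable_pi_apply ()).aemeasurable)
  have := (measurePreserving_eval (fun _ : Unit => gaussianReal 0 v) ()).map_eq
  rw [show (fun x : Unit → ℝ => x ()) = Function.eval () from rfl, this] at hmp
  rw [ExpLE.of_map (by fun_prop) hmp (by fun_prop)]
  simpa [sq] using h

/-- Power mean inequality (Σ g²)⁴ ≤ card³ Σ g⁸, then eighth moments entry by entry. -/
lemma expLE_gauss_norm_pow :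
    ExpLE (Measure.pi fun _ : κ => gaussianReal 0 v) (fun g => (∑ k, g k ^ 2) ^ 4)
      (gaussEighth * (Fintype.card κ * v) ^ 4) := by
  have h1 : ∀ k, ExpLE (Measure.pi fun _ : κ => gaussianReal 0 v) (fun g => g k ^ 8)
      (gaussEighth * v ^ 4) := by
    intro k
    have := ExpLE.of_integral (integrable_pow_gaussianReal v 8) (fun x => by positivity)
      (integral_eighth_gaussianReal v).le
    exact (ExpLE.of_map (measurable_pi_apply k)
      (measurePreserving_eval (fun _ : κ => gaussianReal 0 v) k).map_eq (by fun_prop)).1 this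
  have h2 := (ExpLE.sum Finset.univ (fun k _ => h1 k) (fun k => by fun_prop)
    (fun k => mul_nonneg gaussEighth_nonneg (by positivity))).const_mul
    (c := (Fintype.card κ : ℝ) ^ 3) (by positivity)
  refine (h2.mono (ae_of_all _ fun g => ?_)).mono_right (le_of_eq ?_)
  · have := pow_sum_le_card_mul_sum_pow (s := Finset.univ) (f := fun k => g k ^ 2)
      (fun k _ => sq_nonneg _) 3
    simpa [← pow_mul] using this
  · simp; ring

end MatrixForm

/-! ### The vector `Rᵀ R ξ` -/

section Eta

variable {κ ι : Type*} [Fintype κ] [Fintype ι]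

/-- The vector `Rᵀ R ξ`. -/
def gramVec (ξ : ι → ℝ) (R : κ → ι → ℝ) (i : ι) : ℝ := ∑ k, R k i * ∑ l, ξ l * R k l

/-- For ξ = s e, replacing the component of each row along e by an independent g makes Rξ equal to s
g. Given g, the vector RᵀRξ is then affine in a fresh Gaussian matrix, so linear-form moments apply.
-/
lemma gramVec_replace (e : ι → ℝ) (he : ∑ i, e i ^ 2 = 1) (s : ℝ) (R : κ → ι → ℝ) (g : κ → ℝ)
    (i : ι) :
    gramVec (fun l => s * e l) (fun k i => R k i - (∑ l, e l * R k l) * e i + g k * e i) i =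
      s * (∑ k, g k * R k i + (∑ k, g k ^ 2 - ∑ k, ∑ l, g k * e l * R k l) * e i) := by
  have h1 : ∀ k, ∑ l, s * e l * (R k l - (∑ l, e l * R k l) * e l + g k * e l) = s * g k := by
    intro k
    have : ∀ l, s * e l * (R k l - (∑ l, e l * R k l) * e l + g k * e l) =
        s * (e l * R k l) + s * (g k - ∑ l, e l * R k l) * e l ^ 2 := fun l => by ring
    simp only [this]
    rw [Finset.sum_add_distrib, ← Finset.mul_sum, ← Finset.mul_sum, he]
    ring
  simp only [gramVec, h1]
  have h2 : ∀ k, (R k i - (∑ l, e l * R k l) * e i + g k * e i) * (s * g k) =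
      s * (g k * R k i) + s * e i * (g k ^ 2) - s * e i * ∑ l, g k * e l * R k l := by
    intro k
    simp only [mul_assoc (g k), ← Finset.mul_sum]
    ring
  simp only [h2]
  rw [Finset.sum_sub_distrib, Finset.sum_add_distrib, ← Finset.mul_sum, ← Finset.mul_sum,
    ← Finset.mul_sum]
  ring

/-- With γ = ‖g‖² and τ = gᵀRe, the inner product of Rᵀg with e is τ, and 2(γ - τ)τ + (γ - τ)² = γ²
- τ². -/
lemma sum_gramVec_replace_sq (e : ι → ℝ) (he : ∑ i, e i ^ 2 = 1) (s : ℝ) (R : κ → ι → ℝ)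
    (g : κ → ℝ) :
    ∑ i, gramVec (fun l => s * e l)
        (fun k i => R k i - (∑ l, e l * R k l) * e i + g k * e i) i ^ 2 =
      s ^ 2 * (∑ i, (∑ k, g k * R k i) ^ 2 + (∑ k, g k ^ 2) ^ 2 -
        (∑ k, ∑ l, g k * e l * R k l) ^ 2) := by
  simp only [gramVec_replace e he]
  set γ := ∑ k, g k ^ 2
  set τ := ∑ k, ∑ l, g k * e l * R k l with hτ
  have h1 : ∑ i, (∑ k, g k * R k i) * e i = τ := by
    rw [hτ, Finset.sum_comm]
    refine Finset.sum_congr rfl fun i _ => ?_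
    rw [Finset.sum_mul]
    exact Finset.sum_congr rfl fun k _ => by ring
  have h2 : ∀ i, (s * (∑ k, g k * R k i + (γ - τ) * e i)) ^ 2 =
      s ^ 2 * (∑ k, g k * R k i) ^ 2 + s ^ 2 * (2 * (γ - τ)) * ((∑ k, g k * R k i) * e i) +
        s ^ 2 * (γ - τ) ^ 2 * e i ^ 2 := fun i => by ring
  simp only [h2]
  rw [Finset.sum_add_distrib, Finset.sum_add_distrib, ← Finset.mul_sum, ← Finset.mul_sum,
    ← Finset.mul_sum, h1, he]
  ring

end Eta

section Eta

variable {κ ι : Type*} [Fintype κ] [Fintype ι]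

lemma exists_unit_of_ne_zero {ξ : ι → ℝ} (h : ∑ i, ξ i ^ 2 ≠ 0) :
    ∃ e : ι → ℝ, ∑ i, e i ^ 2 = 1 ∧ ξ = fun i => √(∑ i, ξ i ^ 2) * e i := by
  have h0 : 0 ≤ ∑ i, ξ i ^ 2 := Finset.sum_nonneg fun i _ => sq_nonneg _
  have hs : √(∑ i, ξ i ^ 2) ≠ 0 := by
    rw [Real.sqrt_ne_zero h0]; exact h
  refine ⟨fun i => ξ i / √(∑ i, ξ i ^ 2), ?_, ?_⟩
  · simp only [div_pow, Real.sq_sqrt h0, ← Finset.sum_div]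
    exact div_self h
  · ext i; field_simp

lemma gramVec_zero (R : κ → ι → ℝ) (i : ι) : gramVec (0 : ι → ℝ) R i = 0 := by simp [gramVec]

lemma eq_zero_of_sum_sq {ξ : ι → ℝ} (h : ∑ i, ξ i ^ 2 = 0) : ξ = 0 := by
  ext i
  have := (Finset.sum_eq_zero_iff_of_nonneg (fun i _ => sq_nonneg (ξ i))).1 h i (Finset.mem_univ i)
  simpa using this

/-- Constant in the bound for the norm of `Rᵀ R ξ`. -/
noncomputable def gramConst : ℝ := gaussFourth + 5 + gaussFourth * (gaussFourth + 4)

lemma gramConst_nonneg : 0 ≤ gramConst := by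
  have := gaussFourth_nonneg; unfold gramConst; positivity

/-- Young's inequality with a free scale B turns second-moment bounds into first-moment ones; B is
taken of the order of the standard deviation of x. -/
lemma abs_le_sq_div {x B : ℝ} (hB : 0 < B) : |x| ≤ 1 / (2 * B) * x ^ 2 + B / 2 := by
  have h : 1 / (2 * B) * x ^ 2 + B / 2 - |x| = (|x| - B) ^ 2 / (2 * B) := by
    rw [← sq_abs x]; field_simp; ring
  have : 0 ≤ (|x| - B) ^ 2 / (2 * B) := by positivity
  linarith

/-- Given `g`, the expectation over `R` of the error in the squared norm. -/
lemma expLE_inner_norm [Nonempty ι] (e : ι → ℝ) (he : ∑ i, e i ^ 2 = 1) (q : ℝ)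
    (hq : 1 ≤ q) (v : ℝ≥0) (hv : (v : ℝ) = 1 / q ^ 2) (g : κ → ℝ) :
    ExpLE (gaussMatrix κ ι v) (fun R => |∑ i, (∑ k, g k * R k i) ^ 2 + (∑ k, g k ^ 2) ^ 2 -
        (∑ k, ∑ l, g k * e l * R k l) ^ 2 - (1 + Fintype.card ι / q ^ 2)|)
      ((√(Fintype.card ι) * gaussFourth / q ^ 2 + 3 / q ^ 2 + √(Fintype.card ι) / (2 * q ^ 2) +
          (Fintype.card ι / q ^ 2 + 2) / (2 * q)) +
        (√(Fintype.card ι) * gaussFourth / q ^ 2 + 2 / q ^ 2 +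
          (Fintype.card ι / q ^ 2 + 2) * q / 2 + 1) * (∑ k, g k ^ 2 - 1) ^ 2) := by
  have hK := gaussFourth_nonneg
  set K := gaussFourth
  set n : ℝ := (Fintype.card ι : ℝ) with hn
  have hn1 : 0 < n := by rw [hn]; exact_mod_cast Fintype.card_pos
  set m := √n with hm
  have hm0 : 0 < m := Real.sqrt_pos.2 hn1
  have hmn : n = m ^ 2 := (Real.sq_sqrt hn1.le).symm
  set γ := ∑ k, g k ^ 2 with hγ
  have hγ0 : 0 ≤ γ := Finset.sum_nonneg fun k _ => sq_nonneg _
  have hq0 : 0 < q := by linarith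
  -- Young's scale is √n/r (here m = √n and q = √r), the order of the fluctuations of ‖Rᵀg‖². For γ
  -- - 1 below the scale is 1/√r.
  have h1 := (expLE_transpose_norm (κ := κ) (ι := ι) v g).const_mul
    (c := 1 / (2 * (m / q ^ 2))) (by positivity)
  have h2 := expLE_matrixForm_sq (κ := κ) (ι := ι) v (fun k l => g k * e l)
  have h2' : (v : ℝ) * ∑ k, ∑ i, (g k * e i) ^ 2 = γ / q ^ 2 := by
    simp only [mul_pow, ← Finset.mul_sum, he, mul_one, hv]
    rw [← hγ]; ring
  rw [h2'] at h2
  have h3 : ExpLE (gaussMatrix κ ι v) (fun _ => m / (2 * q ^ 2) +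
      (n / q ^ 2 + 2) * (q / 2 * (γ - 1) ^ 2 + 1 / (2 * q)) + (γ - 1) ^ 2)
      (m / (2 * q ^ 2) + (n / q ^ 2 + 2) * (q / 2 * (γ - 1) ^ 2 + 1 / (2 * q)) + (γ - 1) ^ 2) :=
    ExpLE.const _
  have h4 := h1.add (h2.add h3 (by fun_prop) (by positivity) (by positivity)) (by fun_prop)
    (by positivity) (by positivity)
  refine (h4.mono (ae_of_all _ fun R => ?_)).mono_right ?_
  · set H := ∑ i, (∑ k, g k * R k i) ^ 2
    set τ := ∑ k, ∑ l, g k * e l * R k l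
    have e1 : |H - n * (v * γ)| ≤
        1 / (2 * (m / q ^ 2)) * (H - n * (v * γ)) ^ 2 + (m / q ^ 2) / 2 :=
      abs_le_sq_div (by positivity)
    have e2 : |γ - 1| ≤ q / 2 * (γ - 1) ^ 2 + 1 / (2 * q) := by
      have := abs_le_sq_div (x := γ - 1) (B := 1 / q) (by positivity)
      refine this.trans (le_of_eq ?_)
      field_simp
    -- Expansion around γ = 1, the mean of ‖g‖², using γ² - 1 = 2(γ - 1) + (γ - 1)².
    have e3 : H + γ ^ 2 - τ ^ 2 - (1 + n / q ^ 2) =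
        (H - n * (v * γ)) - τ ^ 2 + (n / q ^ 2 + 2) * (γ - 1) + (γ - 1) ^ 2 := by
      rw [hv]; ring
    rw [e3]
    have e4 : |(H - n * (v * γ)) - τ ^ 2 + (n / q ^ 2 + 2) * (γ - 1) + (γ - 1) ^ 2| ≤
        |H - n * (v * γ)| + τ ^ 2 + (n / q ^ 2 + 2) * |γ - 1| + (γ - 1) ^ 2 := by
      refine (abs_add_le _ _).trans ?_
      rw [abs_of_nonneg (sq_nonneg (γ - 1))]
      gcongr
      refine (abs_add_le _ _).trans ?_
      rw [abs_mul, abs_of_nonneg (show 0 ≤ n / q ^ 2 + 2 by positivity)]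
      gcongr
      refine (abs_sub _ _).trans ?_
      rw [abs_of_nonneg (sq_nonneg τ)]
    have e5 : (n / q ^ 2 + 2) * |γ - 1| ≤
      (n / q ^ 2 + 2) * (q / 2 * (γ - 1) ^ 2 + 1 / (2 * q)) :=
      mul_le_mul_of_nonneg_left e2 (by positivity)
    have e6 : (m / q ^ 2) / 2 = m / (2 * q ^ 2) := by field_simp
    linarith
  · have e1 : 1 / (2 * (m / q ^ 2)) * (n * (K * v ^ 2 * γ ^ 2)) = m * K / q ^ 2 * (γ ^ 2 / 2) := by
      rw [hv, hmn]; field_simp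
    have e2 : γ ^ 2 / 2 ≤ 1 + (γ - 1) ^ 2 := by nlinarith [sq_nonneg (γ - 2)]
    have e3 : γ ≤ 3 + 2 * (γ - 1) ^ 2 := by nlinarith [sq_nonneg (γ - 1)]
    have e4 : m * K / q ^ 2 * (γ ^ 2 / 2) ≤ m * K / q ^ 2 * (1 + (γ - 1) ^ 2) :=
      mul_le_mul_of_nonneg_left e2 (by positivity)
    have e5 : γ / q ^ 2 ≤ (3 + 2 * (γ - 1) ^ 2) / q ^ 2 := by gcongr
    rw [e1]
    refine (add_le_add e4 (add_le_add_left e5 _)).trans (le_of_eq ?_)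
    field_simp
    ring

/-- The squared norm of `Rᵀ R ξ` is close to `(1 + n / r) ‖ξ‖²`. -/
lemma expLE_gramVec_norm [Nonempty κ] (ξ : ι → ℝ) :
    ExpLE (gaussMatrix κ ι (Fintype.card κ : ℝ≥0)⁻¹)
      (fun R => |∑ i, gramVec ξ R i ^ 2 -
        (∑ i, ξ i ^ 2) * (1 + Fintype.card ι / Fintype.card κ)|)
      ((∑ i, ξ i ^ 2) *
        (gramConst * (1 + Fintype.card ι / Fintype.card κ) / √(Fintype.card κ))) := by
  by_cases h0 : ∑ i, ξ i ^ 2 = 0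
  · have := eq_zero_of_sum_sq h0
    subst this
    simp [gramVec_zero, ExpLE]
  have hne : Nonempty ι := by
    by_contra h
    rw [not_nonempty_iff] at h
    simp at h0
  obtain ⟨e, he, hξ⟩ := exists_unit_of_ne_zero h0
  set s := √(∑ i, ξ i ^ 2) with hs
  have hs2 : ∑ i, ξ i ^ 2 = s ^ 2 :=
    (Real.sq_sqrt (Finset.sum_nonneg fun i _ => sq_nonneg _)).symm
  rw [hs2]
  clear_value s
  subst hξ
  set v : ℝ≥0 := (Fintype.card κ : ℝ≥0)⁻¹ with hv
  set r : ℝ := (Fintype.card κ : ℝ) with hr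
  have hr1 : 1 ≤ r := by rw [hr]; exact_mod_cast Fintype.card_pos
  set q := √r with hq
  have hrq : r = q ^ 2 := (Real.sq_sqrt (by linarith)).symm
  have hq1 : 1 ≤ q := by rw [hq]; exact Real.one_le_sqrt.2 hr1
  have hq0 : 0 < q := by linarith
  have hvq : (v : ℝ) = 1 / q ^ 2 := by rw [hv, ← hrq]; simp [hr]
  set n : ℝ := (Fintype.card ι : ℝ) with hn
  -- Pass to the representation with an independent g = Rξ/s; the bound is then averaged over R with
  -- g fixed, and over g last.
  rw [ExpLE.of_map (by fun_prop) (map_replace_component (κ := κ) v e he) (by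
    unfold gramVec; fun_prop)]
  simp only [sum_gramVec_replace_sq e he]
  have hK := gaussFourth_nonneg
  set K := gaussFourth
  set m := √n with hm
  have hm0 : 0 ≤ m := Real.sqrt_nonneg _
  have hmn : n = m ^ 2 := (Real.sq_sqrt (by positivity)).symm
  set A := m * K / q ^ 2 + 3 / q ^ 2 + m / (2 * q ^ 2) + (n / q ^ 2 + 2) / (2 * q) with hA
  set D := m * K / q ^ 2 + 2 / q ^ 2 + (n / q ^ 2 + 2) * q / 2 + 1 with hD
  have hA0 : 0 ≤ A := by positivity
  have hD0 : 0 ≤ D := by positivity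
  have hg := (expLE_gauss_norm_sub (κ := κ) v).const_mul (c := D) hD0
  have hrv : r * v = 1 := by rw [hvq, ← hrq]; field_simp
  rw [← hr, hrv] at hg
  have hg2 := ((ExpLE.const (μ := Measure.pi fun _ : κ => gaussianReal 0 v) A).add hg (by fun_prop)
    hA0 (by positivity)).const_mul (sq_nonneg s)
  refine ((ExpLE.prod_right (by fun_prop) (ae_of_all _ fun g => ?_) hg2).mono_right ?_)
  · refine ((expLE_inner_norm e he q hq1 v hvq g).const_mul (sq_nonneg s)).mono
      (ae_of_all _ fun R => le_of_eq ?_)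
    rw [hrq, ← mul_sub, abs_mul, abs_of_nonneg (sq_nonneg s)]
  · refine mul_le_mul_of_nonneg_left ?_ (sq_nonneg s)
    have e0 : r * (K * (v : ℝ) ^ 2) = K / q ^ 2 := by rw [hvq, hrq]; field_simp
    rw [e0]
    -- With u = √(n/r) every term becomes a polynomial in u and 1/q, with one factor 1/q = 1/√r to
    -- spare. The two parts of `gramConst` bound A and D times the variance of ‖g‖².
    set u := m / q with hu
    have hu0 : 0 ≤ u := by positivity
    have hmu : m = u * q := by rw [hu]; field_simp
    have hnq : n / q ^ 2 = u ^ 2 := by rw [hmn, hmu]; field_simp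
    have hnr : n / r = u ^ 2 := by rw [hrq, hnq]
    have hq' : 1 / q ≤ 1 := by rw [div_le_one hq0]; exact hq1
    have hA' : A = (u * K + 3 * (1 / q) + u / 2 + (u ^ 2 + 2) / 2) / q := by
      rw [hA, hnq, hmu]; field_simp
    have hD' : D * (K / q ^ 2) =
        K * (u * K * (1 / q ^ 2) + 2 * (1 / q ^ 3) + (u ^ 2 + 2) / 2 + 1 / q) / q := by
      rw [hD, hnq, hmu]; field_simp
    have hq2 : 1 / q ^ 2 ≤ 1 := by rw [div_le_one (by positivity)]; exact one_le_pow₀ hq1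
    have hq3 : 1 / q ^ 3 ≤ 1 := by rw [div_le_one (by positivity)]; exact one_le_pow₀ hq1
    rw [hA', hD', hnr, ← add_div]
    gcongr
    have f1 : u ≤ 1 + u ^ 2 := by nlinarith [sq_nonneg (u - 1)]
    have f2 : u * K ≤ (1 + u ^ 2) * K := mul_le_mul_of_nonneg_right f1 hK
    have f3 : u * K * (1 / q ^ 2) ≤ (1 + u ^ 2) * K := by
      calc u * K * (1 / q ^ 2) ≤ u * K * 1 := by gcongr
        _ ≤ _ := by rw [mul_one]; exact f2
    have f4 : u * K + 3 * (1 / q) + u / 2 + (u ^ 2 + 2) / 2 ≤ (K + 5) * (1 + u ^ 2) := by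
      rw [show (K + 5) * (1 + u ^ 2) = (1 + u ^ 2) * K + 5 + 5 * u ^ 2 by ring]
      linarith [sq_nonneg u]
    have f5 : u * K * (1 / q ^ 2) + 2 * (1 / q ^ 3) + (u ^ 2 + 2) / 2 + 1 / q ≤
      (K + 4) * (1 + u ^ 2) := by
      rw [show (K + 4) * (1 + u ^ 2) = (1 + u ^ 2) * K + 4 + 4 * u ^ 2 by ring]
      linarith [sq_nonneg u]
    have f6 := mul_le_mul_of_nonneg_left f5 hK
    have f7 : gramConst * (1 + u ^ 2) =
        (K + 5) * (1 + u ^ 2) + K * ((K + 4) * (1 + u ^ 2)) := by unfold gramConst; ring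
    rw [f7]
    exact add_le_add f4 f6

/-- Constant in the bound for the fourth powers of the entries of `Rᵀ R ξ`. -/
noncomputable def gramConst' : ℝ := 27 * (gaussFourth * (1 + gaussEighth) + gaussEighth)

lemma gramConst'_nonneg : 0 ≤ gramConst' := by
  have := gaussFourth_nonneg; have := gaussEighth_nonneg; unfold gramConst'; positivity

lemma add_three_pow_four_le (a b c : ℝ) :
    (a + b + c) ^ 4 ≤ 27 * (a ^ 4 + b ^ 4 + c ^ 4) := by
  have h1 : (a + b + c) ^ 2 ≤ 3 * (a ^ 2 + b ^ 2 + c ^ 2) := by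
    nlinarith [sq_nonneg (a - b), sq_nonneg (b - c), sq_nonneg (a - c)]
  have h2 : (a ^ 2 + b ^ 2 + c ^ 2) ^ 2 ≤ 3 * (a ^ 4 + b ^ 4 + c ^ 4) := by
    nlinarith [sq_nonneg (a ^ 2 - b ^ 2), sq_nonneg (b ^ 2 - c ^ 2), sq_nonneg (a ^ 2 - c ^ 2)]
  calc (a + b + c) ^ 4 = ((a + b + c) ^ 2) ^ 2 := by ring
    _ ≤ (3 * (a ^ 2 + b ^ 2 + c ^ 2)) ^ 2 := by gcongr
    _ ≤ _ := by nlinarith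

/-- No entry of `Rᵀ R ξ` dominates. -/
lemma expLE_gramVec_fourth [Nonempty κ] (ξ : ι → ℝ) :
    ExpLE (gaussMatrix κ ι (Fintype.card κ : ℝ≥0)⁻¹) (fun R => ∑ i, gramVec ξ R i ^ 4)
      (gramConst' * ((∑ i, ξ i ^ 2) ^ 2 * Fintype.card ι / (Fintype.card κ : ℝ) ^ 2 +
        ∑ i, ξ i ^ 4)) := by
  classical
  by_cases h0 : ∑ i, ξ i ^ 2 = 0
  · have := eq_zero_of_sum_sq h0
    subst this
    simp [gramVec_zero, ExpLE]
  obtain ⟨e, he, hξ⟩ := exists_unit_of_ne_zero h0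
  set s := √(∑ i, ξ i ^ 2) with hs
  have hs2 : ∑ i, ξ i ^ 2 = s ^ 2 :=
    (Real.sq_sqrt (Finset.sum_nonneg fun i _ => sq_nonneg _)).symm
  rw [hs2]
  clear_value s
  subst hξ
  set v : ℝ≥0 := (Fintype.card κ : ℝ≥0)⁻¹ with hv
  set r : ℝ := (Fintype.card κ : ℝ) with hr
  have hr1 : 1 ≤ r := by rw [hr]; exact_mod_cast Fintype.card_pos
  have hvr : (v : ℝ) = 1 / r := by rw [hv]; simp [hr]
  set n : ℝ := (Fintype.card ι : ℝ) with hn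
  set E4 := ∑ i, (s * e i) ^ 4 with hE4
  have hE40 : 0 ≤ E4 := Finset.sum_nonneg fun i _ => by positivity
  rw [ExpLE.of_map (by fun_prop) (map_replace_component (κ := κ) v e he) (by
    unfold gramVec; fun_prop)]
  simp only [gramVec_replace e he]
  have hK := gaussFourth_nonneg
  set K := gaussFourth
  have hK8 := gaussEighth_nonneg
  set K8 := gaussEighth
  have hrv : r * v = 1 := by rw [hvr]; field_simp
  have hg1 := expLE_gauss_norm_pow (κ := κ) v
  rw [← hr, hrv, one_pow, mul_one] at hg1
  have hg2 := (((ExpLE.const (μ := Measure.pi fun _ : κ => gaussianReal 0 v) 1).add hg1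
    (by fun_prop) zero_le_one hK8).const_mul (c := 27 * (s ^ 4 * n * K / r ^ 2 + E4 * K))
    (by positivity)).add (hg1.const_mul (c := 27 * E4) (by positivity)) (by fun_prop)
    (by positivity) (by positivity)
  refine (ExpLE.prod_right (g := fun g => 27 * (s ^ 4 * n * K / r ^ 2 + E4 * K) *
      (1 + (∑ k, g k ^ 2) ^ 4) + 27 * E4 * (∑ k, g k ^ 2) ^ 4)
      (by fun_prop) (ae_of_all _ fun g => ?_) hg2).mono_right ?_
  · set γ := ∑ k, g k ^ 2 with hγ
    have h1 : ∀ i, ExpLE (gaussMatrix κ ι v) (fun R => (∑ k, g k * R k i) ^ 4)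
        (K * (v * γ) ^ 2) := by
      intro i
      -- Entry i of Rᵀg is the linear form with coefficients g in column i and 0 elsewhere.
      have h := expLE_matrixForm_fourth (κ := κ) (ι := ι) v (fun k l => if l = i then g k else 0)
      simpa [ite_pow, hγ] using h
    have h2 := expLE_matrixForm_fourth (κ := κ) (ι := ι) v (fun k l => g k * e l)
    have h2' : ∑ k, ∑ i, (g k * e i) ^ 2 = γ := by
      simp only [mul_pow, ← Finset.mul_sum, he, mul_one]; rfl
    rw [h2'] at h2
    have h3 := (ExpLE.sum Finset.univ (fun i _ => h1 i) (fun i => by fun_prop)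
      (fun i => by positivity)).const_mul (c := 27 * s ^ 4) (by positivity)
    have h4 := (h2.add (ExpLE.const (μ := gaussMatrix κ ι v) (γ ^ 4)) (by fun_prop)
      (by positivity) (by positivity)).const_mul (c := 27 * E4) (by positivity)
    refine ((h3.add h4 (by fun_prop) (by positivity) (by positivity)).mono
      (ae_of_all _ fun R => ?_)).mono_right ?_
    · set τ := ∑ k, ∑ l, g k * e l * R k l
      -- Three contributions: s(Rᵀg)ᵢ, which is spread over all entries, and the multiples γ and -τ
      -- of ξᵢ = s eᵢ, which are small entrywise as soon as Σ ξᵢ⁴ is.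
      have : ∀ i, (s * (∑ k, g k * R k i + (γ - τ) * e i)) ^ 4 ≤
          27 * s ^ 4 * (∑ k, g k * R k i) ^ 4 + 27 * (τ ^ 4 + γ ^ 4) * (s * e i) ^ 4 := by
        intro i
        have := add_three_pow_four_le (s * ∑ k, g k * R k i) (γ * (s * e i)) (-(τ * (s * e i)))
        calc (s * (∑ k, g k * R k i + (γ - τ) * e i)) ^ 4
            = (s * ∑ k, g k * R k i + γ * (s * e i) + -(τ * (s * e i))) ^ 4 := by ring
          _ ≤ _ := this
          _ = _ := by ring
      refine (Finset.sum_le_sum fun i _ => this i).trans (le_of_eq ?_)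
      rw [Finset.sum_add_distrib, ← Finset.mul_sum, ← Finset.mul_sum]
      ring
    · have hγ2 : γ ^ 2 ≤ 1 + γ ^ 4 := by nlinarith [sq_nonneg (γ ^ 2 - 1)]
      have hv2 : 1 / r ^ 2 ≤ 1 := by rw [div_le_one (by positivity)]; exact one_le_pow₀ hr1
      simp only [Finset.sum_const, Finset.card_univ, nsmul_eq_mul]
      rw [← hn, hvr]
      have e1 : 27 * s ^ 4 * (n * (K * (1 / r * γ) ^ 2)) = 27 * (s ^ 4 * n * K / r ^ 2) * γ ^ 2 := by
        ring
      have e2 : K * (1 / r * γ) ^ 2 ≤ K * (1 + γ ^ 4) := by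
        have : (1 / r * γ) ^ 2 ≤ 1 + γ ^ 4 := by
          calc (1 / r * γ) ^ 2 = 1 / r ^ 2 * γ ^ 2 := by ring
            _ ≤ 1 * γ ^ 2 := by gcongr
            _ ≤ _ := by linarith
        exact mul_le_mul_of_nonneg_left this hK
      have e3 : 27 * (s ^ 4 * n * K / r ^ 2) * γ ^ 2 ≤
          27 * (s ^ 4 * n * K / r ^ 2) * (1 + γ ^ 4) :=
        mul_le_mul_of_nonneg_left hγ2 (by positivity)
      have e4 : 27 * E4 * (K * (1 / r * γ) ^ 2) ≤ 27 * E4 * (K * (1 + γ ^ 4)) :=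
        mul_le_mul_of_nonneg_left e2 (by positivity)
      rw [e1]
      linarith
  · have e1 : 0 ≤ s ^ 4 * n / r ^ 2 := by positivity
    have e2 : 0 ≤ s ^ 4 * n / r ^ 2 * K8 := by positivity
    have e3 : (s ^ 2) ^ 2 * n / r ^ 2 = s ^ 4 * n / r ^ 2 := by ring
    have e4 : s ^ 4 * n * K / r ^ 2 = s ^ 4 * n / r ^ 2 * K := by ring
    rw [e3, e4]
    set x := s ^ 4 * n / r ^ 2
    have e5 : gramConst' * (x + E4) = 27 * (x * K + E4 * K) * (1 + K8) + 27 * E4 * K8 +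
        27 * (x * K8) := by unfold gramConst'; ring
    rw [e5]
    linarith
end Eta

/-! ### Central limit theorem for weighted sums -/

/-- Lindeberg replacement: factors are exchanged one at a time, and all others lie in the unit disc.
-/
lemma norm_prod_sub_prod_le {ι : Type*} (s : Finset ι) (z w : ι → ℂ) (hz : ∀ i, ‖z i‖ ≤ 1)
    (hw : ∀ i, ‖w i‖ ≤ 1) :
    ‖∏ i ∈ s, z i - ∏ i ∈ s, w i‖ ≤ ∑ i ∈ s, ‖z i - w i‖ := by
  classical
  induction s using Finset.induction_on with
  | empty => simp
  | insert i s hi ih =>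
    rw [Finset.prod_insert hi, Finset.prod_insert hi, Finset.sum_insert hi]
    have h1 : z i * ∏ j ∈ s, z j - w i * ∏ j ∈ s, w j =
      (z i - w i) * ∏ j ∈ s, z j + w i * (∏ j ∈ s, z j - ∏ j ∈ s, w j) := by ring
    rw [h1]
    refine (norm_add_le _ _).trans (add_le_add ?_ ?_)
    · rw [norm_mul]
      have : ‖∏ j ∈ s, z j‖ ≤ 1 := by
        rw [norm_prod]; exact Finset.prod_le_one (fun _ _ => norm_nonneg _) fun j _ => hz j
      exact mul_le_of_le_one_right (norm_nonneg _) this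
    · rw [norm_mul]
      exact (mul_le_of_le_one_left (norm_nonneg _) (hw i)).trans ih

/-- The law of `∑ aᵢ Xᵢ` for independent `Xᵢ` with law `D`. -/
noncomputable def linLaw (D : Measure ℝ) {n : ℕ} (a : Fin n → ℝ) : Measure ℝ :=
  (Measure.pi fun _ : Fin n => D).map fun x => ∑ i, x i * a i

section CLT

variable (D : Measure ℝ) [IsProbabilityMeasure D]

instance {n : ℕ} (a : Fin n → ℝ) : IsProbabilityMeasure (linLaw D a) :=
  Measure.isProbabilityMeasure_map (Measurable.aemeasurable (by fun_prop))

lemma charFun_linLaw {n : ℕ} (a : Fin n → ℝ) (t : ℝ) :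
    charFun (linLaw D a) t = ∏ i, charFun D (a i * t) := by
  have hind : iIndepFun (fun i (x : Fin n → ℝ) => x i * a i) (Measure.pi fun _ : Fin n => D) :=
    iIndepFun_pi (X := fun i (x : ℝ) => x * a i) (fun i => by fun_prop)
  rw [linLaw, hind.charFun_map_fun_sum_eq_prod
    (fun i => (by fun_prop : Measurable fun x : Fin n → ℝ => x i * a i).aemeasurable),
    Finset.prod_apply]
  refine Finset.prod_congr rfl fun i _ => ?_
  have : (fun x : Fin n → ℝ => x i * a i) = (fun y => a i * y) ∘ Function.eval i := by
    ext x; simp [mul_comm]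
  rw [this, ← Measure.map_map (by fun_prop) (by fun_prop), (measurePreserving_eval _ i).map_eq]
  have h2 := charFun_map_mul_comp (μ := D) (f := id) aemeasurable_id (a i) t
  simpa using h2

/-- Weights of norm close to `1` without a dominating entry. -/
def weightFilter : Filter (Σ n, Fin n → ℝ) :=
  comap (fun x => (∑ i, x.2 i ^ 2, ∑ i, x.2 i ^ 4)) (𝓝 ((1 : ℝ), (0 : ℝ)))

/-- Both laws have mean 0 and variance 1, so their second-order Taylor expansions at 0 coincide. -/
lemma charFun_sub_isLittleO (h0 : ∫ x, x ∂D = 0) (h1 : ∫ x, x ^ 2 ∂D = 1) :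
    (fun s => charFun D s - charFun (gaussianReal 0 1) s) =o[𝓝 0] fun s : ℝ => s ^ 2 := by
  have e1 := taylor_charFun_two (P := D) (X := id) aemeasurable_id (by simpa using h0)
    (by simpa using h1)
  have e2 := taylor_charFun_two (P := gaussianReal 0 1) (X := id) aemeasurable_id
    (by simp) (by simpa using integral_sq_gaussianReal 1)
  simp only [Measure.map_id] at e1 e2
  refine (e1.sub e2).congr_left fun s => by ring

/-- Σ aᵢ⁴ → 0 makes all aᵢ uniformly small, so each factor may be replaced by its Gaussian
counterpart at cost o(aᵢ²t²); the costs add up to o(1) because Σ aᵢ² stays bounded. The product of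
the Gaussian factors is the Gaussian characteristic function at √(Σ aᵢ²) t. -/
lemma tendsto_charFun_linLaw (h0 : ∫ x, x ∂D = 0) (h1 : ∫ x, x ^ 2 ∂D = 1) (t : ℝ) :
    Tendsto (fun x : Σ n, Fin n → ℝ => charFun (linLaw D x.2) t) weightFilter
      (𝓝 (charFun (gaussianReal 0 1) t)) := by
  have hT : Tendsto (fun x : Σ n, Fin n → ℝ => (∑ i, x.2 i ^ 2, ∑ i, x.2 i ^ 4)) weightFilter
      (𝓝 ((1 : ℝ), (0 : ℝ))) := tendsto_comap
  have hT2 : Tendsto (fun x : Σ n, Fin n → ℝ => ∑ i, x.2 i ^ 2) weightFilter (𝓝 1) :=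
    (continuous_fst.tendsto _).comp hT
  have hT4 : Tendsto (fun x : Σ n, Fin n → ℝ => ∑ i, x.2 i ^ 4) weightFilter (𝓝 0) :=
    (continuous_snd.tendsto _).comp hT
  have hg : ∀ x : Σ n, Fin n → ℝ, ∏ i, charFun (gaussianReal 0 1) (x.2 i * t) =
      charFun (gaussianReal 0 1) (√(∑ i, x.2 i ^ 2) * t) := by
    intro x
    simp only [charFun_gaussianReal]
    rw [← Complex.exp_sum]
    congr 1
    have h := Real.sq_sqrt (Finset.sum_nonneg fun i (_ : i ∈ Finset.univ) => sq_nonneg (x.2 i))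
    have h' : ((√(∑ i, x.2 i ^ 2) : ℝ) : ℂ) ^ 2 = ∑ i, (x.2 i : ℂ) ^ 2 := by
      rw [← Complex.ofReal_pow, h]; push_cast; rfl
    push_cast
    rw [mul_pow, h']
    simp only [mul_zero, zero_mul, zero_sub, one_mul, Finset.sum_neg_distrib, mul_pow,
      ← Finset.sum_div, Finset.sum_mul]
  have hlim : Tendsto (fun x : Σ n, Fin n → ℝ => ∏ i, charFun (gaussianReal 0 1) (x.2 i * t))
      weightFilter (𝓝 (charFun (gaussianReal 0 1) t)) := by
    simp only [hg]
    have hc : Continuous (charFun (gaussianReal 0 1)) := continuous_charFun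
    have : Tendsto (fun x : Σ n, Fin n → ℝ => √(∑ i, x.2 i ^ 2) * t) weightFilter (𝓝 t) := by
      simpa using (hT2.sqrt).mul_const t
    exact (hc.tendsto t).comp this
  refine tendsto_of_tendsto_of_dist hlim ?_
  rw [Metric.tendsto_nhds]
  intro ε hε
  have hlo := charFun_sub_isLittleO D h0 h1
  -- Summing this fraction of (aᵢt)² with Σ aᵢ² < 2 and t² ≤ t² + 1 gives at most ε/2.
  have hc : 0 < ε / (2 * (t ^ 2 + 1) * 2) := by positivity
  obtain ⟨δ, hδ, hδ2⟩ := Metric.eventually_nhds_iff.1 (hlo.def hc)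
  have hδt : 0 < (δ / (|t| + 1)) ^ 4 := by positivity
  filter_upwards [hT2.eventually (gt_mem_nhds (show (1 : ℝ) < 2 by norm_num)),
    hT4.eventually (gt_mem_nhds hδt)] with x hx2 hx4
  have hsmall : ∀ i, |x.2 i * t| < δ := by
    intro i
    have h4 : |x.2 i| ^ 4 < (δ / (|t| + 1)) ^ 4 := by
      refine lt_of_le_of_lt ?_ hx4
      rw [show |x.2 i| ^ 4 = x.2 i ^ 4 by
        rw [show (4 : ℕ) = 2 * 2 from rfl, pow_mul, pow_mul, sq_abs]]
      exact Finset.single_le_sum (f := fun i => x.2 i ^ 4) (fun j _ => by positivity)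
        (Finset.mem_univ i)
    have h5 := lt_of_pow_lt_pow_left₀ 4 (by positivity) h4
    rw [abs_mul]
    rw [lt_div_iff₀ (by positivity)] at h5
    nlinarith [abs_nonneg (x.2 i), abs_nonneg t]
  rw [dist_zero_right, Real.norm_of_nonneg dist_nonneg, dist_comm, dist_eq_norm, charFun_linLaw]
  calc _ ≤ ∑ i, ‖charFun D (x.2 i * t) - charFun (gaussianReal 0 1) (x.2 i * t)‖ :=
        norm_prod_sub_prod_le _ _ _ (fun i => norm_charFun_le_one _) (fun i => norm_charFun_le_one _)
    _ ≤ ∑ i, ε / (2 * (t ^ 2 + 1) * 2) * (x.2 i * t) ^ 2 := by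
        refine Finset.sum_le_sum fun i _ => ?_
        have := hδ2 (y := x.2 i * t) (by simpa using hsmall i)
        rwa [Real.norm_of_nonneg (sq_nonneg _)] at this
    _ = ε / (2 * (t ^ 2 + 1) * 2) * t ^ 2 * ∑ i, x.2 i ^ 2 := by
        rw [Finset.mul_sum]; exact Finset.sum_congr rfl fun i _ => by ring
    _ ≤ ε / (2 * (t ^ 2 + 1) * 2) * (t ^ 2 + 1) * 2 := by
        gcongr
        linarith
    _ = ε / 2 := by field_simp
    _ < ε := by linarith

/-- `linLaw` as a bundled probability measure. -/
noncomputable def linLawPM (x : Σ n, Fin n → ℝ) : ProbabilityMeasure ℝ := ⟨linLaw D x.2, inferInstance⟩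

/-- The standard Gaussian as a bundled probability measure. -/
noncomputable def stdGaussPM : ProbabilityMeasure ℝ := ⟨gaussianReal 0 1, inferInstance⟩

lemma tendsto_linLaw (h0 : ∫ x, x ∂D = 0) (h1 : ∫ x, x ^ 2 ∂D = 1) :
    Tendsto (linLawPM D) weightFilter (𝓝 stdGaussPM) := by
  -- Lévy's continuity theorem is applied to sequences, which detect limits along a countably
  -- generated filter.
  have : weightFilter.IsCountablyGenerated := by unfold weightFilter; infer_instance
  refine tendsto_of_seq_tendsto fun x hx => ?_
  exact ProbabilityMeasure.tendsto_of_tendsto_charFun fun t =>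
    (tendsto_charFun_linLaw D h0 h1 t).comp hx

lemma tendsto_linLaw_Iic (h0 : ∫ x, x ∂D = 0) (h1 : ∫ x, x ^ 2 ∂D = 1) (t : ℝ) :
    Tendsto (fun x : Σ n, Fin n → ℝ => (linLaw D x.2).real (Iic t)) weightFilter
      (𝓝 ((gaussianReal 0 1).real (Iic t))) := by
  have : NullSingletonClass (gaussianReal 0 1) := nullSingletonClass_gaussianReal one_ne_zero
  have h := ProbabilityMeasure.tendsto_measure_of_null_frontier_of_tendsto'
    (tendsto_linLaw D h0 h1) (E := Iic t) (by simp [stdGaussPM])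
  exact (ENNReal.tendsto_toReal (by simp)).comp h

end CLT

/-! ### Uniform closeness to the Gaussian law on half-lines and intervals -/

lemma exists_cdf_gaussian {c : ℝ} (hc : c ∈ Ioo (0 : ℝ) 1) :
    ∃ t, (gaussianReal 0 1).real (Iic t) = c := by
  have : NullSingletonClass (gaussianReal 0 1) := nullSingletonClass_gaussianReal one_ne_zero
  have hcont : Continuous (cdf (gaussianReal 0 1)) := by
    refine continuous_iff_continuousAt.2 fun x => ?_
    rw [(monotone_cdf _).continuousAt_iff_leftLim_eq_rightLim, StieltjesFunction.rightLim_eq]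
    have h := (cdf (gaussianReal 0 1)).measure_singleton x
    rw [measure_cdf, measure_singleton] at h
    have h2 := ENNReal.ofReal_eq_zero.1 h.symm
    exact le_antisymm ((monotone_cdf _).leftLim_le le_rfl) (by linarith)
  have h1 := mem_range_of_exists_le_of_exists_ge (c := c) hcont
    (((tendsto_cdf_atBot (gaussianReal 0 1)).eventually (ge_mem_nhds hc.1)).exists)
    (((tendsto_cdf_atTop (gaussianReal 0 1)).eventually (le_mem_nhds hc.2)).exists)
  obtain ⟨t, ht⟩ := h1
  exact ⟨t, by rw [← ht, cdf_eq_real]⟩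

/-- Two probability measures on the line are `δ`-close on lower sets. -/
def LowerClose (ν γ : Measure ℝ) (δ : ℝ) : Prop :=
  ∀ A : Set ℝ, IsLowerSet A → |ν.real A - γ.real A| ≤ δ

/-- Pólya's argument: a lower set of the line is squeezed between half-lines at neighbouring
Gaussian quantiles. The Gaussian mass of a cell and the error at a quantile cost 1/N each. -/
lemma lowerClose_of_quantiles (ν : Measure ℝ) [IsProbabilityMeasure ν] (N : ℕ) (hN : 0 < N)
    (t : ℕ → ℝ)
    (ht : ∀ k, 0 < k → k < N → (gaussianReal 0 1).real (Iic (t k)) = k / N)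
    (hν : ∀ k, 0 < k → k < N →
      |ν.real (Iic (t k)) - (gaussianReal 0 1).real (Iic (t k))| ≤ 1 / N) :
    LowerClose ν (gaussianReal 0 1) (2 / N) := by
  intro A hA
  set γ := gaussianReal 0 1
  have hN' : (0 : ℝ) < N := by exact_mod_cast hN
  have hdich : ∀ s, s ∉ A → A ⊆ Iic s := fun s hs x hx => by
    by_contra h
    exact hs (hA (not_le.1 h).le hx)
  have hp0 : 0 ≤ γ.real A := measureReal_nonneg
  have hp1 : γ.real A ≤ 1 := measureReal_le_one
  have hq0 : 0 ≤ ν.real A := measureReal_nonneg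
  have hq1 : ν.real A ≤ 1 := measureReal_le_one
  rw [abs_le]
  constructor
  -- Here k = ⌈γ(A)N⌉ - 1 is the largest index with k/N < γ(A), so t k lies in A. When k would be 0
  -- there is no quantile, but then γ(A) ≤ 1/N and nothing is needed.
  · rcases Nat.lt_or_ge 1 ⌈γ.real A * N⌉₊ with h | h
    · obtain ⟨k, hk⟩ : ∃ k, ⌈γ.real A * N⌉₊ = k + 1 := ⟨⌈γ.real A * N⌉₊ - 1, by omega⟩
      have h1 : (k : ℝ) < γ.real A * N := Nat.lt_ceil.1 (by omega)
      have h2 : γ.real A * N ≤ k + 1 := by exact_mod_cast Nat.ceil_le.1 hk.le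
      have hkN : k < N := by
        have : (k : ℝ) < N := h1.trans_le (mul_le_of_le_one_left hN'.le hp1)
        exact_mod_cast this
      have hk0 : 0 < k := by omega
      have hmem : t k ∈ A := by
        by_contra hs
        have h3 : γ.real A ≤ γ.real (Iic (t k)) := measureReal_mono (hdich _ hs)
        rw [ht k hk0 hkN, le_div_iff₀ hN'] at h3
        linarith
      have h4 : ν.real (Iic (t k)) ≤ ν.real A := measureReal_mono fun x hx => hA hx hmem
      have h5 := (abs_le.1 (hν k hk0 hkN)).1
      rw [ht k hk0 hkN] at h5
      have h6 : γ.real A ≤ (k + 1) / N := by rw [le_div_iff₀ hN']; exact h2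
      have h7 : ((k : ℝ) + 1) / N = k / N + 1 / N := by ring
      have h8 : (2 : ℝ) / N = 1 / N + 1 / N := by ring
      linarith
    · have h2 : γ.real A * N ≤ 1 := by exact_mod_cast Nat.ceil_le.1 h
      have h6 : γ.real A ≤ 1 / N := by rw [le_div_iff₀ hN']; exact h2
      have h8 : (2 : ℝ) / N = 1 / N + 1 / N := by ring
      have h9 : (0 : ℝ) < 1 / N := by positivity
      linarith
  -- The smallest index with γ(A) < k/N, so t k lies outside A. If k ≥ N, then γ(A) ≥ 1 - 1/N and
  -- the bound is trivial.
  · set k := ⌊γ.real A * N⌋₊ + 1 with hk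
    have h1 : γ.real A * N < k := by rw [hk]; exact_mod_cast Nat.lt_floor_add_one (γ.real A * N)
    have h2 : (k : ℝ) ≤ γ.real A * N + 1 := by
      rw [hk]; push_cast
      have := Nat.floor_le (show 0 ≤ γ.real A * N by positivity)
      linarith
    have h3 : (k : ℝ) / N ≤ γ.real A + 1 / N := by
      rw [div_le_iff₀ hN', add_mul, one_div, inv_mul_cancel₀ hN'.ne']; exact h2
    have h8 : (2 : ℝ) / N = 1 / N + 1 / N := by ring
    have h9 : (0 : ℝ) < 1 / N := by positivity
    rcases Nat.lt_or_ge k N with h | h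
    · have hk0 : 0 < k := by omega
      have hmem : t k ∉ A := by
        intro hs
        have h3 : γ.real (Iic (t k)) ≤ γ.real A := measureReal_mono fun x hx => hA hx hs
        rw [ht k hk0 h, div_le_iff₀ hN'] at h3
        linarith
      have h4 : ν.real A ≤ ν.real (Iic (t k)) := measureReal_mono (hdich _ hmem)
      have h5 := (abs_le.1 (hν k hk0 h)).2
      rw [ht k hk0 h] at h5
      linarith
    · have : (1 : ℝ) ≤ k / N := by
        rw [le_div_iff₀ hN', one_mul]; exact_mod_cast h
      linarith

/-- Under the Lindeberg-type condition, weighted sums are uniformly close to the Gaussian law. -/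
lemma eventually_lowerClose (D : Measure ℝ) [IsProbabilityMeasure D] (h0 : ∫ x, x ∂D = 0)
    (h1 : ∫ x, x ^ 2 ∂D = 1) {δ : ℝ} (hδ : 0 < δ) :
    ∀ᶠ x in weightFilter, LowerClose (linLaw D x.2) (gaussianReal 0 1) δ := by
  obtain ⟨N, hN⟩ := exists_nat_gt (2 / δ)
  have hN' : (0 : ℝ) < N := lt_trans (by positivity) hN
  have hN0 : 0 < N := by exact_mod_cast hN'
  have hex : ∀ k : ℕ, ∃ t, 0 < k → k < N → (gaussianReal 0 1).real (Iic t) = k / N := by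
    intro k
    by_cases hk : 0 < k ∧ k < N
    · obtain ⟨t, ht⟩ := exists_cdf_gaussian (c := k / N) ⟨by have := hk.1; positivity, by
        rw [div_lt_one hN']; exact_mod_cast hk.2⟩
      exact ⟨t, fun _ _ => ht⟩
    · exact ⟨0, fun a b => absurd ⟨a, b⟩ hk⟩
  choose t ht using hex
  have hev : ∀ᶠ x : Σ n, Fin n → ℝ in weightFilter, ∀ k ∈ Finset.range N,
      |(linLaw D x.2).real (Iic (t k)) - (gaussianReal 0 1).real (Iic (t k))| < 1 / N := by
    rw [Filter.eventually_all_finset]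
    intro k _
    have := (Metric.tendsto_nhds.1 (tendsto_linLaw_Iic D h0 h1 (t k))) (1 / N) (by positivity)
    simpa [Real.dist_eq] using this
  filter_upwards [hev] with x hx
  have := lowerClose_of_quantiles (linLaw D x.2) N hN0 t ht
    (fun k _ hk => (hx k (Finset.mem_range.2 hk)).le)
  intro A hA
  refine (this A hA).trans ?_
  rw [div_le_iff₀ hN']
  rw [div_lt_iff₀ hδ] at hN
  linarith

/-- An interval is the difference of two nested lower sets, hence the factor 2. -/
lemma LowerClose.ordConnected {ν γ : Measure ℝ} [IsProbabilityMeasure ν] [IsProbabilityMeasure γ]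
    {δ : ℝ} (h : LowerClose ν γ δ) {K : Set ℝ} (hK : K.OrdConnected) (hKm : MeasurableSet K) :
    |ν.real K - γ.real K| ≤ 2 * δ := by
  set U : Set ℝ := {x | ∃ k ∈ K, x ≤ k}
  set L : Set ℝ := {x | (∃ k ∈ K, x ≤ k) ∧ x ∉ K}
  have hU : IsLowerSet U := fun x y hxy ⟨k, hk, hxk⟩ => ⟨k, hk, hxy.trans hxk⟩
  have hL : IsLowerSet L := by
    rintro x y hyx ⟨⟨k, hk, hxk⟩, hx⟩
    exact ⟨⟨k, hk, hyx.trans hxk⟩, fun hy => hx (hK.out hy hk ⟨hyx, hxk⟩)⟩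
  have hUL : U = K ∪ L := by
    ext x
    constructor
    · intro hx
      by_cases hxK : x ∈ K
      · exact Or.inl hxK
      · exact Or.inr ⟨hx, hxK⟩
    · rintro (hx | hx)
      · exact ⟨x, hx, le_rfl⟩
      · exact hx.1
  have hd : Disjoint K L := Set.disjoint_left.2 fun x hx hL => hL.2 hx
  have hLm : MeasurableSet L := by
    have : L = U \ K := by
      rw [hUL, Set.union_sdiff_cancel_left]
      exact hd.le_bot
    rw [this]
    exact hU.ordConnected.measurableSet.diff hKm
  have e1 : ∀ μ : Measure ℝ, IsProbabilityMeasure μ → μ.real K = μ.real U - μ.real L := by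
    intro μ _
    rw [hUL, measureReal_union hd hLm]; ring
  rw [e1 ν inferInstance, e1 γ inferInstance]
  have h1 := abs_le.1 (h U hU)
  have h2 := abs_le.1 (h L hL)
  rw [abs_le]
  constructor <;> linarith

/-! ### Planar regions cut out by functions monotone in the absolute value -/

/-- `g` is a nondecreasing function of the absolute value. -/
def AbsMono (g : ℝ → ℝ) : Prop := ∀ x y, |x| ≤ |y| → g x ≤ g y

/-- The region `t ≤ g x - h y`. -/
def gapSet (t : ℝ) (g h : ℝ → ℝ) : Set (ℝ × ℝ) := {z | t ≤ g z.1 - h z.2}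

lemma measurableSet_gapSet (t : ℝ) {g h : ℝ → ℝ} (hg : Continuous g) (hh : Continuous h) :
    MeasurableSet (gapSet t g h) :=
  (isClosed_le continuous_const (by fun_prop)).measurableSet

/-- A point between x and y is in absolute value at most max(|x|, |y|). -/
lemma AbsMono.ordConnected_le {g : ℝ → ℝ} (hg : AbsMono g) (c : ℝ) :
    {x | g x ≤ c}.OrdConnected := by
  refine ⟨fun x hx y hy z hz => ?_⟩
  rcases le_total |x| |y| with h | h
  · exact (hg z y (by
      rcases abs_cases z with ⟨h1, _⟩ | ⟨h1, _⟩ <;> rw [h1]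
      · exact hz.2.trans (le_abs_self y)
      · exact (neg_le_neg hz.1).trans ((neg_le_abs x).trans h))).trans hy
  · exact (hg z x (by
      rcases abs_cases z with ⟨h1, _⟩ | ⟨h1, _⟩ <;> rw [h1]
      · exact (hz.2.trans (le_abs_self y)).trans h
      · exact (neg_le_neg hz.1).trans (neg_le_abs x))).trans hx

lemma AbsMono.ordConnected_lt {g : ℝ → ℝ} (hg : AbsMono g) (c : ℝ) :
    {x | g x < c}.OrdConnected := by
  refine ⟨fun x hx y hy z hz => ?_⟩
  have h := (hg.ordConnected_le (max (g x) (g y))).out (le_max_left _ _ : g x ≤ _)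
    (le_max_right _ _ : g y ≤ _) hz
  have hx' : g x < c := hx
  have hy' : g y < c := hy
  exact lt_of_le_of_lt (show g z ≤ max (g x) (g y) from h) (max_lt hx' hy')

lemma ordConnected_preimage_add {K : Set ℝ} (hK : K.OrdConnected) (m : ℝ) :
    {z | m + z ∈ K}.OrdConnected :=
  ⟨fun _ hx _ hy _ hz => hK.out hx hy ⟨by linarith [hz.1], by linarith [hz.2]⟩⟩

lemma prod_real_eq_integral {μ ν : Measure ℝ} [IsProbabilityMeasure μ] [IsProbabilityMeasure ν]
    {F : Set (ℝ × ℝ)} (hF : MeasurableSet F) :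
    (μ.prod ν).real F = ∫ x, ν.real (Prod.mk x ⁻¹' F) ∂μ := by
  rw [Measure.real, Measure.prod_apply hF]
  simp only [Measure.real]
  rw [integral_toReal (measurable_measure_prodMk_left hF).aemeasurable
    (ae_of_all _ fun x => measure_lt_top _ _)]

lemma prod_real_eq_integral_symm {μ ν : Measure ℝ} [IsProbabilityMeasure μ]
    [IsProbabilityMeasure ν] {F : Set (ℝ × ℝ)} (hF : MeasurableSet F) :
    (μ.prod ν).real F = ∫ y, μ.real ((fun x => (x, y)) ⁻¹' F) ∂ν := by
  rw [Measure.real, Measure.prod_apply_symm hF]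
  simp only [Measure.real]
  rw [integral_toReal (measurable_measure_prodMk_right hF).aemeasurable
    (ae_of_all _ fun x => measure_lt_top _ _)]

lemma integrable_section {μ ν : Measure ℝ} [IsProbabilityMeasure μ] [IsProbabilityMeasure ν]
    {F : Set (ℝ × ℝ)} (hF : MeasurableSet F) :
    Integrable (fun x => ν.real (Prod.mk x ⁻¹' F)) μ :=
  Integrable.of_bound (measurable_measure_prodMk_left hF).ennreal_toReal.aestronglyMeasurable 1
    (ae_of_all _ fun x => by
      rw [Real.norm_of_nonneg measureReal_nonneg]; exact measureReal_le_one)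

lemma integrable_section_symm {μ ν : Measure ℝ} [IsProbabilityMeasure μ] [IsProbabilityMeasure ν]
    {F : Set (ℝ × ℝ)} (hF : MeasurableSet F) :
    Integrable (fun y => μ.real ((fun x => (x, y)) ⁻¹' F)) ν :=
  Integrable.of_bound (measurable_measure_prodMk_right hF).ennreal_toReal.aestronglyMeasurable 1
    (ae_of_all _ fun x => by
      rw [Real.norm_of_nonneg measureReal_nonneg]; exact measureReal_le_one)

lemma abs_integral_sub_le {μ : Measure ℝ} [IsProbabilityMeasure μ] {f g : ℝ → ℝ} {c : ℝ}
    (hf : Integrable f μ) (hg : Integrable g μ) (h : ∀ x, |f x - g x| ≤ c) :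
    |∫ x, f x ∂μ - ∫ x, g x ∂μ| ≤ c := by
  rw [← integral_sub hf hg, ← Real.norm_eq_abs]
  refine (norm_integral_le_of_norm_le_const (ae_of_all _ h)).trans ?_
  simp

/-- Closeness on lower sets passes to planar sets with (co-)convex sections. -/
lemma LowerClose.prod {ν γ : Measure ℝ} [IsProbabilityMeasure ν] [IsProbabilityMeasure γ]
    {δ : ℝ} (h : LowerClose ν γ δ) {F : Set (ℝ × ℝ)} (hF : MeasurableSet F)
    (h1 : ∀ x, (Prod.mk x ⁻¹' F).OrdConnected)
    (h2 : ∀ y, ((fun x => (x, y)) ⁻¹' F)ᶜ.OrdConnected) :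
    |(ν.prod ν).real F - (γ.prod γ).real F| ≤ 4 * δ := by
  -- One factor is replaced at a time through the hybrid ν ⊗ γ: first on the convex vertical
  -- sections, then on the complements of the horizontal ones.
  have e1 : |(ν.prod ν).real F - (ν.prod γ).real F| ≤ 2 * δ := by
    rw [prod_real_eq_integral hF, prod_real_eq_integral hF]
    refine abs_integral_sub_le (integrable_section hF) (integrable_section hF) fun x => ?_
    exact h.ordConnected (h1 x) (measurable_prodMk_left hF)
  have e2 : |(ν.prod γ).real F - (γ.prod γ).real F| ≤ 2 * δ := by
    rw [prod_real_eq_integral_symm hF, prod_real_eq_integral_symm hF]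
    refine abs_integral_sub_le (integrable_section_symm hF) (integrable_section_symm hF)
      fun y => ?_
    have hm : MeasurableSet ((fun x => (x, y)) ⁻¹' F) := measurable_prodMk_right hF
    have := h.ordConnected (h2 y) hm.compl
    rw [probReal_compl_eq_one_sub hm, probReal_compl_eq_one_sub hm] at this
    rw [abs_sub_comm]
    convert this using 2
    ring
  calc _ ≤ _ := abs_sub_le _ ((ν.prod γ).real F) _
    _ ≤ 4 * δ := by linarith

/-! ### Gaussian probabilities of gap regions and their dependence on the means -/

/-- Probability of a planar set under independent unit Gaussians with the given means. -/
noncomputable def gaussShift (m₁ m₂ : ℝ) (F : Set (ℝ × ℝ)) : ℝ :=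
  ((gaussianReal m₁ 1).prod (gaussianReal m₂ 1)).real F

lemma gaussShift_eq (m₁ m₂ : ℝ) {F : Set (ℝ × ℝ)} (hF : MeasurableSet F) :
    gaussShift m₁ m₂ F =
      ((gaussianReal 0 1).prod (gaussianReal 0 1)).real {z | (m₁ + z.1, m₂ + z.2) ∈ F} := by
  have h : (gaussianReal m₁ 1).prod (gaussianReal m₂ 1) =
      ((gaussianReal 0 1).prod (gaussianReal 0 1)).map (Prod.map (m₁ + ·) (m₂ + ·)) := by
    rw [← Measure.map_prod_map _ _ (by fun_prop) (by fun_prop), gaussianReal_map_const_add,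
      gaussianReal_map_const_add, zero_add, zero_add]
  rw [gaussShift, h, map_measureReal_apply (by fun_prop) hF]
  rfl

/-- In y the sections are sublevel sets of h, in x they are complements of strict sublevel sets of
g; both properties survive shifts. The bound does not depend on m₁ and m₂, so arbitrarily large
signals are allowed. -/
lemma LowerClose.gapSet {ν : Measure ℝ} [IsProbabilityMeasure ν]
    {δ : ℝ} (hν : LowerClose ν (gaussianReal 0 1) δ) {t : ℝ} {g h : ℝ → ℝ} (hg : AbsMono g)
    (hh : AbsMono h) (hgc : Continuous g) (hhc : Continuous h) (m₁ m₂ : ℝ) :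
    |(ν.prod ν).real {z | (m₁ + z.1, m₂ + z.2) ∈ gapSet t g h} -
      gaussShift m₁ m₂ (gapSet t g h)| ≤ 4 * δ := by
  have hm := measurableSet_gapSet t hgc hhc
  rw [gaussShift_eq m₁ m₂ hm]
  refine hν.prod (F := {z | (m₁ + z.1, m₂ + z.2) ∈ JLKnockoff.gapSet t g h})
    ((by fun_prop : Measurable fun z : ℝ × ℝ => (m₁ + z.1, m₂ + z.2)) hm) (fun x => ?_)
    (fun y => ?_)
  · convert ordConnected_preimage_add (hh.ordConnected_le (g (m₁ + x) - t)) m₂ using 1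
    ext y
    simp only [JLKnockoff.gapSet, mem_preimage, mem_ofPred_eq]
    constructor <;> intro <;> linarith
  · convert ordConnected_preimage_add (hg.ordConnected_lt (t + h (m₂ + y))) m₁ using 1
    ext x
    simp only [JLKnockoff.gapSet, mem_preimage, mem_ofPred_eq, mem_compl_iff, not_le]
    constructor <;> intro <;> linarith

/-- Moving the centre from m to m' gives up (k - m', k - m] and gains [-k - m', -k - m). Translating
the latter by 2k onto the former can only increase the density, because |y| ≤ |y - 2k| for y ≤ k. -/
lemma gaussianReal_Icc_shift_le (k m m' : ℝ) (hk : 0 ≤ k) (hm : 0 ≤ m) (hmm : m ≤ m') :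
    (gaussianReal m' 1).real (Icc (-k) k) ≤ (gaussianReal m 1).real (Icc (-k) k) := by
  set γ := gaussianReal 0 1 with hγ
  have : NullSingletonClass γ := nullSingletonClass_gaussianReal one_ne_zero
  have hsh : ∀ m, (gaussianReal m 1).real (Icc (-k) k) = γ.real (Icc (-k - m) (k - m)) := by
    intro m
    have : gaussianReal m 1 = γ.map (m + ·) := by rw [gaussianReal_map_const_add, zero_add]
    rw [this, map_measureReal_apply (by fun_prop) measurableSet_Icc]
    congr 1
    ext x
    simp only [mem_preimage, mem_Icc]
    constructor <;> rintro ⟨h1, h2⟩ <;> constructor <;> linarith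
  rw [hsh, hsh]
  have h1 : γ.real (Icc (-k - m') (k - m')) + γ.real (Ioc (k - m') (k - m)) =
      γ.real (Icc (-k - m') (k - m)) := by
    rw [← measureReal_union (Set.disjoint_left.2 fun x hx hy => by
      have := hx.2; have := hy.1; linarith) measurableSet_Ioc,
      Icc_union_Ioc_eq_Icc (by linarith) (by linarith)]
  have h2 : γ.real (Ico (-k - m') (-k - m)) + γ.real (Icc (-k - m) (k - m)) =
      γ.real (Icc (-k - m') (k - m)) := by
    rw [← measureReal_union (Set.disjoint_left.2 fun x hx hy => by
      have := hx.2; have := hy.1; linarith) measurableSet_Icc,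
      Ico_union_Icc_eq_Icc (by linarith) (by linarith)]
  have h3 : γ.real (Ico (-k - m') (-k - m)) ≤ γ.real (Ioc (k - m') (k - m)) := by
    have e1 : γ (Ioc (k - m') (k - m)) = γ (Ico (k - m') (k - m)) :=
      measure_congr Ico_ae_eq_Ioc.symm
    have e2 : γ (Ico (-k - m') (-k - m)) = gaussianReal (2 * k) 1 (Ico (k - m') (k - m)) := by
      have : gaussianReal (2 * k) 1 = γ.map (2 * k + ·) := by
        rw [gaussianReal_map_const_add, zero_add]
      rw [this, Measure.map_apply (by fun_prop) measurableSet_Ico]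
      congr 1
      ext x
      simp only [mem_preimage, mem_Ico]
      constructor <;> rintro ⟨h1, h2⟩ <;> constructor <;> linarith
    refine ENNReal.toReal_mono (measure_ne_top _ _) ?_
    rw [e1, e2, gaussianReal_apply _ one_ne_zero, hγ, gaussianReal_apply _ one_ne_zero]
    refine setLIntegral_mono (measurable_gaussianPDF _ _) fun y hy => ?_
    refine ENNReal.ofReal_le_ofReal ?_
    simp only [gaussianPDFReal, NNReal.coe_one, mul_one]
    have hy2 : y ≤ k := by have := hy.2; linarith
    gcongr ?_ * Real.exp ?_
    have : (y - 0) ^ 2 ≤ (y - 2 * k) ^ 2 := by nlinarith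
    linarith
  linarith

/-- A symmetric interval is most likely when the Gaussian is centred. -/
lemma gaussianReal_star_shift_le {K : Set ℝ} (hK : ∀ x ∈ K, ∀ y, |y| ≤ |x| → y ∈ K) {m m' : ℝ}
    (hm : 0 ≤ m) (hmm : m ≤ m') :
    (gaussianReal m' 1).real K ≤ (gaussianReal m 1).real K := by
  rcases K.eq_empty_or_nonempty with rfl | hne
  · simp
  -- A symmetric star-shaped set is [-k, k] with k = sup |x|, up to endpoints which are null, or the
  -- whole line.
  by_cases hb : BddAbove (abs '' K)
  · set k := sSup (abs '' K) with hk
    have hk0 : 0 ≤ k := Real.sSup_nonneg (by rintro _ ⟨x, _, rfl⟩; exact abs_nonneg x)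
    have h1 : K ⊆ Icc (-k) k := fun x hx => abs_le.1 (le_csSup hb ⟨x, hx, rfl⟩)
    have h2 : Ioo (-k) k ⊆ K := by
      intro y hy
      obtain ⟨_, ⟨x, hx, rfl⟩, hxy⟩ := exists_lt_of_lt_csSup (hne.image _) (abs_lt.2 hy)
      exact hK x hx y hxy.le
    have h3 : ∀ m, (gaussianReal m 1).real K = (gaussianReal m 1).real (Icc (-k) k) := by
      intro m
      have : NullSingletonClass (gaussianReal m 1) := nullSingletonClass_gaussianReal one_ne_zero
      refine le_antisymm (measureReal_mono h1) ?_
      rw [measureReal_congr (Ioo_ae_eq_Icc (μ := gaussianReal m 1)).symm]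
      exact measureReal_mono h2
    rw [h3, h3]
    exact gaussianReal_Icc_shift_le k m m' hk0 hm hmm
  · have : K = univ := by
      refine eq_univ_of_forall fun y => ?_
      rw [not_bddAbove_iff] at hb
      obtain ⟨_, ⟨x, hx, rfl⟩, hxy⟩ := hb |y|
      exact hK x hx y hxy.le
    simp [this]

/-- Complements of the horizontal sections are symmetric and star-shaped, so they lose mass as the
mean leaves 0. This allows signals known only to be at least μ₀. -/
lemma gaussShift_mono_left {t : ℝ} {g h : ℝ → ℝ} (hg : AbsMono g) (hgc : Continuous g)
    (hhc : Continuous h) {m m' : ℝ} (hm : 0 ≤ m) (hmm : m ≤ m') (m₂ : ℝ) :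
    gaussShift m m₂ (gapSet t g h) ≤ gaussShift m' m₂ (gapSet t g h) := by
  have hF := measurableSet_gapSet t hgc hhc
  rw [gaussShift, gaussShift, prod_real_eq_integral_symm hF, prod_real_eq_integral_symm hF]
  refine integral_mono (integrable_section_symm hF) (integrable_section_symm hF) fun y => ?_
  have hms : MeasurableSet ((fun x => (x, y)) ⁻¹' gapSet t g h) := measurable_prodMk_right hF
  have := gaussianReal_star_shift_le (K := ((fun x => (x, y)) ⁻¹' gapSet t g h)ᶜ)
    (fun x hx z hz => by
      simp only [gapSet, mem_preimage, mem_ofPred_eq, mem_compl_iff, not_le] at hx ⊢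
      have := hg z x hz
      linarith) hm hmm
  rw [probReal_compl_eq_one_sub hms, probReal_compl_eq_one_sub hms] at this
  simp only
  linarith

/-- Here the vertical sections themselves are symmetric and star-shaped; used when the knockoff of a
signal wins. -/
lemma gaussShift_anti_right {t : ℝ} {g h : ℝ → ℝ} (hh : AbsMono h) (hgc : Continuous g)
    (hhc : Continuous h) {m m' : ℝ} (hm : 0 ≤ m) (hmm : m ≤ m') (m₁ : ℝ) :
    gaussShift m₁ m' (gapSet t g h) ≤ gaussShift m₁ m (gapSet t g h) := by
  have hF := measurableSet_gapSet t hgc hhc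
  rw [gaussShift, gaussShift, prod_real_eq_integral hF, prod_real_eq_integral hF]
  refine integral_mono (integrable_section hF) (integrable_section hF) fun x => ?_
  exact gaussianReal_star_shift_le (K := Prod.mk x ⁻¹' gapSet t g h)
    (fun y hy z hz => by
      simp only [gapSet, mem_preimage, mem_ofPred_eq] at hy ⊢
      have := hh z y hz
      linarith) hm hmm

/-! ### Stability of planar regions under small perturbations -/

/-- `g` evaluated after moving the argument towards the origin by `ε`. -/
noncomputable def shrink (g : ℝ → ℝ) (ε x : ℝ) : ℝ := g (max (|x| - ε) 0)

/-- `g` evaluated after moving the argument away from the origin by `ε`. -/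
noncomputable def grow (g : ℝ → ℝ) (ε x : ℝ) : ℝ := g (|x| + ε)

lemma AbsMono.mono_of_nonneg {g : ℝ → ℝ} (hg : AbsMono g) {a b : ℝ} (ha : 0 ≤ a) (hab : a ≤ b) :
    g a ≤ g b := hg _ _ (by rwa [abs_of_nonneg ha, abs_of_nonneg (ha.trans hab)])

lemma continuous_shrink {g : ℝ → ℝ} (hg : Continuous g) (ε : ℝ) : Continuous (shrink g ε) := by
  unfold shrink; fun_prop

lemma continuous_grow {g : ℝ → ℝ} (hg : Continuous g) (ε : ℝ) : Continuous (grow g ε) := by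
  unfold grow; fun_prop

lemma AbsMono.shrink {g : ℝ → ℝ} (hg : AbsMono g) (ε : ℝ) : AbsMono (shrink g ε) := by
  intro x y h
  refine hg.mono_of_nonneg (le_max_right _ _) ?_
  gcongr

lemma AbsMono.grow {g : ℝ → ℝ} (hg : AbsMono g) {ε : ℝ} (hε : 0 ≤ ε) : AbsMono (grow g ε) := by
  intro x y h
  refine hg.mono_of_nonneg (by positivity) ?_
  gcongr

/-- With `AbsMono.le_grow`, replaces the statistic by the nearby score while keeping a function of
|x|, so that the comparison with Gaussian regions still applies. -/
lemma AbsMono.shrink_le {g : ℝ → ℝ} (hg : AbsMono g) {ε x x' : ℝ} (h : |x - x'| ≤ ε) :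
    JLKnockoff.shrink g ε x ≤ g x' := by
  refine hg _ _ ?_
  rw [abs_of_nonneg (le_max_right _ _)]
  exact max_le (by linarith [abs_sub_abs_le_abs_sub x x']) (abs_nonneg _)

lemma AbsMono.le_grow {g : ℝ → ℝ} (hg : AbsMono g) {ε x x' : ℝ} (h : |x - x'| ≤ ε) :
    g x' ≤ JLKnockoff.grow g ε x := by
  refine hg _ _ ?_
  have := abs_sub_abs_le_abs_sub x' x
  rw [abs_sub_comm] at this
  exact (by linarith : |x'| ≤ |x| + ε).trans (le_abs_self _)

lemma AbsMono.grow_mono {g : ℝ → ℝ} (hg : AbsMono g) {ε ε' x : ℝ} (h0 : 0 ≤ ε) (h : ε ≤ ε') :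
    JLKnockoff.grow g ε x ≤ JLKnockoff.grow g ε' x := by
  refine hg.mono_of_nonneg (by positivity) ?_
  gcongr

lemma AbsMono.shrink_anti {g : ℝ → ℝ} (hg : AbsMono g) {ε ε' x : ℝ} (h : ε ≤ ε') :
    JLKnockoff.shrink g ε' x ≤ JLKnockoff.shrink g ε x := by
  refine hg.mono_of_nonneg (le_max_right _ _) ?_
  gcongr

lemma exists_measureReal_ge_of_diff_null {α : Type*} [MeasurableSpace α] (μ : Measure α)
    [IsProbabilityMeasure μ] {F : Set α} {G : ℕ → Set α} (hG : Monotone G)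
    (h : μ (F \ ⋃ k, G k) = 0) {δ : ℝ} (hδ : 0 < δ) : ∃ k, μ.real F - δ ≤ μ.real (G k) := by
  have h1 := (ENNReal.tendsto_toReal (measure_ne_top μ _)).comp (tendsto_measure_iUnion_atTop hG
    (μ := μ))
  have h2 : μ.real F ≤ μ.real (⋃ k, G k) := by
    refine ENNReal.toReal_mono (measure_ne_top _ _) ?_
    calc μ F ≤ μ ((⋃ k, G k) ∪ F \ ⋃ k, G k) := measure_mono fun x hx => by
          by_cases hk : x ∈ ⋃ k, G k
          · exact Or.inl hk
          · exact Or.inr ⟨hx, hk⟩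
      _ ≤ _ := measure_union_le _ _
      _ = _ := by rw [h, add_zero]
  obtain ⟨k, hk⟩ := (h1.eventually (lt_mem_nhds
    (show (μ (⋃ k, G k)).toReal - δ < (μ (⋃ k, G k)).toReal by linarith))).exists
  have h3 : (μ (⋃ k, G k)).toReal = μ.real (⋃ k, G k) := rfl
  have h4 : ((ENNReal.toReal ∘ μ ∘ G) k) = μ.real (G k) := rfl
  refine ⟨k, ?_⟩
  rw [h3] at hk
  rw [h4] at hk
  linarith

lemma measure_eq_zero_of_abs_eq {μ : Measure ℝ} [NullSingletonClass μ] {N : Set ℝ}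
    (h : ∀ x ∈ N, ∀ y ∈ N, |x| = |y|) : μ N = 0 := by
  rcases N.eq_empty_or_nonempty with rfl | ⟨a, ha⟩
  · simp
  refine measure_mono_null (t := {a, -a}) (fun x hx => ?_)
    (Set.Finite.measure_zero (by simp) μ)
  rcases abs_eq_abs.1 (h x hx a ha) with h | h <;> simp [h]

/-- A sequence of positive tolerances tending to zero. -/
noncomputable def tol (k : ℕ) : ℝ := 1 / ((k : ℝ) + 1)

lemma tol_pos (k : ℕ) : 0 < tol k := by unfold tol; positivity

lemma tol_anti : Antitone tol := fun k l h => by unfold tol; gcongr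

lemma tendsto_tol : Tendsto tol atTop (𝓝 0) := tendsto_one_div_add_atTop_nhds_zero_nat

lemma exists_tol_le {c : ℝ} (hc : 0 < c) : ∃ k, tol k ≤ c :=
  (tendsto_tol.eventually (ge_mem_nhds hc)).exists

/-- The level t may carry positive probability, since g can have plateaus; moving the argument
instead of the value avoids this. If two points of a horizontal line lay in the region but in none
of the shrunken ones, with |x| < |x'|, then x' could be moved in towards |x| and still satisfy the
inequality. So at most a pair ±x is lost on each line, a null set. -/
lemma exists_shrink_left {t : ℝ} {g h : ℝ → ℝ} (hg : AbsMono g) (hgc : Continuous g)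
    (hhc : Continuous h) (m₁ m₂ : ℝ) {δ : ℝ} (hδ : 0 < δ) :
    ∃ ε > 0, gaussShift m₁ m₂ (gapSet t g h) - δ ≤ gaussShift m₁ m₂ (gapSet t (shrink g ε) h) := by
  have hN : NullSingletonClass (gaussianReal m₁ 1) := nullSingletonClass_gaussianReal one_ne_zero
  have hmeas : ∀ k, MeasurableSet (gapSet t (shrink g (tol k)) h) := fun k =>
    measurableSet_gapSet t (continuous_shrink hgc _) hhc
  obtain ⟨k, hk⟩ := exists_measureReal_ge_of_diff_null
    ((gaussianReal m₁ 1).prod (gaussianReal m₂ 1)) (F := gapSet t g h)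
    (G := fun k => gapSet t (shrink g (tol k)) h)
    (fun k l hkl z hz => (show t ≤ _ from le_trans hz
      (sub_le_sub_right (hg.shrink_anti (tol_anti hkl)) _))) (by
      rw [Measure.prod_apply_symm ((measurableSet_gapSet t hgc hhc).diff
        (MeasurableSet.iUnion hmeas))]
      refine (lintegral_congr fun y => ?_).trans lintegral_zero
      refine measure_eq_zero_of_abs_eq fun x hx x' hx' => ?_
      by_contra hne
      wlog hlt : |x| < |x'| generalizing x x'
      · exact this x' hx' x hx (Ne.symm hne) (lt_of_le_of_ne (not_lt.1 hlt) (Ne.symm hne))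
      obtain ⟨k, hk⟩ := exists_tol_le (sub_pos.2 hlt)
      refine hx'.2 (mem_iUnion.2 ⟨k, ?_⟩)
      have h1 : t ≤ g x - h y := hx.1
      have h2 : g x ≤ shrink g (tol k) x' := hg _ _
        ((le_max_of_le_left (by linarith)).trans (le_abs_self _))
      exact (show t ≤ shrink g (tol k) x' - h y by linarith)) hδ
  exact ⟨tol k, tol_pos k, hk⟩

/-- The same argument on vertical lines: of two exceptional points, the one nearer to 0 has room to
move outwards. -/
lemma exists_grow_right {t : ℝ} {g h : ℝ → ℝ} (hh : AbsMono h) (hgc : Continuous g)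
    (hhc : Continuous h) (m₁ m₂ : ℝ) {δ : ℝ} (hδ : 0 < δ) :
    ∃ ε > 0, gaussShift m₁ m₂ (gapSet t g h) - δ ≤ gaussShift m₁ m₂ (gapSet t g (grow h ε)) := by
  have hN : NullSingletonClass (gaussianReal m₂ 1) := nullSingletonClass_gaussianReal one_ne_zero
  have hmeas : ∀ k, MeasurableSet (gapSet t g (grow h (tol k))) := fun k =>
    measurableSet_gapSet t hgc (continuous_grow hhc _)
  obtain ⟨k, hk⟩ := exists_measureReal_ge_of_diff_null
    ((gaussianReal m₁ 1).prod (gaussianReal m₂ 1)) (F := gapSet t g h)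
    (G := fun k => gapSet t g (grow h (tol k)))
    (fun k l hkl z hz => (show t ≤ _ from le_trans hz
      (sub_le_sub_left (hh.grow_mono (tol_pos l).le (tol_anti hkl)) _))) (by
      rw [Measure.prod_apply ((measurableSet_gapSet t hgc hhc).diff
        (MeasurableSet.iUnion hmeas))]
      refine (lintegral_congr fun x => ?_).trans lintegral_zero
      refine measure_eq_zero_of_abs_eq fun y hy y' hy' => ?_
      by_contra hne
      wlog hlt : |y| < |y'| generalizing y y'
      · exact this y' hy' y hy (Ne.symm hne) (lt_of_le_of_ne (not_lt.1 hlt) (Ne.symm hne))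
      obtain ⟨k, hk⟩ := exists_tol_le (sub_pos.2 hlt)
      refine hy.2 (mem_iUnion.2 ⟨k, ?_⟩)
      have h1 : t ≤ g x - h y' := hy'.1
      have h2 : grow h (tol k) y ≤ h y' := hh _ _ (by
        rw [abs_of_nonneg (by have := tol_pos k; positivity)]
        linarith)
      exact (show t ≤ g x - grow h (tol k) y by linarith)) hδ
  exact ⟨tol k, tol_pos k, hk⟩

lemma gaussShift_le_of_subset {m₁ m₂ : ℝ} {F G : Set (ℝ × ℝ)} (h : F ⊆ G) :
    gaussShift m₁ m₂ F ≤ gaussShift m₁ m₂ G := measureReal_mono h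

lemma exists_inner_perturbation {t : ℝ} {g : ℝ → ℝ} (hg : AbsMono g) (hgc : Continuous g)
    (m₁ m₂ : ℝ) {δ : ℝ} (hδ : 0 < δ) :
    ∃ ε > 0, gaussShift m₁ m₂ (gapSet t g g) - δ ≤
      gaussShift m₁ m₂ (gapSet t (shrink g ε) (grow g ε)) := by
  obtain ⟨ε₁, h1, h1'⟩ := exists_shrink_left hg hgc hgc (t := t) m₁ m₂ (half_pos hδ)
  obtain ⟨ε₂, h2, h2'⟩ := exists_grow_right hg (continuous_shrink hgc ε₁) hgc (t := t) m₁ m₂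
    (half_pos hδ)
  refine ⟨min ε₁ ε₂, lt_min h1 h2, ?_⟩
  have : gaussShift m₁ m₂ (gapSet t (shrink g ε₁) (grow g ε₂)) ≤
      gaussShift m₁ m₂ (gapSet t (shrink g (min ε₁ ε₂)) (grow g (min ε₁ ε₂))) :=
    gaussShift_le_of_subset fun z hz => show t ≤ _ from le_trans hz
      (sub_le_sub (hg.shrink_anti (min_le_left _ _))
        (hg.grow_mono (lt_min h1 h2).le (min_le_right _ _)))
  linarith

/-- The enlarged regions decrease to the original one by continuity of g and closedness of the
inequality, so continuity of measure suffices, with no null-set argument. -/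
lemma exists_outer_perturbation {t : ℝ} {g : ℝ → ℝ} (hg : AbsMono g) (hgc : Continuous g)
    (m₁ m₂ : ℝ) {δ : ℝ} (hδ : 0 < δ) :
    ∃ ε > 0, gaussShift m₁ m₂ (gapSet t (grow g ε) (shrink g ε)) ≤
      gaussShift m₁ m₂ (gapSet t g g) + δ := by
  obtain ⟨k, hk⟩ := exists_measureReal_ge_of_diff_null
    ((gaussianReal m₁ 1).prod (gaussianReal m₂ 1)) (F := (gapSet t g g)ᶜ)
    (G := fun k => (gapSet t (grow g (tol k)) (shrink g (tol k)))ᶜ)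
    (fun k l hkl => compl_subset_compl.2 fun z hz => (show t ≤ _ from le_trans hz
      (sub_le_sub (hg.grow_mono (tol_pos l).le (tol_anti hkl))
        (hg.shrink_anti (tol_anti hkl))))) (by
      refine (congrArg _ (eq_empty_iff_forall_notMem.2 ?_)).trans measure_empty
      rintro z ⟨hz, hz'⟩
      refine hz ?_
      have h1 : ∀ k, t ≤ grow g (tol k) z.1 - shrink g (tol k) z.2 := by
        intro k
        by_contra hk
        exact hz' (mem_iUnion.2 ⟨k, hk⟩)
      have e1 : g z.1 = grow g 0 z.1 := le_antisymm (hg.le_grow (by simp))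
        (hg _ _ (by simp))
      have e2 : g z.2 = shrink g 0 z.2 := le_antisymm
        (hg _ _ (by simp)) (hg.shrink_le (by simp))
      have hc : Continuous fun ε => grow g ε z.1 - shrink g ε z.2 := by
        unfold grow shrink; fun_prop
      have := ge_of_tendsto' ((hc.tendsto 0).comp tendsto_tol) h1
      exact (show t ≤ g z.1 - g z.2 by rw [e1, e2]; exact this)) hδ
  refine ⟨tol k, tol_pos k, ?_⟩
  rw [probReal_compl_eq_one_sub (measurableSet_gapSet t hgc hgc),
    probReal_compl_eq_one_sub (measurableSet_gapSet t (continuous_grow hgc _)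
      (continuous_shrink hgc _))] at hk
  unfold gaussShift
  linarith

/-! ### The feature function at unit scale -/

namespace FeatureFun

variable {f : ℝ → ℝ → ℝ}

lemma continuous_left (hf : FeatureFun f) (a : ℝ) : Continuous fun x => f x a := by
  obtain ⟨L, _, hL⟩ := hf.lipschitz
  exact (hL a).continuous

lemma absMono (hf : FeatureFun f) (a : ℝ) : AbsMono fun x => f x a := by
  have h : ∀ x, f x a = f |x| a := by
    intro x
    rcases abs_cases x with ⟨h, _⟩ | ⟨h, _⟩ <;> rw [h]
    exact hf.even x a
  intro x y hxy
  change f x a ≤ f y a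
  rw [h x, h y]
  exact hf.mono a (abs_nonneg x) (abs_nonneg y) hxy

lemma probGe_eq (hf : FeatureFun f) (μ t : ℝ) :
    probGe f μ t = gaussShift μ 0 (gapSet t (fun x => f x 1) fun x => f x 1) := by
  rw [gaussShift_eq _ _ (measurableSet_gapSet t (hf.continuous_left 1) (hf.continuous_left 1))]
  simp only [probGe, gaussProb, gapSet, zero_add, mem_ofPred_eq]

/-- The event that the knockoff wins by t is a gap event with the coordinates exchanged, so the
shift moves to the second one. -/
lemma probLe_eq (hf : FeatureFun f) (μ t : ℝ) :
    probLe f μ t = gaussShift 0 μ (gapSet t (fun x => f x 1) fun x => f x 1) := by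
  have hm := measurableSet_gapSet t (hf.continuous_left 1) (hf.continuous_left 1)
  have hm' : MeasurableSet {z : ℝ × ℝ | ((0 : ℝ) + z.1, μ + z.2) ∈
      gapSet t (fun x => f x 1) fun x => f x 1} :=
    (by fun_prop : Measurable fun z : ℝ × ℝ => ((0 : ℝ) + z.1, μ + z.2)) hm
  rw [gaussShift_eq _ _ hm, ← Measure.prod_swap, map_measureReal_apply measurable_swap hm']
  unfold probLe gaussProb
  congr 1
  ext z
  simp only [gapSet, mem_ofPred_eq, mem_preimage, Prod.fst_swap, Prod.snd_swap, zero_add]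
  constructor <;> intro <;> linarith

/-- Makes the denominators of the limiting proportions positive. By the growth of f(·;1), the event
contains a rectangle with x large and |y| ≤ 1. -/
lemma probGe_pos (hf : FeatureFun f) (t : ℝ) : 0 < probGe f 0 t := by
  obtain ⟨ca, hca, cx, hcx, h⟩ := hf.growth 1
  set c := max cx ((t + f 1 1) / ca)
  have hsub : Icc c (c + 1) ×ˢ Icc (-1) 1 ⊆
      gapSet t (fun x => f x 1) (fun x => f x 1) := by
    rintro ⟨x, y⟩ ⟨hx, hy⟩
    have h1 := h x ((le_max_left _ _).trans hx.1)
    have h2 := (le_max_right _ _).trans hx.1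
    rw [div_le_iff₀ hca] at h2
    have h3 : f y 1 ≤ f 1 1 := hf.absMono 1 y 1 (by rw [abs_one]; exact abs_le.2 hy)
    exact (show t ≤ f x 1 - f y 1 by linarith)
  rw [hf.probGe_eq]
  refine lt_of_lt_of_le ?_ (gaussShift_le_of_subset hsub)
  rw [gaussShift, Measure.real, Measure.prod_prod, ENNReal.toReal_mul]
  have hpos : ∀ a b : ℝ, a < b → 0 < (gaussianReal 0 1 (Icc a b)).toReal := by
    intro a b hab
    refine ENNReal.toReal_pos (fun h0 => ?_) (measure_ne_top _ _)
    have := gaussianReal_absolutelyContinuous' 0 one_ne_zero h0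
    rw [Real.volume_Icc, ENNReal.ofReal_eq_zero] at this
    linarith
  exact mul_pos (hpos _ _ (by linarith)) (hpos _ _ (by norm_num))

end FeatureFun

/-! ### Consequences of the debiasing conditions -/

-- Here v = w²/n, ℓ = log 2p, and κ = 2λ√s + v. Bounding κ² below by 8λ√s v cancels λ in `h` and
-- bounds s v² ℓ; bounding it by 4λ²s bounds λ s √ℓ. The factor ρ is removed by pairing it with √n
-- or √r, according to which part of ρ² dominates. The hypothesis `hbig`, which holds because s
-- grows like p, excludes v > 1.
set_option maxHeartbeats 400000 in
lemma rate_bounds {n r s ℓ σ v lam ρ ε : ℝ} (hn : 1 ≤ n) (hr : 1 ≤ r) (hs : 0 < s) (hℓ : 0 < ℓ)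
    (hσ : 0 < σ) (hv : 0 < v) (hlam : 0 < lam) (hρ : 0 < ρ) (hε : 0 < ε)
    (hρ2 : ρ ^ 2 ≤ 1 / n + 2 * (1 + v) / r)
    (h : 1 / (σ * ρ) * (4 * (2 * lam * √s + v) ^ 2 / (lam * (1 + v))) ≤
      ε * min (√(n / ℓ)) (min (√(r / ℓ)) (1 / v * √(r / ℓ))))
    (hbig : σ ^ 2 * ε ^ 2 < s * ℓ) :
    s * ℓ * v ^ 2 ≤ σ ^ 2 * ε ^ 2 ∧ lam * s * √ℓ ≤ ε * σ := by
  have hn0 : 0 < n := by linarith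
  have hr0 : 0 < r := by linarith
  have hφ : 0 < 1 + v := by linarith
  have hsl : 0 < √ℓ := Real.sqrt_pos.2 hℓ
  have hss : 0 < √s := Real.sqrt_pos.2 hs
  have e1 : √s ^ 2 = s := Real.sq_sqrt hs.le
  have e2 : √ℓ ^ 2 = ℓ := Real.sq_sqrt hℓ.le
  have e3 : √n ^ 2 = n := Real.sq_sqrt hn0.le
  have e4 : √r ^ 2 = r := Real.sq_sqrt hr0.le
  -- The three entries of the minimum are q/√ℓ with q = √n, √r and √r/v.
  have hq : ∀ q : ℝ, ε * min (√(n / ℓ)) (min (√(r / ℓ)) (1 / v * √(r / ℓ))) ≤ ε * (q / √ℓ) →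
      4 * (2 * lam * √s + v) ^ 2 * √ℓ ≤ ε * q * (σ * ρ) * (lam * (1 + v)) := by
    intro q hq
    have := h.trans hq
    rw [one_div_mul_eq_div, div_div, div_le_iff₀ (by positivity)] at this
    calc 4 * (2 * lam * √s + v) ^ 2 * √ℓ
        ≤ (ε * (q / √ℓ) * (lam * (1 + v) * (σ * ρ))) * √ℓ := by gcongr
      _ = _ := by field_simp
  have h1 := hq (√n) (by
    rw [← Real.sqrt_div hn0.le]; gcongr; exact min_le_left _ _)
  have h2 := hq (√r) (by
    rw [← Real.sqrt_div hr0.le]; gcongr; exact (min_le_right _ _).trans (min_le_left _ _))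
  have h3 := hq (√r / v) (by
    rw [div_right_comm, ← Real.sqrt_div hr0.le]
    gcongr
    refine ((min_le_right _ _).trans (min_le_right _ _)).trans (le_of_eq (by ring)))
  -- (x + y)² ≥ 4xy with x = 2λ√s and y = v.
  have k1 : 8 * lam * √s * v ≤ (2 * lam * √s + v) ^ 2 := by
    nlinarith [sq_nonneg (2 * lam * √s - v)]
  have k2 : 4 * lam ^ 2 * s ≤ (2 * lam * √s + v) ^ 2 := by
    have : 0 ≤ 2 * (2 * lam * √s) * v + v ^ 2 := by positivity
    nlinarith
  have step1 : ∀ q : ℝ, 0 ≤ q →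
      4 * (2 * lam * √s + v) ^ 2 * √ℓ ≤ ε * q * (σ * ρ) * (lam * (1 + v)) →
      1024 * (s * v ^ 2 * ℓ) ≤ ε ^ 2 * q ^ 2 * σ ^ 2 * ρ ^ 2 * (1 + v) ^ 2 := by
    intro q hq0 hh
    have : 32 * (√s * v * √ℓ) ≤ ε * q * (σ * ρ) * (1 + v) := by
      have a1 : 4 * (8 * lam * √s * v) * √ℓ ≤ ε * q * (σ * ρ) * (lam * (1 + v)) :=
        le_trans (by gcongr) hh
      refine le_of_mul_le_mul_left ?_ hlam
      linarith
    have := pow_le_pow_left₀ (by positivity) this 2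
    calc 1024 * (s * v ^ 2 * ℓ) = (32 * (√s * v * √ℓ)) ^ 2 := by
          rw [mul_pow, mul_pow, mul_pow, e1, e2]; ring
      _ ≤ _ := this
      _ = _ := by ring
  have a1 := step1 _ (by positivity) h1
  have a2 := step1 _ (by positivity) h2
  have a3 := step1 _ (by positivity) h3
  rw [e3] at a1
  rw [e4] at a2
  rw [div_pow, e4] at a3
  have a3' : 1024 * (s * v ^ 4 * ℓ) ≤ ε ^ 2 * r * σ ^ 2 * ρ ^ 2 * (1 + v) ^ 2 := by
    have := mul_le_mul_of_nonneg_right a3 (sq_nonneg v)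
    calc 1024 * (s * v ^ 4 * ℓ) = 1024 * (s * v ^ 2 * ℓ) * v ^ 2 := by ring
      _ ≤ _ := this
      _ = _ := by field_simp
  -- the penalty scale cannot dominate
  have key : (ρ ^ 2 * n ≤ 2) ∨ (ρ ^ 2 * r ≤ 4 * (1 + v)) := by
    rcases le_total (2 * (1 + v) / r) (1 / n) with hc | hc
    · left
      have : ρ ^ 2 ≤ 2 / n := by
        calc _ ≤ _ := hρ2
          _ ≤ 1 / n + 1 / n := by gcongr
          _ = _ := by ring
      rwa [le_div_iff₀ hn0] at this
    · right
      have : ρ ^ 2 ≤ 4 * (1 + v) / r := by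
        calc _ ≤ _ := hρ2
          _ ≤ 2 * (1 + v) / r + 2 * (1 + v) / r := by gcongr
          _ = _ := by ring
      rwa [le_div_iff₀ hr0] at this
  have hK : 0 < σ ^ 2 * ε ^ 2 := by positivity
  -- If v > 1 then (1 + v)² ≤ 4v², and the powers of v cancel: through `a1` when 1/n dominates ρ²,
  -- through `a3'` otherwise. Either way s ℓ < σ²ε², contradicting `hbig`.
  have hv1 : v ≤ 1 := by
    by_contra hv1
    push Not at hv1
    have hφv : (1 + v) ^ 2 ≤ 4 * v ^ 2 := by nlinarith
    rcases key with hc | hc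
    · have : 1024 * (s * v ^ 2 * ℓ) ≤ 8 * (σ ^ 2 * ε ^ 2) * v ^ 2 := by
        calc _ ≤ _ := a1
          _ = ε ^ 2 * σ ^ 2 * (ρ ^ 2 * n) * (1 + v) ^ 2 := by ring
          _ ≤ ε ^ 2 * σ ^ 2 * 2 * (4 * v ^ 2) := by gcongr
          _ = _ := by ring
      have h5 : (1024 * (s * ℓ)) * v ^ 2 ≤ (8 * (σ ^ 2 * ε ^ 2)) * v ^ 2 := by linarith
      have := le_of_mul_le_mul_right h5 (by positivity)
      linarith
    · have : 1024 * (s * v ^ 4 * ℓ) ≤ 32 * (σ ^ 2 * ε ^ 2) * v ^ 3 := by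
        calc _ ≤ _ := a3'
          _ = ε ^ 2 * σ ^ 2 * (ρ ^ 2 * r) * (1 + v) ^ 2 := by ring
          _ ≤ ε ^ 2 * σ ^ 2 * (8 * v) * (4 * v ^ 2) :=
              mul_le_mul (mul_le_mul_of_nonneg_left (by linarith) (by positivity)) hφv
                (by positivity) (by positivity)
          _ = _ := by ring
      have h5 : (1024 * (s * ℓ)) * v * v ^ 3 ≤ (32 * (σ ^ 2 * ε ^ 2)) * v ^ 3 := by linarith
      have := le_of_mul_le_mul_right h5 (by positivity)
      have h6 : s * ℓ ≤ s * ℓ * v := le_mul_of_one_le_right (by positivity) hv1.le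
      linarith
  have hφ2 : (1 + v) ^ 2 ≤ 4 := by nlinarith
  constructor
  · rcases key with hc | hc
    · have : 1024 * (s * v ^ 2 * ℓ) ≤ 8 * (σ ^ 2 * ε ^ 2) := by
        calc _ ≤ _ := a1
          _ = ε ^ 2 * σ ^ 2 * (ρ ^ 2 * n) * (1 + v) ^ 2 := by ring
          _ ≤ ε ^ 2 * σ ^ 2 * 2 * 4 := by gcongr
          _ = _ := by ring
      linarith
    · have : 1024 * (s * v ^ 2 * ℓ) ≤ 32 * (σ ^ 2 * ε ^ 2) := by
        calc _ ≤ _ := a2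
          _ = ε ^ 2 * σ ^ 2 * (ρ ^ 2 * r) * (1 + v) ^ 2 := by ring
          _ ≤ ε ^ 2 * σ ^ 2 * 8 * 4 :=
              mul_le_mul (mul_le_mul_of_nonneg_left (by linarith) (by positivity)) hφ2
                (by positivity) (by positivity)
          _ = _ := by ring
      linarith
  -- Now 4λ²s is kept from κ², and 1 + v ≤ 2 is available.
  · have step2 : ∀ q : ℝ, 0 ≤ q →
        4 * (2 * lam * √s + v) ^ 2 * √ℓ ≤ ε * q * (σ * ρ) * (lam * (1 + v)) →
        8 * (lam * s * √ℓ) ≤ ε * σ * (ρ * q) := by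
      intro q hq0 hh
      have a1 : 4 * (4 * lam ^ 2 * s) * √ℓ ≤ ε * q * (σ * ρ) * (lam * (1 + v)) :=
        le_trans (by gcongr) hh
      have a2 : ε * q * (σ * ρ) * (lam * (1 + v)) ≤ ε * q * (σ * ρ) * (lam * 2) := by
        gcongr; linarith
      have : (2 * lam) * (8 * (lam * s * √ℓ)) ≤ (2 * lam) * (ε * σ * (ρ * q)) := by linarith
      exact le_of_mul_le_mul_left this (by positivity)
    have b1 := step2 _ (by positivity) h1
    have b2 := step2 _ (by positivity) h2
    have hmin : ρ * √n ≤ 8 ∨ ρ * √r ≤ 8 := by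
      rcases key with hc | hc
      · left
        refine le_of_sq_le_sq ?_ (by norm_num)
        rw [mul_pow, e3]; linarith
      · right
        refine le_of_sq_le_sq ?_ (by norm_num)
        rw [mul_pow, e4]; linarith
    rcases hmin with hm | hm
    · have : ε * σ * (ρ * √n) ≤ ε * σ * 8 := by gcongr
      linarith
    · have : ε * σ * (ρ * √r) ≤ ε * σ * 8 := by gcongr
      linarith

namespace Params

variable {S : Params}

lemma Standing.b_nonneg (hS : S.Standing) : 0 ≤ S.b := by
  have := hS.D_prob
  obtain ⟨x, hx⟩ := hS.D_supp.exists
  exact (abs_nonneg x).trans hx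

lemma Standing.log_pos (hS : S.Standing) (n : ℕ) : 0 < Real.log (4 / S.δ n) := by
  obtain ⟨h1, h2⟩ := hS.δ_mem n
  refine Real.log_pos ?_
  rw [one_lt_div h1]
  have : Real.exp (-1) < 1 := by rw [Real.exp_lt_one_iff]; norm_num
  linarith

lemma Standing.w_pos (hS : S.Standing) (n : ℕ) : 0 < S.w n := by
  have hb := hS.b_nonneg
  have hbn := hS.bn_pos n
  have hε := hS.ε_pos n
  have hl := hS.log_pos n
  have hB : 0 < S.B n := by unfold B; positivity
  unfold w
  positivity

lemma ρ_sq (n : ℕ) : S.ρ n ^ 2 =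
    ((n : ℝ) + S.r n + 1) / (n * S.r n) + S.w n ^ 2 / (n * S.r n) :=
  Real.sq_sqrt (by positivity)

lemma ρ_sq_ge {n : ℕ} (hn : 0 < n) (hr : 0 < S.r n) :
    1 / (n : ℝ) + 1 / S.r n ≤ S.ρ n ^ 2 := by
  have hn' : (0 : ℝ) < n := by exact_mod_cast hn
  have hr' : (0 : ℝ) < S.r n := by exact_mod_cast hr
  rw [ρ_sq]
  have : 1 / (n : ℝ) + 1 / S.r n = ((n : ℝ) + S.r n) / (n * S.r n) := by field_simp; ring
  rw [this]
  have h1 : ((n : ℝ) + S.r n) / (n * S.r n) ≤ ((n : ℝ) + S.r n + 1) / (n * S.r n) := by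
    exact div_le_div_of_nonneg_right (by linarith) (by positivity)
  have h2 : 0 ≤ S.w n ^ 2 / (n * S.r n) := by positivity
  linarith

lemma ρ_pos {n : ℕ} (hn : 0 < n) (hr : 0 < S.r n) : 0 < S.ρ n := by
  have hn' : (0 : ℝ) < n := by exact_mod_cast hn
  have hr' : (0 : ℝ) < S.r n := by exact_mod_cast hr
  have h := ρ_sq_ge hn hr
  have h2 : 0 ≤ S.ρ n := Real.sqrt_nonneg _
  have h3 : 0 < 1 / (n : ℝ) + 1 / S.r n := by positivity
  by_contra h4
  have : S.ρ n = 0 := le_antisymm (not_lt.1 h4) h2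
  rw [this, zero_pow two_ne_zero] at h
  linarith

lemma ρ_sq_le {n : ℕ} (hn : 0 < n) (hr : 0 < S.r n) :
    S.ρ n ^ 2 ≤ 1 / (n : ℝ) + 2 * (1 + S.w n ^ 2 / n) / S.r n := by
  have hn' : (1 : ℝ) ≤ n := by exact_mod_cast hn
  have hn0 : (0 : ℝ) < n := by linarith
  have hr' : (0 : ℝ) < S.r n := by exact_mod_cast hr
  rw [ρ_sq]
  have e : 1 / (n : ℝ) + 2 * (1 + S.w n ^ 2 / n) / S.r n =
      ((S.r n : ℝ) + 2 * n + 2 * S.w n ^ 2) / (n * S.r n) := by field_simp; ring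
  rw [e, ← add_div]
  refine div_le_div_of_nonneg_right ?_ (by positivity)
  nlinarith [sq_nonneg (S.w n)]

/-! ### Rates forced by the error condition when s₀ is proportional to p -/

section Rates

variable {c₀ : ℝ}

lemma Standing.eventually_size (hS : S.Standing) (hc₀ : 0 < c₀)
    (hs : Tendsto (fun n => (S.s₀ n : ℝ) / S.p n) atTop (𝓝 c₀)) :
    ∀ᶠ n in atTop, 1 ≤ n ∧ 1 ≤ S.r n ∧ 2 ≤ S.p n ∧ 1 ≤ S.logDim n ∧
      c₀ / 2 * S.p n ≤ S.s₀ n := by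
  filter_upwards [eventually_ge_atTop 1, hS.r_tendsto.eventually_ge_atTop 1,
    hS.p_tendsto.eventually_ge_atTop 2, hs.eventually (le_mem_nhds (half_lt_self hc₀))]
    with n h1 h2 h3 h4
  refine ⟨h1, h2, h3, ?_, ?_⟩
  · have h3' : (2 : ℝ) ≤ S.p n := by exact_mod_cast h3
    unfold logDim
    rw [Real.le_log_iff_exp_le (by linarith)]
    have := Real.exp_one_lt_d9
    linarith
  · rwa [le_div_iff₀ (by exact_mod_cast (by omega : 0 < S.p n))] at h4

/-- The penalty is at least the noise level σ/√n (and σ/√r, in `lam_ge_right`), so p λ → 0 yields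
p²/n → 0 and p²/r → 0. -/
lemma lam_ge_left (hσ : 0 < S.σ) {n : ℕ} (hℓ : 1 ≤ S.logDim n) :
    S.σ * √(1 / n) ≤ S.lam 1 n := by
  unfold lam
  rw [one_mul]
  gcongr
  refine le_max_of_le_left (Real.sqrt_le_sqrt ?_)
  gcongr

lemma lam_ge_right (hσ : 0 < S.σ) {n : ℕ} (hℓ : 1 ≤ S.logDim n) :
    S.σ * √(1 / S.r n) ≤ S.lam 1 n := by
  unfold lam
  rw [one_mul]
  gcongr
  refine le_max_of_le_right (Real.sqrt_le_sqrt ?_)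
  gcongr
  exact one_le_pow₀ hℓ

/-- The largeness hypothesis of `rate_bounds` holds eventually because s₀ ≥ c₀p/2 → ∞ while logDim ≥
1. -/
lemma eventually_rate_bounds (hS : S.Standing) (hD : S.Debiasing 1) (hc₀ : 0 < c₀)
    (hs : Tendsto (fun n => (S.s₀ n : ℝ) / S.p n) atTop (𝓝 c₀)) {ε : ℝ} (hε : 0 < ε) :
    ∀ᶠ n in atTop, S.s₀ n * S.logDim n * (S.w n ^ 2 / n) ^ 2 ≤ S.σ ^ 2 * ε ^ 2 ∧
      S.lam 1 n * S.s₀ n * √(S.logDim n) ≤ ε * S.σ := by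
  have hp : Tendsto (fun n => c₀ / 2 * (S.p n : ℝ)) atTop atTop :=
    (tendsto_natCast_atTop_atTop.comp hS.p_tendsto).const_mul_atTop (by positivity)
  filter_upwards [hS.eventually_size hc₀ hs, hD.error.bound hε,
    hp.eventually_gt_atTop (S.σ ^ 2 * ε ^ 2)] with n ⟨h1, h2, h3, h4, h5⟩ h6 h7
  have hn : (1 : ℝ) ≤ n := by exact_mod_cast h1
  have hr : (1 : ℝ) ≤ S.r n := by exact_mod_cast h2
  have hn0 : (0 : ℝ) < n := by linarith
  have hr0 : (0 : ℝ) < S.r n := by linarith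
  have hw := hS.w_pos n
  have hρ := ρ_pos (S := S) (n := n) (by omega) (by omega)
  have hσ := hS.σ_pos
  have hlam : 0 < S.lam 1 n := lt_of_lt_of_le (by positivity) (lam_ge_left hσ h4)
  have hs0 : (0 : ℝ) < S.s₀ n := lt_of_lt_of_le (lt_of_le_of_lt (by positivity) h7) h5
  have hℓ : 0 < S.logDim n := by linarith
  refine rate_bounds hn hr hs0 hℓ hσ (by positivity) hlam hρ hε
    (ρ_sq_le (by omega) (by omega)) ?_ ?_
  · have e1 : (0 : ℝ) ≤ 1 / (S.σ * S.ρ n) * (4 * S.κ 1 n ^ 2 / (S.lam 1 n * S.φw n)) := by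
      unfold φw; positivity
    have e2 : (0 : ℝ) ≤ min (√(n / S.logDim n)) (min (√(S.r n / S.logDim n))
        (min (n / S.w n ^ 2 * √(S.r n / S.logDim n))
          (√(n * S.r n) / (S.w n * S.logDim n)))) := by positivity
    rw [Real.norm_of_nonneg e1, Real.norm_of_nonneg e2] at h6
    refine h6.trans ?_
    gcongr
    rw [one_div_div]
    exact min_le_left _ _
  · calc S.σ ^ 2 * ε ^ 2 < S.s₀ n := h7.trans_le h5
      _ ≤ _ := le_mul_of_one_le_right hs0.le h4

/-- The deterministic rates implied by the debiasing conditions. -/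
structure Rates (S : Params) : Prop where
  v : Tendsto (fun n : ℕ => S.w n ^ 2 / n) atTop (𝓝 0)
  pv : Tendsto (fun n : ℕ => (S.p n : ℝ) * (S.w n ^ 2 / n) ^ 2) atTop (𝓝 0)
  plam : Tendsto (fun n : ℕ => (S.p n : ℝ) * S.lam 1 n) atTop (𝓝 0)
  pn : Tendsto (fun n : ℕ => (S.p n : ℝ) ^ 2 / n) atTop (𝓝 0)
  pr : Tendsto (fun n : ℕ => (S.p n : ℝ) ^ 2 / S.r n) atTop (𝓝 0)

/-- The bounds on s₀ pass to p through s₀ ≥ c₀p/2, the logarithms being dropped since they are at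
least 1. The rate v → 0 follows from p v² → 0 and p ≥ 1. -/
lemma rates (hS : S.Standing) (hD : S.Debiasing 1) (hc₀ : 0 < c₀)
    (hs : Tendsto (fun n => (S.s₀ n : ℝ) / S.p n) atTop (𝓝 c₀)) : Rates S := by
  have hσ := hS.σ_pos
  have size := hS.eventually_size hc₀ hs
  have hpv : Tendsto (fun n : ℕ => (S.p n : ℝ) * (S.w n ^ 2 / n) ^ 2) atTop (𝓝 0) := by
    rw [Metric.tendsto_nhds]
    intro ε hε
    -- Chosen so that σ²e² = c₀ε/4, which after division by c₀/2 leaves p v² ≤ ε/2.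
    set e := √(c₀ / 4 * ε) / S.σ with he
    have he0 : 0 < e := by positivity
    have hee : S.σ ^ 2 * e ^ 2 = c₀ / 4 * ε := by
      rw [he, div_pow, Real.sq_sqrt (by positivity)]; field_simp
    filter_upwards [eventually_rate_bounds hS hD hc₀ hs he0, size]
      with n ⟨h, _⟩ ⟨h1, h2, h3, h4, h5⟩
    rw [hee] at h
    rw [dist_zero_right, Real.norm_of_nonneg (by positivity)]
    have : c₀ / 2 * (S.p n * (S.w n ^ 2 / n) ^ 2) ≤ c₀ / 4 * ε := by
      calc c₀ / 2 * (S.p n * (S.w n ^ 2 / n) ^ 2)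
          = c₀ / 2 * S.p n * 1 * (S.w n ^ 2 / n) ^ 2 := by ring
        _ ≤ S.s₀ n * S.logDim n * (S.w n ^ 2 / n) ^ 2 := by gcongr
        _ ≤ _ := h
    nlinarith
  have hpl : Tendsto (fun n : ℕ => (S.p n : ℝ) * S.lam 1 n) atTop (𝓝 0) := by
    rw [Metric.tendsto_nhds]
    intro ε hε
    have he0 : 0 < c₀ / 4 * ε / S.σ := by positivity
    filter_upwards [eventually_rate_bounds hS hD hc₀ hs he0, size]
      with n ⟨_, h⟩ ⟨h1, h2, h3, h4, h5⟩
    have hl : 0 ≤ S.lam 1 n := le_trans (by positivity) (lam_ge_left hσ h4)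
    rw [div_mul_cancel₀ _ hσ.ne'] at h
    rw [dist_zero_right, Real.norm_of_nonneg (by positivity)]
    have : c₀ / 2 * (S.p n * S.lam 1 n) ≤ c₀ / 4 * ε := by
      calc c₀ / 2 * (S.p n * S.lam 1 n) = S.lam 1 n * (c₀ / 2 * S.p n) * 1 := by ring
        _ ≤ S.lam 1 n * S.s₀ n * √(S.logDim n) := by
            gcongr
            exact Real.one_le_sqrt.2 h4
        _ ≤ _ := h
    nlinarith
  have hsq : ∀ q : ℕ → ℝ, (∀ᶠ n in atTop, 0 < q n ∧ S.σ * √(1 / q n) ≤ S.lam 1 n) →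
      Tendsto (fun n : ℕ => (S.p n : ℝ) ^ 2 / q n) atTop (𝓝 0) := by
    intro q hq
    have h0 : Tendsto (fun n : ℕ => ((S.p n : ℝ) * S.lam 1 n) ^ 2 / S.σ ^ 2) atTop (𝓝 0) := by
      simpa using (hpl.pow 2).div_const (S.σ ^ 2)
    refine tendsto_of_tendsto_of_tendsto_of_le_of_le' tendsto_const_nhds h0 ?_ ?_
    · filter_upwards [hq] with n hn
      have := hn.1
      positivity
    · filter_upwards [hq] with n ⟨hn, hl⟩
      rw [le_div_iff₀ (by positivity), mul_pow]
      have := pow_le_pow_left₀ (by positivity) hl 2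
      rw [mul_pow, Real.sq_sqrt (by positivity)] at this
      calc (S.p n : ℝ) ^ 2 / q n * S.σ ^ 2 = S.p n ^ 2 * (S.σ ^ 2 * (1 / q n)) := by ring
        _ ≤ _ := by gcongr
  refine ⟨?_, hpv, hpl, hsq _ ?_, hsq _ ?_⟩
  · have h0 : Tendsto (fun n : ℕ => √((S.p n : ℝ) * (S.w n ^ 2 / n) ^ 2)) atTop (𝓝 0) := by
      simpa using hpv.sqrt
    refine tendsto_of_tendsto_of_tendsto_of_le_of_le' tendsto_const_nhds h0 ?_ ?_
    · exact Eventually.of_forall fun n => by positivity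
    · filter_upwards [size] with n ⟨h1, h2, h3, h4, h5⟩
      refine Real.le_sqrt_of_sq_le (le_mul_of_one_le_left (by positivity) ?_)
      exact_mod_cast (by omega : 1 ≤ S.p n)
  · filter_upwards [size] with n ⟨h1, h2, h3, h4, h5⟩
    exact ⟨by exact_mod_cast h1, lam_ge_left hσ h4⟩
  · filter_upwards [size] with n ⟨h1, h2, h3, h4, h5⟩
    exact ⟨by exact_mod_cast h2, lam_ge_right hσ h4⟩

end Rates

end Params

/-! ### Sums of independent variables -/

lemma expLE_sum_indep {Ω κ : Type*} [MeasurableSpace Ω] {P : Measure Ω} [IsProbabilityMeasure P]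
    [Fintype κ] {Z : κ → Ω → ℝ} (hL : ∀ k, MemLp (Z k) 2 P)
    (hind : Pairwise fun i j => IndepFun (Z i) (Z j) P) {m s : κ → ℝ}
    (hm : ∀ k, ∫ x, Z k x ∂P = m k) (hs : ∀ k, ∫ x, Z k x ^ 2 ∂P ≤ s k) :
    ExpLE P (fun x => (∑ k, Z k x - ∑ k, m k) ^ 2) (∑ k, s k) := by
  have hsum : Var[∑ k, Z k; P] = ∑ k, Var[Z k; P] :=
    IndepFun.variance_sum (fun k _ => hL k) fun i _ j _ hij => hind hij
  have hLs : MemLp (∑ k, Z k) 2 P := memLp_finsetSum' _ fun k _ => hL k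
  have hmean : ∫ x, (∑ k, Z k) x ∂P = ∑ k, m k := by
    simp only [Finset.sum_apply]
    rw [integral_finsetSum _ fun k _ => (hL k).integrable (by norm_num)]
    simp [hm]
  have hev := evariance_eq_lintegral_ofReal (∑ k, Z k) P
  rw [hmean] at hev
  have : ∫⁻ x, ENNReal.ofReal ((∑ k, Z k x - ∑ k, m k) ^ 2) ∂P = eVar[∑ k, Z k; P] := by
    rw [hev]; simp
  unfold ExpLE
  rw [this, ← hLs.ofReal_variance_eq, hsum]
  refine ENNReal.ofReal_le_ofReal (Finset.sum_le_sum fun k _ => ?_)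
  exact (variance_le_expectation_sq (hL k).aestronglyMeasurable).trans (hs k)

lemma expLE_sum_pi {α κ : Type*} [MeasurableSpace α] {ν : Measure α} [IsProbabilityMeasure ν]
    [Fintype κ] {q : κ → α → ℝ} (hq : ∀ k, Measurable (q k)) (hL : ∀ k, MemLp (q k) 2 ν)
    {m s : κ → ℝ} (hm : ∀ k, ∫ x, q k x ∂ν = m k) (hs : ∀ k, ∫ x, q k x ^ 2 ∂ν ≤ s k) :
    ExpLE (Measure.pi fun _ : κ => ν) (fun x => (∑ k, q k (x k) - ∑ k, m k) ^ 2) (∑ k, s k) := by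
  have hmp : ∀ k, MeasurePreserving (Function.eval k) (Measure.pi fun _ : κ => ν) ν := fun k =>
    measurePreserving_eval _ k
  have hmap : ∀ k (u : α → ℝ), Measurable u →
      ∫ x, u (x k) ∂(Measure.pi fun _ : κ => ν) = ∫ x, u x ∂ν := by
    intro k u hu
    conv_rhs => rw [← (hmp k).map_eq]
    rw [integral_map (measurable_pi_apply k).aemeasurable hu.aestronglyMeasurable]
  have hind : iIndepFun (fun k (x : κ → α) => q k (x k)) (Measure.pi fun _ : κ => ν) :=
    iIndepFun_pi (X := q) (fun k => (hq k).aemeasurable)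
  have hL' : ∀ k, MemLp (fun x : κ → α => q k (x k)) 2 (Measure.pi fun _ : κ => ν) := fun k =>
    (hL k).comp_measurePreserving (hmp k)
  refine expLE_sum_indep hL' (fun i j hij => hind.indepFun hij) (fun k => ?_) (fun k => ?_)
  · rw [hmap k _ (hq k), hm]
  · rw [hmap k (fun x => q k x ^ 2) ((hq k).pow_const 2)]
    exact hs k

lemma expLE_sum_apply_pi {α κ : Type*} [MeasurableSpace α] {ν : Measure α}
    [IsProbabilityMeasure ν] [Fintype κ] {q : α → ℝ} (hq : Measurable q) {s : ℝ} (hs0 : 0 ≤ s)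
    (hs : ExpLE ν q s) :
    ExpLE (Measure.pi fun _ : κ => ν) (fun x => ∑ k, q (x k)) (Fintype.card κ * s) := by
  have h := ExpLE.sum (μ := Measure.pi fun _ : κ => ν) Finset.univ (f := fun k x => q (x k))
    (a := fun _ => s) (fun k _ => (ExpLE.of_map (measurable_pi_apply k)
      (measurePreserving_eval (fun _ : κ => ν) k).map_eq hq).1 hs) (fun k => by fun_prop)
    (fun _ => hs0)
  simpa using h

/-! ### Moments of the design law -/

lemma integral_sq_eq_one {D : Measure ℝ} (h0 : ∫ x, x ∂D = 0)
    (h1 : Var[fun x : ℝ => x; D] = 1) : ∫ x, x ^ 2 ∂D = 1 := by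
  rw [variance_of_integral_eq_zero (by fun_prop) h0] at h1
  exact h1

section Design

variable {D : Measure ℝ} [IsProbabilityMeasure D] {b : ℝ}

lemma memLp_of_abs_le (hb : ∀ᵐ x ∂D, |x| ≤ b) (q : ENNReal) : MemLp (fun x : ℝ => x) q D :=
  MemLp.of_bound (by fun_prop) b (by simpa using hb)

lemma expLE_design_linear {n : ℕ} (hb : ∀ᵐ x ∂D, |x| ≤ b) (h0 : ∫ x, x ∂D = 0)
    (h1 : ∫ x, x ^ 2 ∂D = 1) (a : Fin n → ℝ) :
    ExpLE (Measure.pi fun _ : Fin n => D) (fun x => (∑ i, x i * a i) ^ 2) (∑ i, a i ^ 2) := by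
  have h := expLE_sum_pi (ν := D) (q := fun i x => x * a i) (m := fun _ => 0)
    (s := fun i => a i ^ 2) (fun i => by fun_prop)
    (fun i => (memLp_of_abs_le hb 2).mul_const (a i))
    (fun i => by rw [integral_mul_const, h0, zero_mul])
    (fun i => by simp only [mul_pow]; rw [integral_mul_const, h1, one_mul])
  simpa using h

/-- Empirical correlations of two columns of the design. -/
lemma expLE_design_gram {C : Type*} [Fintype C] [DecidableEq C] {n : ℕ}
    (hb : ∀ᵐ x ∂D, |x| ≤ b) (h0 : ∫ x, x ∂D = 0)
    (h1 : ∫ x, x ^ 2 ∂D = 1) (c d : C) :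
    ExpLE (Measure.pi fun _ : C => Measure.pi fun _ : Fin n => D)
      (fun X => (∑ i, X c i * X d i - n * (if c = d then 1 else 0)) ^ 2) (n * b ^ 4) := by
  set ν := Measure.pi fun _ : C => D with hν
  have hmp : ∀ k, MeasurePreserving (Function.eval k) ν D := fun k => measurePreserving_eval _ k
  have hbk : ∀ k, ∀ᵐ z ∂ν, |z k| ≤ b := fun k => (hmp k).quasiMeasurePreserving.ae hb
  have hbd : ∀ᵐ z ∂ν, |z c * z d| ≤ b ^ 2 := by
    filter_upwards [hbk c, hbk d] with z h1 h2
    rw [abs_mul, sq]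
    exact mul_le_mul h1 h2 (abs_nonneg _) ((abs_nonneg _).trans h1)
  have hL : MemLp (fun z : C → ℝ => z c * z d) 2 ν :=
    MemLp.of_bound (Measurable.aestronglyMeasurable (by fun_prop)) (b ^ 2) (by simpa using hbd)
  have hmap : ∀ k (u : ℝ → ℝ), Measurable u → ∫ z, u (z k) ∂ν = ∫ x, u x ∂D := by
    intro k u hu
    conv_rhs => rw [← (hmp k).map_eq]
    rw [integral_map (measurable_pi_apply k).aemeasurable hu.aestronglyMeasurable]
  have hmean : ∫ z, z c * z d ∂ν = if c = d then 1 else 0 := by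
    split_ifs with h
    · subst h
      simp only [← sq]
      rw [hmap c (fun x => x ^ 2) (by fun_prop), h1]
    · have hi : IndepFun (fun z : C → ℝ => z c) (fun z => z d) ν :=
        (iIndepFun_pi (μ := fun _ : C => D) (X := fun _ x => x)
          (fun k => aemeasurable_id)).indepFun h
      rw [hi.integral_fun_mul_eq_mul_integral
        (measurable_pi_apply c).aestronglyMeasurable (measurable_pi_apply d).aestronglyMeasurable,
        hmap c (fun x => x) (by fun_prop), h0, zero_mul]
  have hsq : ∫ z, (z c * z d) ^ 2 ∂ν ≤ b ^ 4 := by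
    have : ∫ z, (z c * z d) ^ 2 ∂ν ≤ ∫ z, b ^ 4 ∂ν := by
      refine integral_mono_ae hL.integrable_sq (integrable_const _) ?_
      filter_upwards [hbd] with z hz
      calc (z c * z d) ^ 2 = |z c * z d| ^ 2 := (sq_abs _).symm
        _ ≤ (b ^ 2) ^ 2 := by gcongr
        _ = b ^ 4 := by ring
    simpa using this
  have h := expLE_sum_pi (κ := Fin n) (ν := ν) (q := fun _ z => z c * z d)
    (m := fun _ => if c = d then 1 else 0)
    (s := fun _ => b ^ 4) (fun i => by fun_prop) (fun _ => hL) (fun _ => hmean) (fun _ => hsq)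
  -- Reading the design by rows, the summands are functions of independent rows.
  rw [hν, ExpLE.of_map (by fun_prop) (map_transpose_pi_pi (κ := C) (ι := Fin n) D)
    (by fun_prop)] at h
  simpa using h

end Design

/-! ### Moments of the truncated noise -/

namespace Params

variable {S : Params}

lemma Standing.tendsto_bn (hS : S.Standing) : Tendsto S.bn atTop atTop := by
  have h1 : Tendsto (fun n => S.bn n / S.σ) atTop atTop := by
    refine tendsto_atTop_mono (fun n => ?_) hS.bn_large
    have := Real.sqrt_nonneg (2 * Real.log (2 * (n : ℝ)))
    linarith
  have := h1.atTop_mul_const hS.σ_pos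
  refine this.congr fun n => ?_
  field_simp [hS.σ_pos.ne']

/-- The untruncated law of the noise. -/
noncomputable abbrev fullNoise (S : Params) : Measure ℝ := gaussianReal 0 (S.σ ^ 2).toNNReal

lemma Standing.noise_prob (hS : S.Standing) (n : ℕ) : IsProbabilityMeasure (S.noiseLaw n) := by
  refine cond_isProbabilityMeasure fun h0 => ?_
  have hv : (S.σ ^ 2).toNNReal ≠ 0 := by
    have := hS.σ_pos
    simp only [ne_eq, Real.toNNReal_eq_zero, not_le]; positivity
  have := gaussianReal_absolutelyContinuous' 0 hv h0
  rw [Real.volume_Icc, ENNReal.ofReal_eq_zero] at this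
  linarith [hS.bn_pos n]

/-- The truncation intervals exhaust the line, so the truncated integral and the normalizing mass
both converge. -/
lemma Standing.tendsto_noise (hS : S.Standing) {g : ℝ → ℝ} (hg : Integrable g S.fullNoise) :
    Tendsto (fun n => ∫ x, g x ∂S.noiseLaw n) atTop (𝓝 (∫ x, g x ∂S.fullNoise)) := by
  have hcov : AECover S.fullNoise atTop fun n => Icc (-S.bn n) (S.bn n) :=
    aecover_Icc (tendsto_neg_atTop_atBot.comp hS.tendsto_bn) hS.tendsto_bn
  have h1 := hcov.integral_tendsto_of_countably_generated hg
  have h2 := hcov.integral_tendsto_of_countably_generated (integrable_const (1 : ℝ))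
  have h3 := h2.inv₀ (by simp)
  have h4 := h3.mul h1
  simp only [integral_const, probReal_univ, smul_eq_mul, mul_one, inv_one, one_mul] at h4
  refine h4.congr fun n => ?_
  rw [noiseLaw, ProbabilityTheory.cond, integral_smul_measure]
  simp [Measure.real]

lemma Standing.integrable_noise (n : ℕ) {g : ℝ → ℝ} (hg : Integrable g S.fullNoise) :
    Integrable g (S.noiseLaw n) := by
  by_cases h : S.fullNoise (Icc (-S.bn n) (S.bn n)) = 0
  · have : S.noiseLaw n = 0 := by
      rw [noiseLaw, ProbabilityTheory.cond, Measure.restrict_eq_zero.2 h, smul_zero]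
    rw [this]; exact integrable_zero_measure
  · rw [noiseLaw, ProbabilityTheory.cond]
    exact hg.restrict.smul_measure (ENNReal.inv_ne_top.2 h)

/-- Second moment of the truncated noise. -/
noncomputable def noiseSq (S : Params) (n : ℕ) : ℝ := ∫ x, x ^ 2 ∂S.noiseLaw n

/-- Fourth moment of the truncated noise. -/
noncomputable def noiseFourth (S : Params) (n : ℕ) : ℝ := ∫ x, x ^ 4 ∂S.noiseLaw n

lemma noiseSq_nonneg (n : ℕ) : 0 ≤ S.noiseSq n := integral_nonneg fun x => by positivity

lemma noiseFourth_nonneg (n : ℕ) : 0 ≤ S.noiseFourth n := integral_nonneg fun x => by positivity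

lemma Standing.tendsto_noiseSq (hS : S.Standing) : Tendsto S.noiseSq atTop (𝓝 (S.σ ^ 2)) := by
  have := hS.tendsto_noise (integrable_pow_gaussianReal (S.σ ^ 2).toNNReal 2)
  rwa [integral_sq_gaussianReal, Real.coe_toNNReal _ (by positivity)] at this

lemma Standing.exists_noiseFourth_le (hS : S.Standing) :
    ∃ K > 0, ∀ᶠ n in atTop, S.noiseFourth n ≤ K := by
  have := hS.tendsto_noise (integrable_pow_gaussianReal (S.σ ^ 2).toNNReal 4)
  exact ⟨_, lt_of_lt_of_le one_pos (le_max_right (∫ x, x ^ 4 ∂S.fullNoise + 1) 1),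
    (this.eventually (ge_mem_nhds (lt_add_one _))).mono fun n hn => hn.trans (le_max_left _ _)⟩

lemma Standing.expLE_noise_sq (hS : S.Standing) (n : ℕ) :
    ExpLE (Measure.pi fun _ : Fin n => S.noiseLaw n) (fun ξ => ∑ i, ξ i ^ 2)
      (n * S.noiseSq n) := by
  have := hS.noise_prob n
  have h := expLE_sum_apply_pi (κ := Fin n) (ν := S.noiseLaw n) (q := fun x => x ^ 2)
    (by fun_prop) (noiseSq_nonneg n)
    (.of_integral (integrable_noise n (integrable_pow_gaussianReal _ 2))
      (fun x => by positivity) le_rfl)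
  simpa using h

lemma Standing.expLE_noise_fourth (hS : S.Standing) (n : ℕ) :
    ExpLE (Measure.pi fun _ : Fin n => S.noiseLaw n) (fun ξ => ∑ i, ξ i ^ 4)
      (n * S.noiseFourth n) := by
  have := hS.noise_prob n
  have h := expLE_sum_apply_pi (κ := Fin n) (ν := S.noiseLaw n) (q := fun x => x ^ 4)
    (by fun_prop) (noiseFourth_nonneg n)
    (.of_integral (integrable_noise n (integrable_pow_gaussianReal _ 4))
      (fun x => by positivity) le_rfl)
  simpa using h

lemma Standing.expLE_noise_var (hS : S.Standing) (n : ℕ) :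
    ExpLE (Measure.pi fun _ : Fin n => S.noiseLaw n)
      (fun ξ => (∑ i, ξ i ^ 2 - n * S.noiseSq n) ^ 2) (n * S.noiseFourth n) := by
  have := hS.noise_prob n
  have h := expLE_sum_pi (κ := Fin n) (ν := S.noiseLaw n) (q := fun _ x => x ^ 2)
    (m := fun _ => S.noiseSq n) (s := fun _ => S.noiseFourth n) (fun _ => by fun_prop)
    (fun _ => (memLp_two_iff_integrable_sq (by fun_prop)).2 (by
      have := integrable_noise (S := S) n (integrable_pow_gaussianReal (S.σ ^ 2).toNNReal 4)
      refine this.congr (ae_of_all _ fun x => ?_)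
      simp only; ring)) (fun _ => rfl)
    (fun _ => le_of_eq (by unfold noiseFourth; congr 1; ext x; ring))
  simpa using h

end Params

/-! ### Error of the Lasso for a nearly orthogonal design -/

section Lasso

variable {K C : Type*} [Fintype K] [Fintype C]

lemma sum_mulVec_sq_le (E : C → C → ℝ) (x : C → ℝ) :
    ∑ c, (∑ d, E c d * x d) ^ 2 ≤ (∑ c, ∑ d, E c d ^ 2) * ∑ d, x d ^ 2 := by
  rw [Finset.sum_mul]
  exact Finset.sum_le_sum fun c _ => Finset.sum_mul_sq_le_sq_mul_sq _ _ _

/-- The Gram matrix differs from (1 + v)I by at most 1/2 in Frobenius norm, hence in operator norm,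
so the quadratic loss is strongly convex. Comparing objectives at θ and θ₀ and absorbing the linear
terms suffices; sparsity plays no role, and the ℓ₁ penalty is charged on all coordinates. -/
lemma lasso_error_le [DecidableEq C] {A : K → C → ℝ} {e : K → ℝ} {θ₀ θ : C → ℝ} {n lam v : ℝ}
    (hn : 0 < n) (hlam : 0 ≤ lam) (hv : 0 ≤ v)
    (hτ : ∑ c, ∑ d, ((1 + v) * (if c = d then 1 else 0) - 1 / n * ∑ k, A k c * A k d) ^ 2 ≤ 1 / 4)
    (hθ : 1 / (2 * n) * ∑ k, (∑ c, A k c * θ c - (∑ c, A k c * θ₀ c + e k)) ^ 2 +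
        lam * ∑ c, |θ c| ≤
      1 / (2 * n) * ∑ k, (∑ c, A k c * θ₀ c - (∑ c, A k c * θ₀ c + e k)) ^ 2 +
        lam * ∑ c, |θ₀ c|) :
    ∑ c, (θ c - θ₀ c) ^ 2 ≤
      32 * (∑ c, (1 / n * ∑ k, A k c * e k) ^ 2 + Fintype.card C * lam ^ 2) := by
  set Δ : C → ℝ := fun c => θ c - θ₀ c with hΔ
  set E : C → C → ℝ := fun c d =>
    (1 + v) * (if c = d then 1 else 0) - 1 / n * ∑ k, A k c * A k d with hE
  set g : C → ℝ := fun c => 1 / n * ∑ k, A k c * e k with hg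
  have hquad : ∑ c, Δ c * ∑ d, E c d * Δ d =
      (1 + v) * ∑ c, Δ c ^ 2 - 1 / n * ∑ k, (∑ c, A k c * Δ c) ^ 2 := by
    have h1 : ∀ c, ∑ d, E c d * Δ d = (1 + v) * Δ c - 1 / n * ∑ k, A k c * ∑ d, A k d * Δ d := by
      intro c
      simp only [hE, sub_mul, Finset.sum_sub_distrib]
      congr 1
      · simp
      · simp only [Finset.mul_sum, Finset.sum_mul]
        rw [Finset.sum_comm]
        refine Finset.sum_congr rfl fun k _ => Finset.sum_congr rfl fun d _ => by ring
    simp only [h1, mul_sub, Finset.sum_sub_distrib]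
    congr 1
    · rw [Finset.mul_sum]
      exact Finset.sum_congr rfl fun c _ => by ring
    · simp only [sq, Finset.sum_mul]
      simp only [Finset.mul_sum]
      rw [Finset.sum_comm]
      refine Finset.sum_congr rfl fun k _ => Finset.sum_congr rfl fun d _ =>
        Finset.sum_congr rfl fun c _ => by ring
  have hbound : ∑ c, Δ c * ∑ d, E c d * Δ d ≤ 1 / 2 * ∑ c, Δ c ^ 2 := by
    have h0 : 0 ≤ ∑ c, Δ c ^ 2 := Finset.sum_nonneg fun c _ => sq_nonneg _
    refine le_of_sq_le_sq ?_ (by positivity)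
    calc (∑ c, Δ c * ∑ d, E c d * Δ d) ^ 2
        ≤ (∑ c, Δ c ^ 2) * ∑ c, (∑ d, E c d * Δ d) ^ 2 := Finset.sum_mul_sq_le_sq_mul_sq _ _ _
      _ ≤ (∑ c, Δ c ^ 2) * ((∑ c, ∑ d, E c d ^ 2) * ∑ d, Δ d ^ 2) := by
          gcongr; exact sum_mulVec_sq_le E Δ
      _ ≤ (∑ c, Δ c ^ 2) * (1 / 4 * ∑ d, Δ d ^ 2) := by gcongr
      _ = _ := by ring
  have hbasic : 1 / (2 * n) * ∑ k, (∑ c, A k c * Δ c) ^ 2 ≤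
      ∑ c, g c * Δ c + lam * ∑ c, |Δ c| := by
    have h1 : ∑ k, (∑ c, A k c * θ c - (∑ c, A k c * θ₀ c + e k)) ^ 2 =
        ∑ k, (∑ c, A k c * Δ c) ^ 2 - 2 * ∑ k, (∑ c, A k c * Δ c) * e k + ∑ k, e k ^ 2 := by
      rw [Finset.mul_sum, ← Finset.sum_sub_distrib, ← Finset.sum_add_distrib]
      refine Finset.sum_congr rfl fun k _ => ?_
      simp only [hΔ, mul_sub, Finset.sum_sub_distrib]
      ring
    have h2 : ∑ k, (∑ c, A k c * θ₀ c - (∑ c, A k c * θ₀ c + e k)) ^ 2 = ∑ k, e k ^ 2 := by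
      refine Finset.sum_congr rfl fun k _ => by ring
    have h3 : ∑ c, g c * Δ c = 1 / n * ∑ k, (∑ c, A k c * Δ c) * e k := by
      simp only [hg, Finset.mul_sum, Finset.sum_mul]
      rw [Finset.sum_comm]
      refine Finset.sum_congr rfl fun k _ => Finset.sum_congr rfl fun c _ => by ring
    have h4 : ∑ c, |θ₀ c| ≤ ∑ c, |θ c| + ∑ c, |Δ c| := by
      rw [← Finset.sum_add_distrib]
      refine Finset.sum_le_sum fun c _ => ?_
      have := abs_sub_abs_le_abs_sub (θ₀ c) (θ c)
      rw [abs_sub_comm] at this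
      simp only [hΔ]; linarith
    rw [h1, h2] at hθ
    rw [h3]
    have h5 : 1 / (2 * n) * (2 * ∑ k, (∑ c, A k c * Δ c) * e k) =
        1 / n * ∑ k, (∑ c, A k c * Δ c) * e k := by field_simp
    have h6 := mul_le_mul_of_nonneg_left h4 hlam
    linarith
  -- Strong convexity gives ‖Δ‖²/4; the two Young inequalities use 1/16 each, leaving 1/8 against
  -- the factor 4, whence 32.
  have hy1 : ∑ c, g c * Δ c ≤ 4 * ∑ c, g c ^ 2 + 1 / 16 * ∑ c, Δ c ^ 2 := by
    rw [Finset.mul_sum, Finset.mul_sum, ← Finset.sum_add_distrib]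
    exact Finset.sum_le_sum fun c _ => by nlinarith [sq_nonneg (2 * g c - 1 / 4 * Δ c)]
  have hy2 : lam * ∑ c, |Δ c| ≤ 4 * (Fintype.card C * lam ^ 2) + 1 / 16 * ∑ c, Δ c ^ 2 := by
    have : (Fintype.card C : ℝ) * lam ^ 2 = ∑ _c : C, lam ^ 2 := by simp
    rw [this, Finset.mul_sum, Finset.mul_sum, Finset.mul_sum, ← Finset.sum_add_distrib]
    refine Finset.sum_le_sum fun c _ => ?_
    rw [← sq_abs (Δ c)]
    nlinarith [sq_nonneg (2 * lam - 1 / 4 * |Δ c|)]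
  have hvv : 0 ≤ v * ∑ c, Δ c ^ 2 :=
    mul_nonneg hv (Finset.sum_nonneg fun c _ => sq_nonneg _)
  have hhalf : 1 / (2 * n) * ∑ k, (∑ c, A k c * Δ c) ^ 2 =
      1 / 2 * (1 / n * ∑ k, (∑ c, A k c * Δ c) ^ 2) := by field_simp
  have e1 : (1 + v) * ∑ c, Δ c ^ 2 = ∑ c, Δ c ^ 2 + v * ∑ c, Δ c ^ 2 := by ring
  linarith

/-- The one-step correction multiplies the estimation error by the Gram deviation. The extra term vθ
accounts for the mean (1 + v)I of the sketched Gram matrix. -/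
lemma debias_error_eq [DecidableEq C] {A : K → C → ℝ} {e : K → ℝ} {θ₀ θ : C → ℝ} {n v : ℝ}
    (c : C) :
    θ c + 1 / n * ∑ k, A k c * ((∑ d, A k d * θ₀ d + e k) - ∑ d, A k d * θ d) + v * θ c =
      θ₀ c + ∑ d, ((1 + v) * (if c = d then 1 else 0) - 1 / n * ∑ k, A k c * A k d) *
        (θ d - θ₀ d) + (1 / n * ∑ k, A k c * e k + v * θ₀ c) := by
  have h1 : ∑ d, ((1 + v) * (if c = d then 1 else 0) - 1 / n * ∑ k, A k c * A k d) *
      (θ d - θ₀ d) = (1 + v) * (θ c - θ₀ c) -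
        1 / n * ∑ k, A k c * (∑ d, A k d * θ d - ∑ d, A k d * θ₀ d) := by
    simp only [sub_mul (_ * _), Finset.sum_sub_distrib]
    congr 1
    · simp
    · simp only [← Finset.sum_sub_distrib, ← mul_sub]
      simp only [Finset.mul_sum, Finset.sum_mul]
      rw [Finset.sum_comm]
      refine Finset.sum_congr rfl fun k _ => Finset.sum_congr rfl fun d _ => by ring
  rw [h1]
  have h2 : ∑ k, A k c * ((∑ d, A k d * θ₀ d + e k) - ∑ d, A k d * θ d) =
      ∑ k, A k c * e k - ∑ k, A k c * (∑ d, A k d * θ d - ∑ d, A k d * θ₀ d) := by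
    rw [← Finset.sum_sub_distrib]
    exact Finset.sum_congr rfl fun k _ => by ring
  rw [h2]
  ring

end Lasso

/-! ### The sketch of the augmented data -/

section Sketch

variable {κ ι : Type*} [Fintype κ] [Fintype ι]

/-- The inner product of the sketches of `a` and `b`. -/
def sketchInner (R : κ → ι → ℝ) (a b : ι → ℝ) : ℝ :=
  ∑ k, (∑ i, a i * R k i) * ∑ i, b i * R k i

lemma sketchInner_add_left (R : κ → ι → ℝ) (a a' b : ι → ℝ) (w : ℝ) :
    sketchInner R (fun i => a i + w * a' i) b = sketchInner R a b + w * sketchInner R a' b := by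
  unfold sketchInner
  rw [Finset.mul_sum, ← Finset.sum_add_distrib]
  refine Finset.sum_congr rfl fun k _ => ?_
  simp only [add_mul, Finset.sum_add_distrib, mul_assoc, ← Finset.mul_sum]

lemma sketchInner_add_right (R : κ → ι → ℝ) (a b b' : ι → ℝ) (w : ℝ) :
    sketchInner R a (fun i => b i + w * b' i) = sketchInner R a b + w * sketchInner R a b' := by
  unfold sketchInner
  rw [Finset.mul_sum, ← Finset.sum_add_distrib]
  refine Finset.sum_congr rfl fun k _ => ?_
  simp only [add_mul, Finset.sum_add_distrib, mul_assoc, ← Finset.mul_sum]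
  ring

end Sketch

/-! ### Random inputs and decomposition of the sketched regression error -/

/-- The random inputs at fixed size: columns of `[X X̃]`, noise, projection. -/
abbrev Inputs (n p r : ℕ) : Type :=
  (Cols p → Fin n → ℝ) × ((Fin n → ℝ) × (Fin r → Fin n ⊕ AugCols p → ℝ))

namespace Inputs

variable {n p r : ℕ}

/-- The vector `(x, 0, 0)`. -/
def pad (p : ℕ) (x : Fin n → ℝ) : Fin n ⊕ AugCols p → ℝ := Sum.elim x 0

/-- The coordinate vector of the column `c`. -/
def unit (n : ℕ) (c : Cols p) : Fin n ⊕ AugCols p → ℝ :=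
  Sum.elim 0 (Sum.elim (fun d => if d = c then 1 else 0) 0)

/-- The column `c` of `[X X̃; w I]`. -/
def col (w : ℝ) (x : Fin n → ℝ) (c : Cols p) : Fin n ⊕ AugCols p → ℝ :=
  fun i => pad p x i + w * unit n c i

/-- The direction `(0, -θ, 1)` of the artificial part of the regression error. -/
def dir (n : ℕ) (θ : Cols p → ℝ) : Fin n ⊕ AugCols p → ℝ := Sum.elim 0 (Sum.elim (-θ) 1)

/-- The regression error `(ξ, -w θ, w)` of the augmented data. -/
def err (w : ℝ) (θ : Cols p → ℝ) (ξ : Fin n → ℝ) : Fin n ⊕ AugCols p → ℝ :=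
  fun i => pad p ξ i + w * dir n θ i

/-- Deviation of the sketched Gram matrix from its mean. -/
noncomputable def gramDev (w : ℝ) (z : Inputs n p r) (c d : Cols p) : ℝ :=
  (1 + w ^ 2 / n) * (if c = d then 1 else 0) -
    1 / n * sketchInner z.2.2 (col w (z.1 c) c) (col w (z.1 d) d)

/-- The leading part of the debiased error. -/
noncomputable def lead (z : Inputs n p r) (c : Cols p) : ℝ :=
  1 / n * ∑ i, z.1 c i * gramVec z.2.1 (fun k i => z.2.2 k (Sum.inl i)) i

/-- The remainder of the debiased error due to the artificial rows. -/
noncomputable def rem (w : ℝ) (θ : Cols p → ℝ) (z : Inputs n p r) (c : Cols p) : ℝ :=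
  w / n * (sketchInner z.2.2 (unit n c) (pad p z.2.1) +
    (sketchInner z.2.2 (col w (z.1 c) c) (dir n θ) + w * θ c))

lemma sketchInner_pad (R : Fin r → Fin n ⊕ AugCols p → ℝ) (x ξ : Fin n → ℝ) :
    sketchInner R (pad p x) (pad p ξ) = ∑ i, x i * gramVec ξ (fun k i => R k (Sum.inl i)) i := by
  unfold sketchInner gramVec pad
  simp only [Fintype.sum_sum_type, Sum.elim_inl, Sum.elim_inr, Pi.zero_apply, zero_mul,
    Finset.sum_const_zero, add_zero]
  simp only [Finset.sum_mul]
  rw [Finset.sum_comm]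
  refine Finset.sum_congr rfl fun i _ => ?_
  rw [Finset.mul_sum]
  exact Finset.sum_congr rfl fun k _ => by ring

/-- Separates the part linear in the data column, which drives the limit law, from the contribution
of the artificial rows wI. The sketch of the latter has mean -w²θ/n, so adding w²θ/n centres `rem`.
-/
lemma sketch_err_eq (w : ℝ) (θ : Cols p → ℝ) (z : Inputs n p r) (c : Cols p) :
    1 / n * sketchInner z.2.2 (col w (z.1 c) c) (err w θ z.2.1) + w ^ 2 / n * θ c =
      lead z c + rem w θ z c := by
  have h1 : sketchInner z.2.2 (col w (z.1 c) c) (err w θ z.2.1) =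
      sketchInner z.2.2 (col w (z.1 c) c) (pad p z.2.1) +
        w * sketchInner z.2.2 (col w (z.1 c) c) (dir n θ) := sketchInner_add_right _ _ _ _ _
  have h2 : sketchInner z.2.2 (col w (z.1 c) c) (pad p z.2.1) =
      sketchInner z.2.2 (pad p (z.1 c)) (pad p z.2.1) +
        w * sketchInner z.2.2 (unit n c) (pad p z.2.1) := sketchInner_add_left _ _ _ _ _
  rw [h1, h2, sketchInner_pad, lead, rem]
  ring

end Inputs

namespace Sample

variable {S : Params} {n : ℕ} {Ω : Type*} (Y : Sample S n Ω)

/-- The random inputs of a sample. -/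
def inputs (ω : Ω) : Inputs n (S.p n) (S.r n) :=
  (fun c i => Y.design ω i c, (Y.ξ ω, Y.R ω))

/-- The coefficients of `[X X̃]`: the true ones, and zero for the knockoffs. -/
def coef (S : Params) (n : ℕ) : Cols (S.p n) → ℝ := Sum.elim (S.θ₀ n) 0

lemma privX_eq (ω : Ω) (k : Fin (S.r n)) (c : Cols (S.p n)) :
    Y.privX ω k c =
      ∑ i, Inputs.col (S.w n) ((Y.inputs ω).1 c) c i * (Y.inputs ω).2.2 k i := by
  simp only [privX, Matrix.toCols₁_apply, priv, Matrix.mul_apply, Fintype.sum_sum_type,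
    Matrix.fromRows_apply_inl, Matrix.fromRows_apply_inr, Matrix.fromCols_apply_inl, inputs,
    Inputs.col, Inputs.pad, Inputs.unit, Sum.elim_inl, Sum.elim_inr, Matrix.smul_apply,
    Matrix.one_apply, Pi.zero_apply, smul_eq_mul, mul_zero, add_zero, zero_add, zero_mul,
    Sum.inl.injEq, reduceCtorEq, if_false, Finset.sum_const_zero]
  simp [mul_comm]

/-- The response column of [A; wI] is (y, 0, w), whereas the design columns combined with the true
coefficients give (Xθ₀, wθ, 0), θ being θ₀ padded with zeros; the difference is `err`. -/
lemma privY_eq (ω : Ω) (k : Fin (S.r n)) :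
    Y.privY ω k = ∑ c, Y.privX ω k c * coef S n c +
      ∑ i, Inputs.err (S.w n) (coef S n) (Y.inputs ω).2.1 i * (Y.inputs ω).2.2 k i := by
  have hA : ∀ c, Y.privX ω k c = ∑ i, Y.R ω k (Sum.inl i) * Y.design ω i c +
      S.w n * Y.R ω k (Sum.inr (Sum.inl c)) := by
    intro c
    simp only [privX, Matrix.toCols₁_apply, priv, Matrix.mul_apply, Fintype.sum_sum_type,
      Matrix.fromRows_apply_inl, Matrix.fromRows_apply_inr, Matrix.fromCols_apply_inl,
      Matrix.smul_apply, Matrix.one_apply]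
    rcases c with c | c <;> simp [mul_comm]
  have hY : Y.privY ω k = ∑ i, Y.R ω k (Sum.inl i) * (∑ j, Y.X ω i j * S.θ₀ n j + Y.ξ ω i) +
      S.w n * Y.R ω k (Sum.inr (Sum.inr ())) := by
    simp only [privY, priv, Matrix.mul_apply, Fintype.sum_sum_type,
      Matrix.fromRows_apply_inl, Matrix.fromRows_apply_inr, Matrix.fromCols_apply_inr,
      Matrix.smul_apply, Matrix.one_apply, Matrix.replicateCol_apply, y, Pi.add_apply,
      Matrix.mulVec, dotProduct]
    simp [mul_comm]
  have hX : ∀ i j, Y.design ω i (Sum.inl j) = Y.X ω i j := fun i j => rfl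
  have hswap : ∑ i, Y.R ω k (Sum.inl i) * ∑ j, Y.X ω i j * S.θ₀ n j =
      ∑ j, (∑ i, Y.R ω k (Sum.inl i) * Y.X ω i j) * S.θ₀ n j := by
    simp only [Finset.mul_sum, Finset.sum_mul]
    rw [Finset.sum_comm]
    exact Finset.sum_congr rfl fun j _ => Finset.sum_congr rfl fun i _ => by ring
  have hE : ∑ i, Inputs.err (S.w n) (coef S n) (Y.inputs ω).2.1 i * (Y.inputs ω).2.2 k i =
      ∑ i, Y.R ω k (Sum.inl i) * Y.ξ ω i -
        ∑ j, S.w n * Y.R ω k (Sum.inr (Sum.inl (Sum.inl j))) * S.θ₀ n j +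
        S.w n * Y.R ω k (Sum.inr (Sum.inr ())) := by
    simp only [inputs, Inputs.err, Inputs.pad, Inputs.dir, coef, Fintype.sum_sum_type,
      Sum.elim_inl, Sum.elim_inr, Pi.zero_apply, Pi.neg_apply, Pi.one_apply, mul_zero, add_zero,
      zero_add, neg_zero, zero_mul, Finset.sum_const_zero, mul_one, Finset.univ_unique,
      Finset.sum_singleton]
    rw [← add_assoc, sub_eq_add_neg, ← Finset.sum_neg_distrib]
    congr 1
    congr 1
    · exact Finset.sum_congr rfl fun i _ => by ring
    · exact Finset.sum_congr rfl fun i _ => by ring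
  rw [hY, hE]
  simp only [hA, coef, Fintype.sum_sum_type, Sum.elim_inl, Sum.elim_inr, Pi.zero_apply, mul_zero,
    Finset.sum_const_zero, add_zero, hX, mul_add, add_mul, Finset.sum_add_distrib, hswap]
  ring

/-- The error is the Gram deviation applied to the Lasso error, plus `rem`. Cauchy–Schwarz and
`lasso_error_le` bound the first part; 64 = 2 · 32, the 2 from squaring a sum. -/
lemma exists_debias_eq (hn : 0 < n) {l : ℝ} (hl : 0 ≤ l) (hθ₀ : ∑ j, S.θ₀ n j ^ 2 = 1) {ω : Ω}
    {θ : Cols (S.p n) → ℝ} (hθ : Y.IsLasso l ω θ)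
    (hτ : ∑ c, ∑ d, Inputs.gramDev (S.w n) (Y.inputs ω) c d ^ 2 ≤ 1 / 4) :
    ∃ e : Cols (S.p n) → ℝ,
      (∀ c, Y.debias ω θ c = coef S n c + Inputs.lead (Y.inputs ω) c + e c) ∧
      ∑ c, e c ^ 2 ≤ 64 * (∑ c, ∑ d, Inputs.gramDev (S.w n) (Y.inputs ω) c d ^ 2) *
        (4 * ∑ c, Inputs.lead (Y.inputs ω) c ^ 2 +
          4 * ∑ c, Inputs.rem (S.w n) (coef S n) (Y.inputs ω) c ^ 2 +
          2 * (S.w n ^ 2 / n) ^ 2 + 2 * S.p n * l ^ 2) +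
        2 * ∑ c, Inputs.rem (S.w n) (coef S n) (Y.inputs ω) c ^ 2 := by
  have hn' : (0 : ℝ) < n := by exact_mod_cast hn
  set z := Y.inputs ω with hz
  set A : Fin (S.r n) → Cols (S.p n) → ℝ := fun k c => Y.privX ω k c with hA
  set ek : Fin (S.r n) → ℝ := fun k =>
    ∑ i, Inputs.err (S.w n) (coef S n) z.2.1 i * z.2.2 k i with hek
  have hAeq : ∀ k c, A k c = ∑ i, Inputs.col (S.w n) (z.1 c) c i * z.2.2 k i :=
    fun k c => Y.privX_eq ω k c
  have hgram : ∀ c d, Inputs.gramDev (S.w n) z c d =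
      (1 + S.w n ^ 2 / n) * (if c = d then 1 else 0) - 1 / n * ∑ k, A k c * A k d := by
    intro c d
    simp only [Inputs.gramDev, sketchInner, hAeq]
  have hYk : ∀ k, Y.privY ω k = ∑ c, A k c * coef S n c + ek k := fun k => Y.privY_eq ω k
  have hg : ∀ c, 1 / n * ∑ k, A k c * ek k + S.w n ^ 2 / n * coef S n c =
      Inputs.lead z c + Inputs.rem (S.w n) (coef S n) z c := by
    intro c
    rw [← Inputs.sketch_err_eq]
    simp only [sketchInner, hAeq, hek]
  have hcoef : ∑ c, coef S n c ^ 2 = 1 := by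
    simp [coef, Fintype.sum_sum_type, hθ₀]
  have hlasso := lasso_error_le (A := A) (e := ek) (θ₀ := coef S n) (θ := θ) (v := S.w n ^ 2 / n)
    hn' hl (by positivity) (by simpa only [hgram] using hτ) (by
      have := hθ (coef S n)
      simpa only [lassoObj, Matrix.mulVec, dotProduct, hYk] using this)
  set τ := ∑ c, ∑ d, Inputs.gramDev (S.w n) z c d ^ 2 with hτdef
  set L := ∑ c, Inputs.lead z c ^ 2 with hL
  set M := ∑ c, Inputs.rem (S.w n) (coef S n) z c ^ 2 with hM
  set v := S.w n ^ 2 / n with hv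
  have hgsq : ∑ c, (1 / (n : ℝ) * ∑ k, A k c * ek k) ^ 2 ≤ 4 * L + 4 * M + 2 * v ^ 2 := by
    have : ∀ c, (1 / (n : ℝ) * ∑ k, A k c * ek k) ^ 2 ≤ 4 * Inputs.lead z c ^ 2 +
        4 * Inputs.rem (S.w n) (coef S n) z c ^ 2 + 2 * v ^ 2 * coef S n c ^ 2 := by
      intro c
      have h1 := hg c
      have h2 : 1 / (n : ℝ) * ∑ k, A k c * ek k =
          Inputs.lead z c + Inputs.rem (S.w n) (coef S n) z c - v * coef S n c := by linarith
      rw [h2]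
      nlinarith [sq_nonneg (Inputs.lead z c + Inputs.rem (S.w n) (coef S n) z c + v * coef S n c),
        sq_nonneg (Inputs.lead z c - Inputs.rem (S.w n) (coef S n) z c)]
    refine (Finset.sum_le_sum fun c _ => this c).trans ?_
    rw [Finset.sum_add_distrib, Finset.sum_add_distrib, ← Finset.mul_sum, ← Finset.mul_sum,
      ← Finset.mul_sum, hcoef]
    linarith
  refine ⟨fun c => ∑ d, Inputs.gramDev (S.w n) z c d * (θ d - coef S n d) +
    Inputs.rem (S.w n) (coef S n) z c, fun c => ?_, ?_⟩
  · have h1 := debias_error_eq (A := A) (e := ek) (θ₀ := coef S n) (θ := θ) (n := n) (v := v) c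
    have h2 : Y.debias ω θ c = θ c + 1 / n *
        ∑ k, A k c * ((∑ d, A k d * coef S n d + ek k) - ∑ d, A k d * θ d) + v * θ c := by
      simp only [debias, Pi.add_apply, Pi.smul_apply, smul_eq_mul, Matrix.mulVec, dotProduct,
        Matrix.transpose_apply, Pi.sub_apply, hYk]
      rfl
    rw [h2, h1, hg]
    simp only [hgram]
    ring
  · have h1 : ∑ c, (∑ d, Inputs.gramDev (S.w n) z c d * (θ d - coef S n d) +
        Inputs.rem (S.w n) (coef S n) z c) ^ 2 ≤
        2 * ∑ c, (∑ d, Inputs.gramDev (S.w n) z c d * (θ d - coef S n d)) ^ 2 + 2 * M := by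
      rw [hM, Finset.mul_sum, Finset.mul_sum, ← Finset.sum_add_distrib]
      exact Finset.sum_le_sum fun c _ => by
        nlinarith [sq_nonneg (∑ d, Inputs.gramDev (S.w n) z c d * (θ d - coef S n d) -
          Inputs.rem (S.w n) (coef S n) z c)]
    have h2 := sum_mulVec_sq_le (Inputs.gramDev (S.w n) z) fun d => θ d - coef S n d
    have hτ0 : 0 ≤ τ := Finset.sum_nonneg fun c _ => Finset.sum_nonneg fun d _ => sq_nonneg _
    have hcard : (Fintype.card (Cols (S.p n)) : ℝ) = 2 * S.p n := by
      simp; ring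
    rw [hcard] at hlasso
    have h3 : τ * ∑ d, (θ d - coef S n d) ^ 2 ≤
        τ * (32 * (4 * L + 4 * M + 2 * v ^ 2 + 2 * S.p n * l ^ 2)) := by
      gcongr
      linarith
    linarith

end Sample

/-! ### Expectation bounds for the random inputs -/

lemma map_gaussMatrix_inl {κ ι ι' : Type*} [Fintype κ] [Fintype ι] [Fintype ι'] (v : ℝ≥0) :
    (gaussMatrix κ (ι ⊕ ι') v).map (fun R k i => R k (Sum.inl i)) = gaussMatrix κ ι v := by
  have h1 : (Measure.pi fun _ : ι ⊕ ι' => gaussianReal 0 v).map (fun x i => x (Sum.inl i)) =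
      Measure.pi fun _ : ι => gaussianReal 0 v := by
    have h := (measurePreserving_sumPiEquivProdPi (X := fun _ : ι ⊕ ι' => ℝ)
      (fun _ => gaussianReal 0 v)).map_eq
    have h2 := (measurePreserving_fst (μ := Measure.pi fun _ : ι => gaussianReal 0 v)
      (ν := Measure.pi fun _ : ι' => gaussianReal 0 v)).map_eq
    rw [← h, Measure.map_map (by fun_prop) (by fun_prop)] at h2
    exact h2
  rw [gaussMatrix, gaussMatrix, ← h1]
  exact (Measure.pi_map_pi (μ := fun _ : κ => Measure.pi fun _ : ι ⊕ ι' => gaussianReal 0 v)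
    (f := fun _ (x : ι ⊕ ι' → ℝ) (i : ι) => x (Sum.inl i))
    (fun _ => Measurable.aemeasurable (by fun_prop)))

lemma expLE_sketchInner {ι : Type*} [Fintype ι] {r : ℕ} (hr : 0 < r) (a b : ι → ℝ) :
    ExpLE (gaussMatrix (Fin r) ι (r : ℝ≥0)⁻¹)
      (fun R => (sketchInner R a b - ∑ i, a i * b i) ^ 2)
      (gaussFourth / r * (∑ i, a i ^ 2) * ∑ i, b i ^ 2) := by
  have hr' : (r : ℝ) ≠ 0 := by positivity
  have h := sketch_expLE (κ := Fin r) (r : ℝ≥0)⁻¹ a b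
  simp only [Fintype.card_fin, NNReal.coe_inv, NNReal.coe_natCast] at h
  refine (h.mono (ae_of_all _ fun R => le_of_eq ?_)).mono_right (le_of_eq ?_)
  · rw [mul_inv_cancel_left₀ hr']
    rfl
  · field_simp

lemma card_cols (p : ℕ) : (Fintype.card (Cols p) : ℝ) = 2 * p := by
  simp; ring

namespace Inputs

variable {n p r : ℕ}

lemma measurable_pad (i : Fin n ⊕ AugCols p) : Measurable fun x : Fin n → ℝ => pad p x i := by
  rcases i with i | i
  · exact measurable_pi_apply i
  · exact measurable_const

lemma measurable_col (w : ℝ) (c : Cols p) (i : Fin n ⊕ AugCols p) :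
    Measurable fun x : Fin n → ℝ => col w x c i := (measurable_pad i).add_const _

lemma measurable_sketchInner {α : Type*} [MeasurableSpace α] {κ ι : Type*} [Fintype κ]
    [Fintype ι] {R : α → κ → ι → ℝ} {a b : α → ι → ℝ} (hR : Measurable R)
    (ha : ∀ i, Measurable fun x => a x i) (hb : ∀ i, Measurable fun x => b x i) :
    Measurable fun x => sketchInner (R x) (a x) (b x) := by
  have hR' : ∀ k i, Measurable fun x => R x k i := fun k i => by fun_prop
  unfold sketchInner
  exact Finset.measurable_fun_sum _ fun k _ =>
    (Finset.measurable_fun_sum _ fun i _ => (ha i).mul (hR' k i)).mul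
      (Finset.measurable_fun_sum _ fun i _ => (hb i).mul (hR' k i))

lemma measurable_gramDev (w : ℝ) (c d : Cols p) :
    Measurable fun z : Inputs n p r => gramDev w z c d := by
  unfold gramDev
  refine measurable_const.sub (measurable_const.mul ?_)
  exact measurable_sketchInner (by fun_prop)
    (fun i => (measurable_col w c i).comp (by fun_prop))
    (fun i => (measurable_col w d i).comp (by fun_prop))

lemma measurable_rem (w : ℝ) (θ : Cols p → ℝ) (c : Cols p) :
    Measurable fun z : Inputs n p r => rem w θ z c := by
  unfold rem
  refine measurable_const.mul (.add ?_ (.add ?_ measurable_const))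
  · exact measurable_sketchInner (by fun_prop) (fun i => measurable_const)
      (fun i => (measurable_pad i).comp (by fun_prop))
  · exact measurable_sketchInner (by fun_prop)
      (fun i => (measurable_col w c i).comp (by fun_prop)) (fun i => measurable_const)

lemma measurable_lead (c : Cols p) :
    Measurable fun z : Inputs n p r => lead z c := by
  unfold lead gramVec
  fun_prop

lemma sum_pad_sq (x : Fin n → ℝ) : ∑ i, pad p x i ^ 2 = ∑ i, x i ^ 2 := by
  simp [pad, Fintype.sum_sum_type]

lemma sum_unit_sq (c : Cols p) : ∑ i, unit n c i ^ 2 = 1 := by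
  rcases c with c | c <;> simp [unit, Fintype.sum_sum_type]

lemma sum_unit_mul_pad (c : Cols p) (x : Fin n → ℝ) : ∑ i, unit n c i * pad p x i = 0 := by
  simp [unit, pad, Fintype.sum_sum_type]

lemma sum_dir_sq (θ : Cols p → ℝ) : ∑ i, dir n θ i ^ 2 = ∑ c, θ c ^ 2 + 1 := by
  simp [dir, Fintype.sum_sum_type]

lemma sum_col_mul_col (w : ℝ) (x y : Fin n → ℝ) (c d : Cols p) :
    ∑ i, col w x c i * col w y d i = ∑ i, x i * y i + w ^ 2 * (if c = d then 1 else 0) := by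
  rcases c with c | c <;> rcases d with d | d <;>
    simp [col, pad, unit, Fintype.sum_sum_type, eq_comm, sq]

lemma sum_col_sq (w : ℝ) (x : Fin n → ℝ) (c : Cols p) :
    ∑ i, col w x c i ^ 2 = ∑ i, x i ^ 2 + w ^ 2 := by
  simpa [sq] using sum_col_mul_col w x x c c

lemma sum_col_mul_dir (w : ℝ) (x : Fin n → ℝ) (c : Cols p) (θ : Cols p → ℝ) :
    ∑ i, col w x c i * dir n θ i = -(w * θ c) := by
  rcases c with c | c <;> simp [col, pad, unit, dir, Fintype.sum_sum_type]

end Inputs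

/-- The joint law of the noise and the projection. -/
noncomputable abbrev auxLaw (S : Params) (n : ℕ) :
    Measure ((Fin n → ℝ) × (Fin (S.r n) → Fin n ⊕ AugCols (S.p n) → ℝ)) :=
  (Measure.pi fun _ => S.noiseLaw n).prod
    (gaussMatrix (Fin (S.r n)) (Fin n ⊕ AugCols (S.p n)) (S.r n : ℝ≥0)⁻¹)

/-- The joint law of the random inputs. -/
noncomputable def inputLaw (S : Params) (n : ℕ) : Measure (Inputs n (S.p n) (S.r n)) :=
  (Measure.pi fun _ => Measure.pi fun _ => S.D).prod (auxLaw S n)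

section Bounds

variable {S : Params} {n : ℕ}

lemma ae_design_bound (hS : S.Standing) :
    ∀ᵐ X ∂(Measure.pi fun _ : Cols (S.p n) => Measure.pi fun _ : Fin n => S.D),
      ∀ c, ∑ i, X c i ^ 2 ≤ n * S.b ^ 2 := by
  have := hS.D_prob
  rw [ae_all_iff]
  intro c
  have h1 : ∀ᵐ X ∂(Measure.pi fun _ : Cols (S.p n) => Measure.pi fun _ : Fin n => S.D),
      ∀ i, |X c i| ≤ S.b := by
    rw [ae_all_iff]
    intro i
    have hq := ((measurePreserving_eval (fun _ : Fin n => S.D) i).comp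
      (measurePreserving_eval (fun _ : Cols (S.p n) => Measure.pi fun _ : Fin n => S.D) c))
    exact hq.quasiMeasurePreserving.ae hS.D_supp
  filter_upwards [h1] with X hX
  calc ∑ i, X c i ^ 2 ≤ ∑ _i : Fin n, S.b ^ 2 := Finset.sum_le_sum fun i _ => by
        rw [← sq_abs]; exact pow_le_pow_left₀ (abs_nonneg _) (hX i) 2
    _ = _ := by simp

/-- Two sources of deviation: the projection given the design, of variance of order 1/r since column
norms are bounded, and the empirical correlations of the design, of variance of order 1/n. Summing
over (2p)² entries gives p²(1/n + 1/r). -/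
lemma expLE_gramDev (hS : S.Standing) (hn : 0 < n) (hr : 0 < S.r n) :
    ExpLE (inputLaw S n) (fun z => ∑ c, ∑ d, Inputs.gramDev (S.w n) z c d ^ 2)
      (4 * S.p n ^ 2 * (2 * (gaussFourth / S.r n * (S.b ^ 2 + S.w n ^ 2 / n) ^ 2) +
        2 * (S.b ^ 4 / n))) := by
  have hD := hS.D_prob
  have hN := hS.noise_prob n
  have hn' : (0 : ℝ) < n := by exact_mod_cast hn
  have hK := gaussFourth_nonneg
  set a := 2 * (gaussFourth / S.r n * (S.b ^ 2 + S.w n ^ 2 / n) ^ 2) with ha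
  have ha0 : 0 ≤ a := by positivity
  have h2 := integral_sq_eq_one hS.D_mean hS.D_var
  have key : ∀ c d, ExpLE (inputLaw S n) (fun z => Inputs.gramDev (S.w n) z c d ^ 2)
      (a + 2 * (S.b ^ 4 / n)) := by
    intro c d
    refine ExpLE.prod_left (g := fun X => a + 2 / n ^ 2 *
      (∑ i, X c i * X d i - n * (if c = d then 1 else 0)) ^ 2)
      ((Inputs.measurable_gramDev _ c d).pow_const 2) ?_ ?_
    · filter_upwards [ae_design_bound hS] with X hX
      refine ExpLE.prod_left (g := fun _ => a + 2 / n ^ 2 *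
        (∑ i, X c i * X d i - n * (if c = d then 1 else 0)) ^ 2)
        (((Inputs.measurable_gramDev _ c d).comp measurable_prodMk_left).pow_const 2)
        (ae_of_all _ fun ξ => ?_) (.const _)
      have hsk := (expLE_sketchInner hr (Inputs.col (S.w n) (X c) c)
        (Inputs.col (S.w n) (X d) d)).const_mul (c := 2 / n ^ 2) (by positivity)
      have hm : Measurable fun R : Fin (S.r n) → Fin n ⊕ AugCols (S.p n) → ℝ =>
          2 / (n : ℝ) ^ 2 * (sketchInner R (Inputs.col (S.w n) (X c) c)
            (Inputs.col (S.w n) (X d) d) - ∑ i, Inputs.col (S.w n) (X c) c i *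
              Inputs.col (S.w n) (X d) d i) ^ 2 := by
        unfold sketchInner; fun_prop
      refine ((hsk.mono_right (b := a) ?_).add (.const (2 / n ^ 2 *
        (∑ i, X c i * X d i - n * (if c = d then 1 else 0)) ^ 2)) hm ha0 (by positivity)).mono
        (ae_of_all _ fun R => ?_)
      · rw [Inputs.sum_col_sq, Inputs.sum_col_sq]
        have e1 := hX c
        have e2 := hX d
        calc 2 / (n : ℝ) ^ 2 * (gaussFourth / S.r n * (∑ i, X c i ^ 2 + S.w n ^ 2) *
              (∑ i, X d i ^ 2 + S.w n ^ 2))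
            ≤ 2 / (n : ℝ) ^ 2 * (gaussFourth / S.r n * (n * S.b ^ 2 + S.w n ^ 2) *
              (n * S.b ^ 2 + S.w n ^ 2)) := by gcongr
          _ = a := by rw [ha]; field_simp
      · rw [Inputs.sum_col_mul_col]
        set s := sketchInner R (Inputs.col (S.w n) (X c) c) (Inputs.col (S.w n) (X d) d) with hs
        set q := ∑ i, X c i * X d i
        have e : Inputs.gramDev (S.w n) (X, ξ, R) c d =
            -(1 / n * (s - (q + S.w n ^ 2 * (if c = d then 1 else 0))) +
              1 / n * (q - n * (if c = d then 1 else 0))) := by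
          have : Inputs.gramDev (S.w n) (X, ξ, R) c d =
            (1 + S.w n ^ 2 / n) * (if c = d then 1 else 0) - 1 / n * s := rfl
          rw [this]; field_simp; ring
        rw [e]
        set x := s - (q + S.w n ^ 2 * (if c = d then 1 else 0))
        set y := q - n * (if c = d then 1 else 0)
        have : 2 / (n : ℝ) ^ 2 * x ^ 2 + 2 / n ^ 2 * y ^ 2 =
            2 * (1 / n * x) ^ 2 + 2 * (1 / n * y) ^ 2 := by field_simp
        rw [this]
        nlinarith [sq_nonneg (1 / n * x - 1 / n * y)]
    · have := (expLE_design_gram hS.D_supp hS.D_mean h2 c d (n := n)).const_mul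
        (c := 2 / n ^ 2) (by positivity)
      refine ((ExpLE.const a).add this measurable_const ha0 (by positivity)).mono_right ?_
      have : 2 / (n : ℝ) ^ 2 * (n * S.b ^ 4) = 2 * (S.b ^ 4 / n) := by field_simp
      rw [this]
  have hsum := ExpLE.sum Finset.univ
    (fun c _ => ExpLE.sum Finset.univ (fun d _ => key c d)
      (fun d => (Inputs.measurable_gramDev (S.w n) c d).pow_const 2) (fun _ => by positivity))
    (fun c => Finset.measurable_fun_sum _ fun d _ =>
      (Inputs.measurable_gramDev (S.w n) c d).pow_const 2)
    (fun _ => Finset.sum_nonneg fun _ _ => by positivity)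
  refine hsum.mono_right (le_of_eq ?_)
  simp only [Finset.sum_const, Finset.card_univ, nsmul_eq_mul, card_cols]
  ring

/-- A crude consequence of `expLE_gramVec_norm`, bounding 1/√r by 1. -/
lemma expLE_gram_sum_sq (hr : 0 < S.r n) (ξ : Fin n → ℝ) :
    ExpLE (gaussMatrix (Fin (S.r n)) (Fin n ⊕ AugCols (S.p n)) (S.r n : ℝ≥0)⁻¹)
      (fun R => ∑ i, gramVec ξ (fun k i => R k (Sum.inl i)) i ^ 2)
      ((∑ i, ξ i ^ 2) * ((1 + n / S.r n) * (1 + gramConst))) := by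
  have : Nonempty (Fin (S.r n)) := ⟨⟨0, hr⟩⟩
  have hr' : (1 : ℝ) ≤ S.r n := by exact_mod_cast hr
  have hg := gramConst_nonneg
  have h := expLE_gramVec_norm (κ := Fin (S.r n)) ξ
  have hm : ∀ i, Measurable fun R : Fin (S.r n) → Fin n → ℝ => gramVec ξ R i := fun i => by
    unfold gramVec; fun_prop
  simp only [Fintype.card_fin] at h
  rw [ExpLE.of_map (by fun_prop) (map_gaussMatrix_inl (ι' := AugCols (S.p n)) _)
    (by fun_prop)] at h
  have hs0 : 0 ≤ ∑ i, ξ i ^ 2 := Finset.sum_nonneg fun i _ => sq_nonneg _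
  have hm' : ∀ i, Measurable fun R : Fin (S.r n) → Fin n ⊕ AugCols (S.p n) → ℝ =>
      gramVec ξ (fun k i => R k (Sum.inl i)) i := fun i => by unfold gramVec; fun_prop
  refine ((h.add (.const ((∑ i, ξ i ^ 2) * (1 + n / S.r n))) (by fun_prop) (by positivity)
    (by positivity)).mono (ae_of_all _ fun R => ?_)).mono_right ?_
  · have := le_abs_self (∑ i, gramVec ξ (fun k i => R k (Sum.inl i)) i ^ 2 -
      (∑ i, ξ i ^ 2) * (1 + n / S.r n))
    linarith
  · have h1 : gramConst * (1 + n / S.r n) / √(S.r n) ≤ gramConst * (1 + n / S.r n) :=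
      div_le_self (by positivity) (Real.one_le_sqrt.2 hr')
    have h2 := mul_le_mul_of_nonneg_left h1 hs0
    linarith

/-- Averaging the design first, with noise and projection fixed: its entries are centred with unit
variance, so each column contributes ‖RᵀRξ‖²/n². -/
lemma expLE_lead (hS : S.Standing) (hn : 0 < n) (hr : 0 < S.r n) :
    ExpLE (inputLaw S n) (fun z => ∑ c, Inputs.lead z c ^ 2)
      (2 * S.p n * ((1 / n + 1 / S.r n) * (S.noiseSq n * (1 + gramConst)))) := by
  have hD := hS.D_prob
  have hN := hS.noise_prob n
  have hn' : (0 : ℝ) < n := by exact_mod_cast hn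
  have hr' : (0 : ℝ) < S.r n := by exact_mod_cast hr
  have hg := gramConst_nonneg
  have hm2 := S.noiseSq_nonneg n
  have h2 := integral_sq_eq_one hS.D_mean hS.D_var
  have key : ∀ c, ExpLE (inputLaw S n) (fun z => Inputs.lead z c ^ 2)
      ((1 / n + 1 / S.r n) * (S.noiseSq n * (1 + gramConst))) := by
    intro c
    refine ExpLE.prod_right (g := fun y => 1 / (n : ℝ) ^ 2 *
      ∑ i, gramVec y.1 (fun k i => y.2 k (Sum.inl i)) i ^ 2)
      ((Inputs.measurable_lead c).pow_const 2) (ae_of_all _ fun y => ?_) ?_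
    · have h := (expLE_design_linear hS.D_supp hS.D_mean h2
        (gramVec y.1 (fun k i => y.2 k (Sum.inl i)))).const_mul (c := 1 / (n : ℝ) ^ 2)
        (by positivity)
      rw [ExpLE.of_map (measurable_pi_apply c) (measurePreserving_eval
        (fun _ : Cols (S.p n) => Measure.pi fun _ : Fin n => S.D) c).map_eq (by fun_prop)] at h
      refine h.mono (ae_of_all _ fun X => le_of_eq ?_)
      simp only [Inputs.lead]
      ring
    · have h1 := ((hS.expLE_noise_sq n).const_mul (c := (1 + n / S.r n) * (1 + gramConst))
        (by positivity))
      have hm : Measurable fun y : (Fin n → ℝ) × (Fin (S.r n) → Fin n ⊕ AugCols (S.p n) → ℝ) =>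
          ∑ i, gramVec y.1 (fun k i => y.2 k (Sum.inl i)) i ^ 2 := by
        unfold gramVec; fun_prop
      have h3 := (ExpLE.prod_left (μ := Measure.pi fun _ : Fin n => S.noiseLaw n)
        hm (ae_of_all _ fun ξ => expLE_gram_sum_sq hr ξ) (h1.mono (ae_of_all _ fun ξ =>
          le_of_eq (mul_comm _ _)))).const_mul (c := 1 / (n : ℝ) ^ 2) (by positivity)
      refine h3.mono_right (le_of_eq ?_)
      field_simp
  have hsum := ExpLE.sum Finset.univ (fun c _ => key c)
    (fun c => (Inputs.measurable_lead c).pow_const 2) (fun _ => by positivity)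
  refine hsum.mono_right (le_of_eq ?_)
  simp only [Finset.sum_const, Finset.card_univ, nsmul_eq_mul, card_cols]

/-- Given design and noise, both sketched inner products are taken relative to their means over the
projection, so each has variance of order 1/r; the prefactor (w/n)² adds a factor v. -/
lemma expLE_rem (hS : S.Standing) (hn : 0 < n) (hr : 0 < S.r n) :
    ExpLE (inputLaw S n)
      (fun z => ∑ c, Inputs.rem (S.w n) (Sample.coef S n) z c ^ 2)
      (2 * S.p n * (2 * (S.w n ^ 2 / n) * (gaussFourth / S.r n) *
        (S.noiseSq n + 2 * (S.b ^ 2 + S.w n ^ 2 / n)))) := by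
  have hD := hS.D_prob
  have hN := hS.noise_prob n
  have hn' : (0 : ℝ) < n := by exact_mod_cast hn
  have hr' : (0 : ℝ) < S.r n := by exact_mod_cast hr
  have hK := gaussFourth_nonneg
  have hm2 := S.noiseSq_nonneg n
  have hcoef : ∑ c, Sample.coef S n c ^ 2 = 1 := by
    simp [Sample.coef, Fintype.sum_sum_type, hS.θ₀_norm]
  set q := gaussFourth / S.r n with hq
  have hq0 : 0 ≤ q := by positivity
  have key : ∀ c, ExpLE (inputLaw S n)
      (fun z => Inputs.rem (S.w n) (Sample.coef S n) z c ^ 2)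
      (2 * (S.w n ^ 2 / n) * q * (S.noiseSq n + 2 * (S.b ^ 2 + S.w n ^ 2 / n))) := by
    intro c
    refine ExpLE.prod_left (g := fun _ => 2 * (S.w n ^ 2 / n) * q *
      (S.noiseSq n + 2 * (S.b ^ 2 + S.w n ^ 2 / n)))
      ((Inputs.measurable_rem _ _ c).pow_const 2) ?_ (.const _)
    filter_upwards [ae_design_bound hS] with X hX
    set k := 2 * (S.w n / n) ^ 2 with hk
    have hk0 : 0 ≤ k := by positivity
    refine ExpLE.prod_left (g := fun ξ => k * (q * ∑ i, ξ i ^ 2) +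
        k * (q * (n * S.b ^ 2 + S.w n ^ 2) * 2))
      (((Inputs.measurable_rem _ _ c).comp measurable_prodMk_left).pow_const 2)
      (ae_of_all _ fun ξ => ?_) ?_
    · have h1 := (expLE_sketchInner hr (Inputs.unit n c) (Inputs.pad (S.p n) ξ)).const_mul hk0
      have h2 := (expLE_sketchInner hr (Inputs.col (S.w n) (X c) c)
        (Inputs.dir n (Sample.coef S n))).const_mul hk0
      rw [Inputs.sum_unit_sq, Inputs.sum_pad_sq, mul_one, Inputs.sum_unit_mul_pad] at h1
      rw [Inputs.sum_col_sq, Inputs.sum_dir_sq, hcoef, Inputs.sum_col_mul_dir] at h2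
      have hs0 : 0 ≤ ∑ i, ξ i ^ 2 := Finset.sum_nonneg fun i _ => sq_nonneg _
      have h2' := h2.mono_right (b := k * (q * (n * S.b ^ 2 + S.w n ^ 2) * 2)) (by
        have := hX c
        norm_num
        gcongr)
      refine (h1.add h2' (by unfold sketchInner; fun_prop) (by positivity) (by positivity)).mono
        (ae_of_all _ fun R => ?_)
      set x := sketchInner R (Inputs.unit n c) (Inputs.pad (S.p n) ξ)
      set y := sketchInner R (Inputs.col (S.w n) (X c) c) (Inputs.dir n (Sample.coef S n))
      have e : Inputs.rem (S.w n) (Sample.coef S n) (X, ξ, R) c =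
        S.w n / n * (x + (y + S.w n * Sample.coef S n c)) := rfl
      simp only [e, hk]
      have := mul_nonneg (sq_nonneg (S.w n / n))
        (sq_nonneg (x - (y + S.w n * Sample.coef S n c)))
      nlinarith
    · have h1 := ((hS.expLE_noise_sq n).const_mul hq0).const_mul hk0
      refine (h1.add (.const _) (by fun_prop) (by positivity) (by positivity)).mono_right
        (le_of_eq ?_)
      rw [hk]
      field_simp
  have hsum := ExpLE.sum Finset.univ (fun c _ => key c)
    (fun c => (Inputs.measurable_rem (n := n) (r := S.r n) (S.w n) (Sample.coef S n) c).pow_const 2)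
    (fun _ => by positivity)
  refine hsum.mono_right (le_of_eq ?_)
  simp only [Finset.sum_const, Finset.card_univ, nsmul_eq_mul, card_cols]

end Bounds

/-! ### Convergence in probability -/

section InProb

variable {Ω : ℕ → Type*} [∀ n, MeasurableSpace (Ω n)] {P : ∀ n, Measure (Ω n)}

lemma WithHighProb.mono {E F : ∀ n, Set (Ω n)} (hE : WithHighProb P E)
    (h : ∀ᶠ n in atTop, E n ⊆ F n) : WithHighProb P F :=
  tendsto_of_tendsto_of_tendsto_of_le_of_le' tendsto_const_nhds hE
    (Eventually.of_forall fun _ => zero_le)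
    (h.mono fun _ hn => measure_mono (compl_subset_compl.2 hn))

lemma WithHighProb.inter {E F : ∀ n, Set (Ω n)} (hE : WithHighProb P E)
    (hF : WithHighProb P F) : WithHighProb P fun n => E n ∩ F n := by
  have h : Tendsto (fun n => P n (E n)ᶜ + P n (F n)ᶜ) atTop (𝓝 0) := by
    have := hE.add hF
    rwa [add_zero] at this
  refine tendsto_of_tendsto_of_tendsto_of_le_of_le tendsto_const_nhds h (fun _ => zero_le)
    fun n => ?_
  simp only [compl_inter]
  exact measure_union_le _ _

/-- The nonnegative variables `f n` tend to zero in probability. -/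
def SmallP (P : ∀ n, Measure (Ω n)) (f : ∀ n, Ω n → ℝ) : Prop :=
  ∀ ε > 0, WithHighProb P fun n => {x | f n x < ε}

namespace SmallP

variable {f g : ∀ n, Ω n → ℝ}

lemma mono (hf : SmallP P f) (h : ∀ᶠ n in atTop, ∀ x, g n x ≤ f n x) : SmallP P g := by
  intro ε hε
  exact (hf ε hε).mono (h.mono fun n hn x hx => (hn x).trans_lt hx)

lemma add (hf : SmallP P f) (hg : SmallP P g) : SmallP P fun n x => f n x + g n x := by
  intro ε hε
  refine ((hf _ (half_pos hε)).inter (hg _ (half_pos hε))).mono (Eventually.of_forall ?_)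
  rintro n x ⟨h1, h2⟩
  have h1' : f n x < ε / 2 := h1
  have h2' : g n x < ε / 2 := h2
  exact (show f n x + g n x < ε by linarith)

lemma const_mul (hf : SmallP P f) {c : ℝ} (hc : 0 < c) : SmallP P fun n x => c * f n x := by
  intro ε hε
  refine (hf (ε / c) (by positivity)).mono (Eventually.of_forall fun n x hx => ?_)
  have hx' : f n x < ε / c := hx
  rw [lt_div_iff₀ hc] at hx'
  exact (show c * f n x < ε by linarith)

lemma of_expLE {a : ℕ → ℝ} (hm : ∀ n, Measurable (f n))
    (h : ∀ᶠ n in atTop, ExpLE (P n) (f n) (a n)) (ha : Tendsto a atTop (𝓝 0)) : SmallP P f := by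
  intro ε hε
  have h0 : Tendsto (fun n => ENNReal.ofReal (a n / ε)) atTop (𝓝 0) := by
    have := (ENNReal.continuous_ofReal.tendsto _).comp (ha.div_const ε)
    simpa [Function.comp_def] using this
  refine tendsto_of_tendsto_of_tendsto_of_le_of_le' tendsto_const_nhds h0
    (Eventually.of_forall fun _ => zero_le) ?_
  filter_upwards [h] with n hn
  have := hn.meas_ge_le (hm n) hε
  have e : {x | f n x < ε}ᶜ = {x | ε ≤ f n x} := by
    ext x
    exact not_lt (a := f n x) (b := ε)
  rwa [e]

/-- A Slutsky argument: a factor with bounded expectation is tight. -/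
lemma mul_of_expLE {K : ℝ} (hf : SmallP P f) (hf0 : ∀ n x, 0 ≤ f n x)
    (hgm : ∀ n, Measurable (g n)) (hg : ∀ᶠ n in atTop, ExpLE (P n) (g n) K) :
    SmallP P fun n x => f n x * g n x := by
  intro ε hε
  rw [WithHighProb, ENNReal.tendsto_nhds_zero]
  intro δ hδ
  obtain ⟨δ', hδ'0, hδ'⟩ : ∃ δ' : ℝ, 0 < δ' ∧ ENNReal.ofReal δ' ≤ δ := by
    by_cases htop : δ = ⊤
    · exact ⟨1, one_pos, by simp [htop]⟩
    · exact ⟨δ.toReal, ENNReal.toReal_pos hδ.ne' htop, by rw [ENNReal.ofReal_toReal htop]⟩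
  -- By Markov the event g ≥ M has probability at most K/M ≤ δ'/2.
  set M := 2 * max K 1 / δ' with hM
  have hM0 : 0 < M := by positivity
  have h1 := ENNReal.tendsto_nhds_zero.1 (hf (ε / M) (by positivity)) (ENNReal.ofReal (δ' / 2))
    (by simpa using hδ'0)
  filter_upwards [h1, hg] with n h1 h2
  have h3 := h2.meas_ge_le (hgm n) hM0
  have hsub : {x | f n x * g n x < ε}ᶜ ⊆ {x | f n x < ε / M}ᶜ ∪ {x | M ≤ g n x} := by
    intro x hx
    by_contra hc
    rw [mem_union, not_or] at hc
    have a1 : f n x < ε / M := not_not.1 hc.1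
    have a2 : g n x < M := not_le.1 hc.2
    refine hx ?_
    rw [lt_div_iff₀ hM0] at a1
    refine (show f n x * g n x < ε from lt_of_le_of_lt ?_ a1)
    exact mul_le_mul_of_nonneg_left a2.le (hf0 n x)
  have h4 : K / M ≤ δ' / 2 := by
    rw [div_le_iff₀ hM0, hM]
    have : δ' / 2 * (2 * max K 1 / δ') = max K 1 := by field_simp
    rw [this]
    exact le_max_left _ _
  calc P n {x | f n x * g n x < ε}ᶜ ≤ _ := measure_mono hsub
    _ ≤ P n {x | f n x < ε / M}ᶜ + P n {x | M ≤ g n x} := measure_union_le _ _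
    _ ≤ ENNReal.ofReal (δ' / 2) + ENNReal.ofReal (δ' / 2) :=
        add_le_add h1 (h3.trans (ENNReal.ofReal_le_ofReal h4))
    _ = ENNReal.ofReal δ' := by
        rw [← ENNReal.ofReal_add (by positivity) (by positivity), add_halves]
    _ ≤ δ := hδ'

end SmallP

end InProb

/-! ### The debiasing error is negligible -/

/-- The squared Frobenius norm of the deviation of the sketched Gram matrix. -/
noncomputable def gramErr (S : Params) (n : ℕ) (z : Inputs n (S.p n) (S.r n)) : ℝ :=
  ∑ c, ∑ d, Inputs.gramDev (S.w n) z c d ^ 2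

/-- The bound for the squared norm of the negligible part of the debiased error. -/
noncomputable def debiasErr (S : Params) (n : ℕ) (z : Inputs n (S.p n) (S.r n)) : ℝ :=
  64 * gramErr S n z * (4 * ∑ c, Inputs.lead z c ^ 2 +
    4 * ∑ c, Inputs.rem (S.w n) (Sample.coef S n) z c ^ 2 +
    2 * (S.w n ^ 2 / n) ^ 2 + 2 * S.p n * S.lam 1 n ^ 2) +
  2 * ∑ c, Inputs.rem (S.w n) (Sample.coef S n) z c ^ 2

section Small

variable {S : Params} {c₀ : ℝ}

lemma measurable_gramErr (n : ℕ) : Measurable (gramErr S n) :=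
  Finset.measurable_fun_sum _ fun c _ => Finset.measurable_fun_sum _ fun d _ =>
    (Inputs.measurable_gramDev _ c d).pow_const 2

lemma gramErr_nonneg (n : ℕ) (z : Inputs n (S.p n) (S.r n)) : 0 ≤ gramErr S n z :=
  Finset.sum_nonneg fun _ _ => Finset.sum_nonneg fun _ _ => sq_nonneg _

/-- Everything the parameters satisfy for large `n`. -/
lemma eventually_params (hS : S.Standing) (hR : Params.Rates S) :
    ∀ᶠ n : ℕ in atTop, 0 < n ∧ 0 < S.r n ∧ 0 < S.p n ∧ S.w n ^ 2 / n ≤ 1 ∧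
      S.noiseSq n ≤ S.σ ^ 2 + 1 := by
  filter_upwards [eventually_gt_atTop 0, hS.r_tendsto.eventually_gt_atTop 0,
    hS.p_tendsto.eventually_gt_atTop 0, hR.v.eventually (ge_mem_nhds one_pos),
    hS.tendsto_noiseSq.eventually (ge_mem_nhds (lt_add_one _))] with n h1 h2 h3 h4 h5
  exact ⟨h1, h2, h3, h4, h5⟩

/-- A constant for the deviation of the sketched Gram matrix. -/
noncomputable def gramErrConst (S : Params) : ℝ :=
  4 * (2 * (gaussFourth * (S.b ^ 2 + 1) ^ 2) + 2 * S.b ^ 4)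

lemma eventually_expLE_gramErr (hS : S.Standing) (hR : Params.Rates S) :
    ∀ᶠ n : ℕ in atTop, ExpLE (inputLaw S n) (gramErr S n)
      (gramErrConst S * (S.p n ^ 2 * (1 / n + 1 / S.r n))) := by
  filter_upwards [eventually_params hS hR] with n ⟨hn, hr, hp, hv, hm⟩
  refine (expLE_gramDev hS hn hr).mono_right ?_
  have hK := gaussFourth_nonneg
  have hn' : (0 : ℝ) < n := by exact_mod_cast hn
  have hr' : (0 : ℝ) < S.r n := by exact_mod_cast hr
  set x := gaussFourth * (S.b ^ 2 + 1) ^ 2 with hx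
  have hx0 : 0 ≤ x := by positivity
  have h1 : gaussFourth / S.r n * (S.b ^ 2 + S.w n ^ 2 / n) ^ 2 ≤ x * (1 / S.r n) := by
    calc gaussFourth / S.r n * (S.b ^ 2 + S.w n ^ 2 / n) ^ 2
        ≤ gaussFourth / S.r n * (S.b ^ 2 + 1) ^ 2 := by gcongr
      _ = _ := by rw [hx]; ring
  have h2 : 0 ≤ 2 * x * (1 / n) + 2 * S.b ^ 4 * (1 / S.r n) := by positivity
  calc 4 * (S.p n : ℝ) ^ 2 * (2 * (gaussFourth / S.r n * (S.b ^ 2 + S.w n ^ 2 / n) ^ 2) +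
        2 * (S.b ^ 4 / n))
      ≤ 4 * (S.p n : ℝ) ^ 2 * ((2 * x + 2 * S.b ^ 4) * (1 / n + 1 / S.r n)) := by
        gcongr
        have : S.b ^ 4 / (n : ℝ) = S.b ^ 4 * (1 / n) := by ring
        rw [this]
        linarith
    _ = _ := by rw [gramErrConst]; ring

lemma tendsto_p_sq_rate (hR : Params.Rates S) :
    Tendsto (fun n : ℕ => (S.p n : ℝ) ^ 2 * (1 / n + 1 / S.r n)) atTop (𝓝 0) := by
  have := hR.pn.add hR.pr
  rw [add_zero] at this
  exact this.congr fun n => by ring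

lemma smallP_gramErr (hS : S.Standing) (hR : Params.Rates S) :
    SmallP (inputLaw S) (gramErr S) := by
  refine .of_expLE measurable_gramErr (eventually_expLE_gramErr hS hR) ?_
  simpa using (tendsto_p_sq_rate hR).const_mul (gramErrConst S)

/-- Everything is normalized by p s with s = 1/n + 1/r ≤ ρ². The leading term is then tight and
multiplied by a vanishing `gramErr`, and the remainder vanishes because v → 0. -/
lemma smallP_debiasErr (hS : S.Standing) (hR : Params.Rates S) :
    SmallP (inputLaw S) fun n z => debiasErr S n z / (S.p n * S.ρ n ^ 2) := by
  have hK := gaussFourth_nonneg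
  have hG := gramConst_nonneg
  set s : ℕ → ℝ := fun n => 1 / n + 1 / S.r n with hs
  set L : ∀ n, Inputs n (S.p n) (S.r n) → ℝ := fun n z =>
    1 / (S.p n * s n) * ∑ c, Inputs.lead z c ^ 2 with hL
  set M : ∀ n, Inputs n (S.p n) (S.r n) → ℝ := fun n z =>
    1 / (S.p n * s n) * ∑ c, Inputs.rem (S.w n) (Sample.coef S n) z c ^ 2 with hM
  have hs0 : ∀ n, 0 ≤ s n := fun n => by positivity
  have hLm : ∀ n, Measurable (L n) := fun n => measurable_const.mul
    (Finset.measurable_fun_sum _ fun c _ => (Inputs.measurable_lead c).pow_const 2)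
  have hMm : ∀ n, Measurable (M n) := fun n => measurable_const.mul
    (Finset.measurable_fun_sum _ fun c _ => (Inputs.measurable_rem _ _ c).pow_const 2)
  have hLE : ∀ᶠ n in atTop, ExpLE (inputLaw S n) (L n)
      (2 * ((S.σ ^ 2 + 1) * (1 + gramConst))) := by
    filter_upwards [eventually_params hS hR] with n ⟨hn, hr, hp, hv, hm⟩
    have hn' : (0 : ℝ) < n := by exact_mod_cast hn
    have hr' : (0 : ℝ) < S.r n := by exact_mod_cast hr
    have hp' : (0 : ℝ) < S.p n := by exact_mod_cast hp
    have hsn : 0 < s n := by simp only [hs]; positivity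
    refine ((expLE_lead hS hn hr).const_mul (c := 1 / (S.p n * s n)) (by positivity)).mono_right ?_
    have : 1 / (S.p n * s n) * (2 * S.p n * (s n * (S.noiseSq n * (1 + gramConst)))) =
        2 * (S.noiseSq n * (1 + gramConst)) := by field_simp
    simp only [hs] at this ⊢
    rw [this]
    gcongr
  have hME : ∀ᶠ n in atTop, ExpLE (inputLaw S n) (M n)
      (4 * gaussFourth * (S.σ ^ 2 + 1 + 2 * (S.b ^ 2 + 1)) * (S.w n ^ 2 / n)) := by
    filter_upwards [eventually_params hS hR] with n ⟨hn, hr, hp, hv, hm⟩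
    have hn' : (0 : ℝ) < n := by exact_mod_cast hn
    have hr' : (0 : ℝ) < S.r n := by exact_mod_cast hr
    have hp' : (0 : ℝ) < S.p n := by exact_mod_cast hp
    have hsn : 0 < s n := by simp only [hs]; positivity
    have hm2 := S.noiseSq_nonneg n
    refine ((expLE_rem hS hn hr).const_mul (c := 1 / (S.p n * s n)) (by positivity)).mono_right ?_
    have h1 : 1 / (S.r n : ℝ) / s n ≤ 1 := by
      rw [div_le_one hsn]
      have : (0 : ℝ) ≤ 1 / n := by positivity
      simp only [hs]; linarith
    calc 1 / (S.p n * s n) * (2 * S.p n * (2 * (S.w n ^ 2 / n) * (gaussFourth / S.r n) *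
          (S.noiseSq n + 2 * (S.b ^ 2 + S.w n ^ 2 / n))))
        = 4 * gaussFourth * (S.noiseSq n + 2 * (S.b ^ 2 + S.w n ^ 2 / n)) * (S.w n ^ 2 / n) *
          (1 / (S.r n : ℝ) / s n) := by field_simp; ring
      _ ≤ 4 * gaussFourth * (S.σ ^ 2 + 1 + 2 * (S.b ^ 2 + 1)) * (S.w n ^ 2 / n) * 1 := by
          gcongr
      _ = _ := by ring
  have hMs : SmallP (inputLaw S) M := by
    refine .of_expLE hMm hME ?_
    simpa using hR.v.const_mul (4 * gaussFourth * (S.σ ^ 2 + 1 + 2 * (S.b ^ 2 + 1)))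
  have hME' : ∀ᶠ n in atTop, ExpLE (inputLaw S n) (M n)
      (4 * gaussFourth * (S.σ ^ 2 + 1 + 2 * (S.b ^ 2 + 1))) := by
    filter_upwards [eventually_params hS hR, hME] with n ⟨hn, hr, hp, hv, hm⟩ h
    refine h.mono_right (mul_le_of_le_one_right (by positivity) hv)
  have hT := smallP_gramErr hS hR
  have h1 := hT.mul_of_expLE gramErr_nonneg hLm hLE
  have h2 := hT.mul_of_expLE gramErr_nonneg hMm hME'
  -- The deterministic terms v² and pλ² need not be small compared with p s. The rate p² s of
  -- `gramErr` cancels s and leaves p v² and (pλ)².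
  have h3 : SmallP (inputLaw S) fun n z =>
      (2 * (S.w n ^ 2 / n) ^ 2 + 2 * S.p n * S.lam 1 n ^ 2) / (S.p n * s n) * gramErr S n z := by
    refine .of_expLE (a := fun n => gramErrConst S * (2 * (S.p n * (S.w n ^ 2 / n) ^ 2) +
      2 * (S.p n * S.lam 1 n) ^ 2)) (fun n => measurable_const.mul (measurable_gramErr n)) ?_ ?_
    · filter_upwards [eventually_expLE_gramErr hS hR, eventually_params hS hR]
        with n h ⟨hn, hr, hp, hv, hm⟩
      have hn' : (0 : ℝ) < n := by exact_mod_cast hn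
      have hr' : (0 : ℝ) < S.r n := by exact_mod_cast hr
      have hp' : (0 : ℝ) < S.p n := by exact_mod_cast hp
      have hsn : 0 < s n := by simp only [hs]; positivity
      refine (h.const_mul (by positivity)).mono_right (le_of_eq ?_)
      change (2 * (S.w n ^ 2 / n) ^ 2 + 2 * S.p n * S.lam 1 n ^ 2) / (S.p n * s n) *
        (gramErrConst S * (S.p n ^ 2 * s n)) = _
      field_simp
    · simpa using ((hR.pv.const_mul 2).add ((hR.plam.pow 2).const_mul 2)).const_mul
        (gramErrConst S)
  have hfin := (((h1.const_mul (c := 256) (by norm_num)).add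
    (h2.const_mul (c := 256) (by norm_num))).add (h3.const_mul (c := 64) (by norm_num))).add
    (hMs.const_mul (c := 2) (by norm_num))
  refine hfin.mono ?_
  filter_upwards [eventually_params hS hR] with n ⟨hn, hr, hp, hv, hm⟩ z
  have hn' : (0 : ℝ) < n := by exact_mod_cast hn
  have hr' : (0 : ℝ) < S.r n := by exact_mod_cast hr
  have hp' : (0 : ℝ) < S.p n := by exact_mod_cast hp
  have hsn : 0 < s n := by simp only [hs]; positivity
  have hρ : s n ≤ S.ρ n ^ 2 := Params.ρ_sq_ge hn hr
  have hle0 : 0 ≤ ∑ c, Inputs.lead z c ^ 2 := Finset.sum_nonneg fun _ _ => sq_nonneg _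
  have hre0 : 0 ≤ ∑ c, Inputs.rem (S.w n) (Sample.coef S n) z c ^ 2 :=
    Finset.sum_nonneg fun _ _ => sq_nonneg _
  have hge0 := gramErr_nonneg n z
  have hd0 : 0 ≤ debiasErr S n z := by unfold debiasErr; positivity
  calc debiasErr S n z / (S.p n * S.ρ n ^ 2) ≤ debiasErr S n z / (S.p n * s n) := by gcongr
    _ = _ := by
      simp only [debiasErr, hL, hM]
      ring

end Small

/-! ### The weights of the leading term -/

/-- The normalized weights `Rᵀ R ξ / (n σ ρ)` of the leading term. -/
noncomputable def weights (S : Params) (n : ℕ)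
    (y : (Fin n → ℝ) × (Fin (S.r n) → Fin n ⊕ AugCols (S.p n) → ℝ)) (i : Fin n) : ℝ :=
  gramVec y.1 (fun k i => y.2 k (Sum.inl i)) i / (n * (S.σ * S.ρ n))

section Weights

variable {S : Params}

lemma measurable_weights (n : ℕ) (i : Fin n) : Measurable fun y => weights S n y i := by
  unfold weights gramVec; fun_prop

lemma lead_eq (n : ℕ) (hn : 0 < n) (z : Inputs n (S.p n) (S.r n)) (h : S.σ * S.ρ n ≠ 0)
    (c : Cols (S.p n)) :
    Inputs.lead z c = S.σ * S.ρ n * ∑ i, z.1 c i * weights S n z.2 i := by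
  have hn' : (n : ℝ) ≠ 0 := by positivity
  simp only [Inputs.lead, weights, Finset.mul_sum]
  obtain ⟨h1, h2⟩ := mul_ne_zero_iff.1 h
  refine Finset.sum_congr rfl fun i _ => ?_
  field_simp

/-- The main term n(1 + n/r), multiplied by σ², is the typical size of ‖RᵀRξ‖², so σρ is the right
normalization; the rest has relative size at most 1/r + v. -/
lemma n_sq_ρ_sq {n : ℕ} (hn : 0 < n) (hr : 0 < S.r n) :
    (n : ℝ) ^ 2 * S.ρ n ^ 2 =
      n * (1 + n / S.r n) + n * ((1 / S.r n) + (S.w n ^ 2 / n) * (n / S.r n)) := by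
  have hn' : (0 : ℝ) < n := by exact_mod_cast hn
  have hr' : (0 : ℝ) < S.r n := by exact_mod_cast hr
  rw [Params.ρ_sq]
  field_simp
  ring

/-- Four relative errors: 1/√r from the projection, 1/√n from the fluctuation of ‖ξ‖², the change of
variance by truncation, and 1/r + v from the lower-order part of ρ². -/
lemma smallP_weights_sq (hS : S.Standing) (hR : Params.Rates S) :
    SmallP (auxLaw S) fun n y => |∑ i, weights S n y i ^ 2 - 1| := by
  obtain ⟨K, hK0, hK⟩ := hS.exists_noiseFourth_le
  have hg := gramConst_nonneg
  have hσ := hS.σ_pos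
  have hrinv : Tendsto (fun n => 1 / (S.r n : ℝ)) atTop (𝓝 0) :=
    tendsto_one_div_atTop_nhds_zero_nat.comp hS.r_tendsto
  have hninv : Tendsto (fun n : ℕ => 1 / (n : ℝ)) atTop (𝓝 0) :=
    tendsto_one_div_atTop_nhds_zero_nat
  refine .of_expLE (a := fun n => (1 / S.σ ^ 2) * ((S.σ ^ 2 + 1) * gramConst * √(1 / S.r n) +
    (K + 1) / 2 * √(1 / n) + |S.noiseSq n - S.σ ^ 2| +
      S.σ ^ 2 * (1 / S.r n + S.w n ^ 2 / n)))
    (fun n => ((Finset.measurable_fun_sum _ fun i _ =>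
      (measurable_weights n i).pow_const 2).sub_const 1).abs) ?_ ?_
  · filter_upwards [eventually_params hS hR, hK] with n ⟨hn, hr, hp, hv, hm⟩ hK
    have hN := hS.noise_prob n
    have hn' : (0 : ℝ) < n := by exact_mod_cast hn
    have hr' : (0 : ℝ) < S.r n := by exact_mod_cast hr
    have hρ := Params.ρ_pos (S := S) hn hr
    have hm2 := S.noiseSq_nonneg n
    have : Nonempty (Fin (S.r n)) := ⟨⟨0, hr⟩⟩
    set q : ℝ := 1 + n / S.r n with hq
    have hq0 : 0 < q := by positivity
    set N2 : ℝ := n ^ 2 * (S.σ ^ 2 * S.ρ n ^ 2) with hN2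
    have hN2ge : S.σ ^ 2 * (n * q) ≤ N2 := by
      have h := n_sq_ρ_sq (S := S) hn hr
      have h' : (n : ℝ) * q ≤ n ^ 2 * S.ρ n ^ 2 := by
        rw [h]
        exact le_add_of_nonneg_right (by positivity)
      calc S.σ ^ 2 * (n * q) ≤ S.σ ^ 2 * (n ^ 2 * S.ρ n ^ 2) := by gcongr
        _ = N2 := by rw [hN2]; ring
    have hN20 : 0 < N2 := by positivity
    have hdiff : |n * q * S.σ ^ 2 - N2| ≤ n * q * (S.σ ^ 2 * (1 / S.r n + S.w n ^ 2 / n)) := by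
      have h := n_sq_ρ_sq (S := S) hn hr
      have e : n * q * S.σ ^ 2 - N2 =
          -(n * ((1 / S.r n) + (S.w n ^ 2 / n) * (n / S.r n)) * S.σ ^ 2) := by
        have : N2 = (n ^ 2 * S.ρ n ^ 2) * S.σ ^ 2 := by rw [hN2]; ring
        rw [this, h, hq]; ring
      rw [e, abs_neg, abs_of_nonneg (by positivity)]
      have h1 : (1 : ℝ) / S.r n + S.w n ^ 2 / n * (n / S.r n) ≤
          q * (1 / S.r n + S.w n ^ 2 / n) := by
        have a1 : (1 : ℝ) / S.r n ≤ q * (1 / S.r n) := le_mul_of_one_le_left (by positivity)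
          (le_add_of_nonneg_right (by positivity))
        have a2 : S.w n ^ 2 / n * (n / S.r n) ≤ S.w n ^ 2 / n * q := by
          gcongr
          rw [hq]; linarith
        linarith
      calc (n : ℝ) * (1 / S.r n + S.w n ^ 2 / n * (n / S.r n)) * S.σ ^ 2
          ≤ n * (q * (1 / S.r n + S.w n ^ 2 / n)) * S.σ ^ 2 := by gcongr
        _ = _ := by ring
    -- Collects the deterministic errors: truncation, and the gap between n q σ² and N2.
    set c := q * (n * |S.noiseSq n - S.σ ^ 2|) +
      n * q * (S.σ ^ 2 * (1 / S.r n + S.w n ^ 2 / n)) with hc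
    have hc0 : 0 ≤ c := by positivity
    have hsn : 0 < √(n : ℝ) := Real.sqrt_pos.2 hn'
    have hmeas : Measurable fun y : (Fin n → ℝ) × (Fin (S.r n) → Fin n ⊕ AugCols (S.p n) → ℝ) =>
        |∑ i, gramVec y.1 (fun k i => y.2 k (Sum.inl i)) i ^ 2 - N2| := by
      unfold gramVec; fun_prop
    have hξ : ExpLE (Measure.pi fun _ : Fin n => S.noiseLaw n) (fun ξ =>
        ((gramConst * q / √(S.r n)) * ∑ i, ξ i ^ 2 +
          (q * (1 / (2 * √n)) * (∑ i, ξ i ^ 2 - n * S.noiseSq n) ^ 2 + (q * (√n / 2) + c))))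
        ((gramConst * q / √(S.r n)) * (n * S.noiseSq n) +
          (q * (1 / (2 * √n)) * (n * S.noiseFourth n) + (q * (√n / 2) + c))) := by
      have hm4 := S.noiseFourth_nonneg n
      refine ((hS.expLE_noise_sq n).const_mul (by positivity)).add
        (((hS.expLE_noise_var n).const_mul (by positivity)).add (.const _) (by fun_prop)
          (by positivity) (by positivity)) (by fun_prop) (by positivity) (by positivity)
    have hmain : ExpLE (auxLaw S n)
        (fun y => |∑ i, gramVec y.1 (fun k i => y.2 k (Sum.inl i)) i ^ 2 - N2|)
        ((gramConst * q / √(S.r n)) * (n * S.noiseSq n) +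
          (q * (1 / (2 * √n)) * (n * S.noiseFourth n) + (q * (√n / 2) + c))) := by
      refine ExpLE.prod_left hmeas (ae_of_all _ fun ξ => ?_) hξ
      have h := expLE_gramVec_norm (κ := Fin (S.r n)) ξ
      have hmg : ∀ i, Measurable fun R : Fin (S.r n) → Fin n → ℝ => gramVec ξ R i := fun i => by
        unfold gramVec; fun_prop
      have hmg' : ∀ i, Measurable fun R : Fin (S.r n) → Fin n ⊕ AugCols (S.p n) → ℝ =>
          gramVec ξ (fun k i => R k (Sum.inl i)) i := fun i => by unfold gramVec; fun_prop
      simp only [Fintype.card_fin] at h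
      rw [ExpLE.of_map (by fun_prop) (map_gaussMatrix_inl (ι' := AugCols (S.p n)) _)
        (by fun_prop)] at h
      have hs0 : 0 ≤ ∑ i, ξ i ^ 2 := Finset.sum_nonneg fun i _ => sq_nonneg _
      set T := ∑ i, ξ i ^ 2 with hT
      refine ((h.add (.const (q * (1 / (2 * √n)) * (T - n * S.noiseSq n) ^ 2 +
        (q * (√n / 2) + c))) (by fun_prop) (by positivity) (by positivity)).mono
        (ae_of_all _ fun R => ?_)).mono_right (le_of_eq ?_)
      · set E := ∑ i, gramVec ξ (fun k i => R k (Sum.inl i)) i ^ 2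
        have b1 := abs_le_sq_div (x := T - n * S.noiseSq n) hsn
        have b2 : |T * q - N2| ≤ q * |T - n * S.noiseSq n| + c := by
          have e : T * q - N2 = q * (T - n * S.noiseSq n) +
              (q * (n * (S.noiseSq n - S.σ ^ 2)) + (n * q * S.σ ^ 2 - N2)) := by ring
          rw [e]
          refine (abs_add_le _ _).trans (add_le_add ?_ ((abs_add_le _ _).trans
            (add_le_add ?_ hdiff)))
          · rw [abs_mul, abs_of_pos hq0]
          · rw [abs_mul, abs_mul, abs_of_pos hq0, abs_of_pos hn']
        have b3 := mul_le_mul_of_nonneg_left b1 hq0.le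
        have b4 := abs_sub_le E (T * q) N2
        linarith
      · ring
    refine ((hmain.const_mul (c := 1 / N2) (by positivity)).mono (ae_of_all _ fun y =>
      le_of_eq ?_)).mono_right ?_
    · have e : ∑ i, weights S n y i ^ 2 =
          1 / N2 * ∑ i, gramVec y.1 (fun k i => y.2 k (Sum.inl i)) i ^ 2 := by
        rw [Finset.mul_sum]
        refine Finset.sum_congr rfl fun i _ => ?_
        rw [weights, hN2]
        ring
      rw [e]
      have e2 : ∀ x : ℝ, 1 / N2 * x - 1 = 1 / N2 * (x - N2) := fun x => by field_simp
      rw [e2, abs_mul, abs_of_pos (by positivity)]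
    · have hnn : (n : ℝ) = √n * √n := (Real.mul_self_sqrt hn'.le).symm
      have e : (gramConst * q / √(S.r n)) * (n * S.noiseSq n) +
          (q * (1 / (2 * √n)) * (n * S.noiseFourth n) + (q * (√n / 2) + c)) =
          n * q * (S.noiseSq n * gramConst * √(1 / S.r n) +
            (S.noiseFourth n + 1) / 2 * √(1 / n) + |S.noiseSq n - S.σ ^ 2| +
            S.σ ^ 2 * (1 / S.r n + S.w n ^ 2 / n)) := by
        rw [hc, Real.sqrt_div one_pos.le, Real.sqrt_div one_pos.le, Real.sqrt_one]
        have h1 : √(n : ℝ) / 2 = n * (1 / 2 * (1 / √n)) := by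
          rw [eq_comm, mul_comm]
          field_simp
          rw [Real.sq_sqrt hn'.le]
        rw [h1]
        ring
      rw [e]
      have hb : S.noiseSq n * gramConst * √(1 / S.r n) +
            (S.noiseFourth n + 1) / 2 * √(1 / n) + |S.noiseSq n - S.σ ^ 2| +
            S.σ ^ 2 * (1 / S.r n + S.w n ^ 2 / n) ≤
          (S.σ ^ 2 + 1) * gramConst * √(1 / S.r n) +
            (K + 1) / 2 * √(1 / n) + |S.noiseSq n - S.σ ^ 2| +
            S.σ ^ 2 * (1 / S.r n + S.w n ^ 2 / n) := by gcongr
      have hm4 := S.noiseFourth_nonneg n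
      calc _ ≤ 1 / (S.σ ^ 2 * (n * q)) * (n * q * ((S.σ ^ 2 + 1) * gramConst * √(1 / S.r n) +
            (K + 1) / 2 * √(1 / n) + |S.noiseSq n - S.σ ^ 2| +
            S.σ ^ 2 * (1 / S.r n + S.w n ^ 2 / n))) := by gcongr
        _ = _ := by field_simp
  · have t1 : Tendsto (fun n => √(1 / (S.r n : ℝ))) atTop (𝓝 0) := by
      simpa using hrinv.sqrt
    have t2 : Tendsto (fun n : ℕ => √(1 / (n : ℝ))) atTop (𝓝 0) := by
      simpa using hninv.sqrt
    have t3 : Tendsto (fun n => |S.noiseSq n - S.σ ^ 2|) atTop (𝓝 0) := by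
      have := (hS.tendsto_noiseSq.sub_const (S.σ ^ 2)).abs
      rwa [sub_self, abs_zero] at this
    have := ((((t1.const_mul ((S.σ ^ 2 + 1) * gramConst)).add (t2.const_mul ((K + 1) / 2))).add
      t3).add ((hrinv.add hR.v).const_mul (S.σ ^ 2))).const_mul (1 / S.σ ^ 2)
    simpa using this

/-- The fourth powers of RᵀRξ sum to order n(1 + (n/r)²), against a squared normalization of order
n²(1 + n/r)²; the ratio is of order 1/n. -/
lemma smallP_weights_fourth (hS : S.Standing) (hR : Params.Rates S) :
    SmallP (auxLaw S) fun n y => ∑ i, weights S n y i ^ 4 := by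
  obtain ⟨K, hK0, hK⟩ := hS.exists_noiseFourth_le
  have hg := gramConst'_nonneg
  have hσ := hS.σ_pos
  have hninv : Tendsto (fun n : ℕ => 1 / (n : ℝ)) atTop (𝓝 0) :=
    tendsto_one_div_atTop_nhds_zero_nat
  refine .of_expLE (a := fun n => 2 * gramConst' * K / S.σ ^ 4 * (1 / n))
    (fun n => Finset.measurable_fun_sum _ fun i _ => (measurable_weights n i).pow_const 4) ?_ ?_
  · filter_upwards [eventually_params hS hR, hK] with n ⟨hn, hr, hp, hv, hm⟩ hK
    have hN := hS.noise_prob n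
    have hn' : (0 : ℝ) < n := by exact_mod_cast hn
    have hr' : (0 : ℝ) < S.r n := by exact_mod_cast hr
    have hρ := Params.ρ_pos (S := S) hn hr
    have hm4 := S.noiseFourth_nonneg n
    have : Nonempty (Fin (S.r n)) := ⟨⟨0, hr⟩⟩
    set q : ℝ := 1 + n / S.r n with hq
    have hq0 : 0 < q := by positivity
    set N2 : ℝ := n ^ 2 * (S.σ ^ 2 * S.ρ n ^ 2) with hN2
    have hN2ge : S.σ ^ 2 * (n * q) ≤ N2 := by
      have h := n_sq_ρ_sq (S := S) hn hr
      have h' : (n : ℝ) * q ≤ n ^ 2 * S.ρ n ^ 2 := by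
        rw [h]
        exact le_add_of_nonneg_right (by positivity)
      calc S.σ ^ 2 * (n * q) ≤ S.σ ^ 2 * (n ^ 2 * S.ρ n ^ 2) := by gcongr
        _ = N2 := by rw [hN2]; ring
    have hN20 : 0 < N2 := by positivity
    have hmeas : Measurable fun y : (Fin n → ℝ) × (Fin (S.r n) → Fin n ⊕ AugCols (S.p n) → ℝ) =>
        ∑ i, gramVec y.1 (fun k i => y.2 k (Sum.inl i)) i ^ 4 := by
      unfold gramVec; fun_prop
    have hmain : ExpLE (auxLaw S n)
        (fun y => ∑ i, gramVec y.1 (fun k i => y.2 k (Sum.inl i)) i ^ 4)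
        (gramConst' * ((n / S.r n) ^ 2 + 1) * (n * S.noiseFourth n)) := by
      refine ExpLE.prod_left (g := fun ξ => gramConst' * ((n / S.r n) ^ 2 + 1) * ∑ i, ξ i ^ 4)
        hmeas (ae_of_all _ fun ξ => ?_) ((hS.expLE_noise_fourth n).const_mul (by positivity))
      have h := expLE_gramVec_fourth (κ := Fin (S.r n)) ξ
      have hmg : ∀ i, Measurable fun R : Fin (S.r n) → Fin n → ℝ => gramVec ξ R i := fun i => by
        unfold gramVec; fun_prop
      simp only [Fintype.card_fin] at h
      rw [ExpLE.of_map (by fun_prop) (map_gaussMatrix_inl (ι' := AugCols (S.p n)) _)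
        (by fun_prop)] at h
      refine h.mono_right ?_
      have hcs : (∑ i, ξ i ^ 2) ^ 2 ≤ n * ∑ i, ξ i ^ 4 := by
        have := sq_sum_le_card_mul_sum_sq (s := Finset.univ) (f := fun i => ξ i ^ 2)
        simpa [← pow_mul] using this
      calc gramConst' * ((∑ i, ξ i ^ 2) ^ 2 * n / (S.r n : ℝ) ^ 2 + ∑ i, ξ i ^ 4)
          ≤ gramConst' * ((n * ∑ i, ξ i ^ 4) * n / (S.r n : ℝ) ^ 2 + ∑ i, ξ i ^ 4) := by gcongr
        _ = _ := by ring
    refine ((hmain.const_mul (c := 1 / N2 ^ 2) (by positivity)).mono (ae_of_all _ fun y =>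
      le_of_eq ?_)).mono_right ?_
    · rw [Finset.mul_sum]
      refine Finset.sum_congr rfl fun i _ => ?_
      rw [weights, hN2]
      ring
    · have h1 : ((n : ℝ) / S.r n) ^ 2 + 1 ≤ 2 * q ^ 2 := by
        have : (0 : ℝ) ≤ n / S.r n := by positivity
        rw [hq]; nlinarith
      calc 1 / N2 ^ 2 * (gramConst' * ((n / S.r n) ^ 2 + 1) * (n * S.noiseFourth n))
          ≤ 1 / (S.σ ^ 2 * (n * q)) ^ 2 * (gramConst' * (2 * q ^ 2) * (n * K)) := by gcongr
        _ = _ := by field_simp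
  · simpa using hninv.const_mul (2 * gramConst' * K / S.σ ^ 4)

/-- With high probability the weights satisfy any property valid along `weightFilter`. -/
lemma exists_good_weights (hS : S.Standing) (hR : Params.Rates S)
    {p : (Σ n, Fin n → ℝ) → Prop} (hp : ∀ᶠ x in weightFilter, p x) :
    ∃ U : ∀ n, Set ((Fin n → ℝ) × (Fin (S.r n) → Fin n ⊕ AugCols (S.p n) → ℝ)),
      (∀ n, MeasurableSet (U n)) ∧ WithHighProb (auxLaw S) U ∧
      ∀ n, ∀ y ∈ U n, p ⟨n, weights S n y⟩ := by
  obtain ⟨V, hV, hVp⟩ := mem_comap.1 hp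
  obtain ⟨ε, hε, hεV⟩ := Metric.mem_nhds_iff.1 hV
  refine ⟨fun n => {y | |∑ i, weights S n y i ^ 2 - 1| < ε} ∩ {y | ∑ i, weights S n y i ^ 4 < ε},
    fun n => ?_, (smallP_weights_sq hS hR ε hε).inter (smallP_weights_fourth hS hR ε hε), ?_⟩
  · have hm := measurable_weights (S := S) n
    exact (measurableSet_lt (by fun_prop) measurable_const).inter
      (measurableSet_lt (by fun_prop) measurable_const)
  · rintro n y ⟨h1, h2⟩
    have h1' : |∑ i, weights S n y i ^ 2 - 1| < ε := h1
    have h2' : ∑ i, weights S n y i ^ 4 < ε := h2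
    refine hVp (hεV ?_)
    have h0 : 0 ≤ ∑ i, weights S n y i ^ 4 := Finset.sum_nonneg fun i _ => by positivity
    simp only [Metric.mem_ball, Prod.dist_eq, Real.dist_eq, sub_zero]
    exact max_lt h1' (by rwa [abs_of_nonneg h0])

end Weights

/-! ### Counting columns -/

/-- The normalized leading term of column `c`. -/
noncomputable def score {n : ℕ} {C : Type*} (a : Fin n → ℝ) (X : C → Fin n → ℝ) (c : C) : ℝ :=
  ∑ i, X c i * a i

open Classical in
/-- Number of features whose pair of scores lies in the region assigned to it. -/
noncomputable def pairCount {p : ℕ} (B : Fin p → Set (ℝ × ℝ)) (N : Cols p → ℝ) : ℝ :=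
  ∑ j, if (N (Sum.inl j), N (Sum.inr j)) ∈ B j then 1 else 0

section Count

variable {n p : ℕ} (D : Measure ℝ) [IsProbabilityMeasure D]

lemma measurable_score {α : Type*} [MeasurableSpace α] {C : Type*} {a : α → Fin n → ℝ}
    {X : α → C → Fin n → ℝ} (ha : Measurable a) (hX : Measurable X) (c : C) :
    Measurable fun x => score (a x) (X x) c := by
  unfold score; fun_prop

/-- With the weights frozen, scores of distinct columns, original or knockoff, are independent, with
common law `linLaw`. -/
lemma iIndepFun_score (a : Fin n → ℝ) :
    iIndepFun (fun (c : Cols p) (X : Cols p → Fin n → ℝ) => score a X c)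
      (Measure.pi fun _ : Cols p => Measure.pi fun _ : Fin n => D) :=
  iIndepFun_pi (X := fun _ (x : Fin n → ℝ) => ∑ i, x i * a i)
    (fun _ => Measurable.aemeasurable (by fun_prop))

lemma map_score (a : Fin n → ℝ) (c : Cols p) :
    (Measure.pi fun _ : Cols p => Measure.pi fun _ : Fin n => D).map (fun X => score a X c) =
      linLaw D a := by
  have h := (measurePreserving_eval
    (fun _ : Cols p => Measure.pi fun _ : Fin n => D) c).map_eq
  unfold linLaw
  nth_rewrite 2 [← h]
  rw [Measure.map_map (by fun_prop) (by fun_prop)]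
  rfl

lemma map_score_pair (a : Fin n → ℝ) (j : Fin p) :
    (Measure.pi fun _ : Cols p => Measure.pi fun _ : Fin n => D).map
      (fun X => (score a X (Sum.inl j), score a X (Sum.inr j))) =
      (linLaw D a).prod (linLaw D a) := by
  have h := (iIndepFun_score (p := p) D a).indepFun
    (show (Sum.inl j : Cols p) ≠ Sum.inr j by simp)
  have hm : ∀ c, Measurable fun X : Cols p → Fin n → ℝ => score a X c := fun c =>
    measurable_score measurable_const measurable_id c
  rw [indepFun_iff_map_prod_eq_prod_map_map (hm _).aemeasurable (hm _).aemeasurable, map_score,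
    map_score] at h
  exact h

lemma measurable_pairCount {α : Type*} [MeasurableSpace α] {B : Fin p → Set (ℝ × ℝ)}
    (hB : ∀ j, MeasurableSet (B j)) {a : α → Fin n → ℝ} {X : α → Cols p → Fin n → ℝ}
    (ha : Measurable a) (hX : Measurable X) :
    Measurable fun x => pairCount B (score (a x) (X x)) := by
  classical
  unfold pairCount
  refine Finset.measurable_fun_sum _ fun j _ => Measurable.ite ?_ measurable_const
    measurable_const
  exact ((measurable_score ha hX _).prodMk (measurable_score ha hX _)) (hB j)

/-- Distinct features use disjoint pairs of columns, so their indicators are independent, each of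
variance at most 1. -/
lemma expLE_pairCount {B : Fin p → Set (ℝ × ℝ)} (hB : ∀ j, MeasurableSet (B j)) (a : Fin n → ℝ) :
    ExpLE (Measure.pi fun _ : Cols p => Measure.pi fun _ : Fin n => D)
      (fun X => (pairCount B (score a X) - ∑ j, ((linLaw D a).prod (linLaw D a)).real (B j)) ^ 2)
      p := by
  classical
  set Q := Measure.pi fun _ : Cols p => Measure.pi fun _ : Fin n => D with hQ
  set q : Fin p → ℝ × ℝ → ℝ := fun j => (B j).indicator 1 with hq
  have hqm : ∀ j, Measurable (q j) := fun j => measurable_one.indicator (hB j)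
  have hqb : ∀ j z, ‖q j z‖ ≤ 1 := fun j z => by
    simp only [hq, indicator_apply, Pi.one_apply]
    split_ifs <;> simp
  set Z : Fin p → (Cols p → Fin n → ℝ) → ℝ := fun j X =>
    q j (score a X (Sum.inl j), score a X (Sum.inr j)) with hZ
  have hsm : ∀ c, Measurable fun X : Cols p → Fin n → ℝ => score a X c := fun c =>
    measurable_score measurable_const measurable_id c
  have hZm : ∀ j, Measurable (Z j) := fun j => (hqm j).comp ((hsm _).prodMk (hsm _))
  have hL : ∀ j, MemLp (Z j) 2 Q := fun j =>
    MemLp.of_bound (hZm j).aestronglyMeasurable 1 (ae_of_all _ fun X => hqb j _)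
  have hind : Pairwise fun i j => IndepFun (Z i) (Z j) Q := by
    intro i j hij
    have h := (iIndepFun_score (p := p) D a).indepFun_prodMk_prodMk (fun c => hsm c)
      (Sum.inl i) (Sum.inr i) (Sum.inl j) (Sum.inr j) (by simpa using hij) (by simp) (by simp)
      (by simpa using hij)
    exact h.comp (hqm i) (hqm j)
  have hmean : ∀ j, ∫ X, Z j X ∂Q = ((linLaw D a).prod (linLaw D a)).real (B j) := by
    intro j
    rw [← integral_indicator_one (hB j), ← map_score_pair (p := p) D a j,
      integral_map ((hsm _).prodMk (hsm _)).aemeasurable (hqm j).aestronglyMeasurable]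
  have hsq : ∀ j, ∫ X, Z j X ^ 2 ∂Q ≤ 1 := by
    intro j
    have : ∫ X, Z j X ^ 2 ∂Q ≤ ∫ X, (1 : ℝ) ∂Q := by
      refine integral_mono (hL j).integrable_sq (integrable_const _) fun X => ?_
      have := hqb j (score a X (Sum.inl j), score a X (Sum.inr j))
      rw [Real.norm_eq_abs] at this
      calc Z j X ^ 2 = |Z j X| ^ 2 := (sq_abs _).symm
        _ ≤ 1 ^ 2 := by gcongr
        _ = 1 := one_pow 2
    simpa using this
  have h := expLE_sum_indep hL hind hmean hsq
  refine (h.mono (ae_of_all _ fun X => le_of_eq ?_)).mono_right (by simp)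
  congr 2

end Count

/-- A conditional bound valid for good y, with bad y charged their full mass. -/
lemma prod_measure_le_add {α β : Type*} [MeasurableSpace α] [MeasurableSpace β] {μ : Measure α}
    {ν : Measure β} [IsProbabilityMeasure μ] [IsProbabilityMeasure ν] {A : Set (α × β)}
    (hA : MeasurableSet A) {U : Set β} (hU : MeasurableSet U) {e : ENNReal}
    (h : ∀ y ∈ U, μ ((fun x => (x, y)) ⁻¹' A) ≤ e) : (μ.prod ν) A ≤ ν Uᶜ + e := by
  classical
  rw [Measure.prod_apply_symm hA]
  calc ∫⁻ y, μ ((fun x => (x, y)) ⁻¹' A) ∂ν ≤ ∫⁻ y, (Uᶜ.indicator 1 y + e) ∂ν := by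
        refine lintegral_mono fun y => ?_
        by_cases hy : y ∈ U
        · exact (h y hy).trans (le_add_left le_rfl)
        · refine le_add_right ?_
          rw [indicator_of_mem (mem_compl hy)]
          exact prob_le_one
    _ = ν Uᶜ + e := by
        rw [lintegral_add_right _ measurable_const, lintegral_indicator_one hU.compl]
        simp

/-- The Chebyshev inequality for the counts, given the weights. -/
lemma measure_pairCount_le {n p : ℕ} (D : Measure ℝ) [IsProbabilityMeasure D] (hp : 0 < p)
    {B : Fin p → Set (ℝ × ℝ)} (hB : ∀ j, MeasurableSet (B j)) (a : Fin n → ℝ) {T : Fin p → ℝ}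
    {δ : ℝ} (hδ : 0 < δ)
    (hT : ∀ j, |((linLaw D a).prod (linLaw D a)).real (B j) - T j| ≤ δ / 2) :
    (Measure.pi fun _ : Cols p => Measure.pi fun _ : Fin n => D)
      {X | δ * p < |pairCount B (score a X) - ∑ j, T j|} ≤
        ENNReal.ofReal (4 / δ ^ 2 * (1 / (p : ℝ))) := by
  have hp' : (0 : ℝ) < p := by exact_mod_cast hp
  have hE := expLE_pairCount D hB a
  set C := ∑ j, ((linLaw D a).prod (linLaw D a)).real (B j) with hCdef
  have hcheb := hE.meas_ge_le (((measurable_pairCount hB measurable_const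
    measurable_id).sub_const _).pow_const 2) (c := (δ / 2 * p) ^ 2) (by positivity)
  have e : (p : ℝ) / (δ / 2 * p) ^ 2 = 4 / δ ^ 2 * (1 / (p : ℝ)) := by
    field_simp; ring
  rw [e] at hcheb
  refine (measure_mono fun X hX => ?_).trans hcheb
  have hX' : δ * p < |pairCount B (score a X) - ∑ j, T j| := hX
  have hC : |C - ∑ j, T j| ≤ δ / 2 * p := by
    rw [hCdef, ← Finset.sum_sub_distrib]
    refine (Finset.abs_sum_le_sum_abs _ _).trans ?_
    refine (Finset.sum_le_sum fun j _ => hT j).trans (le_of_eq ?_)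
    rw [Finset.sum_const, Finset.card_univ, Fintype.card_fin, nsmul_eq_mul, mul_comm]
  have habs := abs_sub_le (pairCount B (score a X)) C (∑ j, T j)
  have hge : δ / 2 * p ≤ |pairCount B (score a X) - C| := by linarith
  change (δ / 2 * p) ^ 2 ≤ (pairCount B (score a X) - C) ^ 2
  rw [← sq_abs (pairCount B (score a X) - C)]
  exact pow_le_pow_left₀ (by positivity) hge 2

/-- The law of large numbers for the counts of features with scores in given regions. -/
lemma withHighProb_pairCount {S : Params} (hS : S.Standing) (hR : Params.Rates S)
    {B : ∀ n, Fin (S.p n) → Set (ℝ × ℝ)} (hB : ∀ n j, MeasurableSet (B n j))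
    {T : ∀ n, Fin (S.p n) → ℝ}
    (hT : ∀ (ν : Measure ℝ) [IsProbabilityMeasure ν] (δ : ℝ), LowerClose ν (gaussianReal 0 1) δ →
      0 ≤ δ → ∀ n j, |(ν.prod ν).real (B n j) - T n j| ≤ 4 * δ)
    {δ : ℝ} (hδ : 0 < δ) :
    WithHighProb (inputLaw S) fun n => {z |
      |pairCount (B n) (score (weights S n z.2) z.1) - ∑ j, T n j| ≤ δ * S.p n} := by
  have hD := hS.D_prob
  have h2 := integral_sq_eq_one hS.D_mean hS.D_var
  -- With accuracy δ/8 on half-lines, the bias of each indicator is at most 4 · δ/8 = δ/2; Chebyshev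
  -- uses the other half.
  obtain ⟨U, hUm, hU, hUp⟩ := exists_good_weights hS hR
    (eventually_lowerClose S.D hS.D_mean h2 (δ := δ / 8) (by positivity))
  have hpinf : Tendsto (fun n => (S.p n : ℝ)) atTop atTop :=
    tendsto_natCast_atTop_atTop.comp hS.p_tendsto
  have hlim : Tendsto (fun n => auxLaw S n (U n)ᶜ +
      ENNReal.ofReal (4 / δ ^ 2 * (1 / (S.p n : ℝ)))) atTop (𝓝 0) := by
    have h0 : Tendsto (fun n => 1 / (S.p n : ℝ)) atTop (𝓝 0) :=
      (tendsto_const_nhds (x := (1 : ℝ))).div_atTop hpinf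
    have h1 := h0.const_mul (4 / δ ^ 2)
    rw [mul_zero] at h1
    have h3 := (ENNReal.continuous_ofReal.tendsto _).comp h1
    rw [ENNReal.ofReal_zero] at h3
    have := Tendsto.add hU h3
    rwa [add_zero] at this
  refine tendsto_of_tendsto_of_tendsto_of_le_of_le' tendsto_const_nhds hlim
    (Eventually.of_forall fun _ => zero_le) ?_
  filter_upwards [eventually_params hS hR] with n ⟨hn, hr, hp, hv, hm⟩
  have hN := hS.noise_prob n
  have hw : Measurable fun z : Inputs n (S.p n) (S.r n) => weights S n z.2 :=
    measurable_pi_lambda _ fun i => (measurable_weights n i).comp measurable_snd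
  have hcm : Measurable fun z : Inputs n (S.p n) (S.r n) =>
      pairCount (B n) (score (weights S n z.2) z.1) :=
    measurable_pairCount (hB n) hw measurable_fst
  refine prod_measure_le_add (measurableSet_le (hcm.sub_const _).abs measurable_const).compl
    (hUm n) fun y hy => ?_
  have hlc : LowerClose (linLaw S.D (weights S n y)) (gaussianReal 0 1) (δ / 8) := hUp n y hy
  refine (measure_mono fun X hX => ?_).trans (measure_pairCount_le S.D hp (hB n) (weights S n y)
    (T := T n) hδ fun j => (hT _ _ hlc (by positivity) n j).trans (by linarith))
  exact (not_le (a := |pairCount (B n) (score (weights S n y) X) - ∑ j, T n j|)).1 hX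

/-! ### The law of the inputs of a sample -/

section Law

variable {S : Params} {n : ℕ} {Ω : Type*} [MeasurableSpace Ω] {P : Measure Ω}
  {Y : Sample S n Ω}

/-- Rearrangement of the family of all scalar inputs. -/
def ofEntries {n p r : ℕ}
    (x : (Fin n × Cols p) ⊕ (Fin n ⊕ (Fin r × (Fin n ⊕ AugCols p))) → ℝ) : Inputs n p r :=
  (fun c i => x (Sum.inl (i, c)), (fun i => x (Sum.inr (Sum.inl i)),
    fun k l => x (Sum.inr (Sum.inr (k, l)))))

lemma measurable_ofEntries {n p r : ℕ} : Measurable (ofEntries (n := n) (p := p) (r := r)) := by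
  unfold ofEntries; fun_prop

/-- The laws of the scalar inputs. -/
noncomputable def entryLaw (S : Params) (n : ℕ) :
    (Fin n × Cols (S.p n)) ⊕ (Fin n ⊕ (Fin (S.r n) × (Fin n ⊕ AugCols (S.p n)))) → Measure ℝ
  | Sum.inl _ => S.D
  | Sum.inr (Sum.inl _) => S.noiseLaw n
  | Sum.inr (Sum.inr _) => gaussianReal 0 ((S.r n : ℝ≥0)⁻¹)

/-- Inverse of `ofEntries`. -/
def toEntries {n p r : ℕ} (z : Inputs n p r) :
    (Fin n × Cols p) ⊕ (Fin n ⊕ (Fin r × (Fin n ⊕ AugCols p))) → ℝ :=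
  Sum.elim (fun q => z.1 q.2 q.1) (Sum.elim z.2.1 fun q => z.2.2 q.1 q.2)

lemma measurable_toEntries {n p r : ℕ} : Measurable (toEntries (n := n) (p := p) (r := r)) := by
  refine measurable_pi_lambda _ fun i => ?_
  rcases i with i | i | i <;> simp only [toEntries, Sum.elim_inl, Sum.elim_inr] <;> fun_prop

lemma map_toEntries (hS : S.Standing) :
    (inputLaw S n).map toEntries = Measure.pi (entryLaw S n) := by
  have hD := hS.D_prob
  have hN := hS.noise_prob n
  have hE : ∀ i, IsProbabilityMeasure (entryLaw S n i) := by
    rintro (i | i | i) <;> simp only [entryLaw] <;> infer_instance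
  refine (Measure.pi_eq fun s hs => ?_).symm
  rw [Measure.map_apply measurable_toEntries (MeasurableSet.univ_pi hs)]
  have : toEntries ⁻¹' (univ.pi s) =
      (univ.pi fun c => univ.pi fun i => s (Sum.inl (i, c))) ×ˢ
        ((univ.pi fun i => s (Sum.inr (Sum.inl i))) ×ˢ
          (univ.pi fun k => univ.pi fun l => s (Sum.inr (Sum.inr (k, l))))) := by
    ext z
    simp only [mem_preimage, mem_univ_pi, mem_prod]
    constructor
    · intro h
      exact ⟨fun c i => h (Sum.inl (i, c)), fun i => h (Sum.inr (Sum.inl i)),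
        fun k l => h (Sum.inr (Sum.inr (k, l)))⟩
    · rintro ⟨h1, h2, h3⟩ (⟨i, c⟩ | i | ⟨k, l⟩)
      · exact h1 c i
      · exact h2 i
      · exact h3 k l
  rw [this, inputLaw, auxLaw, Measure.prod_prod, Measure.prod_prod, Measure.pi_pi, Measure.pi_pi,
    Measure.pi_pi]
  simp_rw [Measure.pi_pi]
  symm
  refine (Fintype.prod_sum_type _).trans ?_
  congr 1
  · refine (Fintype.prod_prod_type _).trans ?_
    exact Finset.prod_comm
  · refine (Fintype.prod_sum_type _).trans ?_
    congr 1
    exact Fintype.prod_prod_type _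

lemma map_ofEntries (hS : S.Standing) :
    (Measure.pi (entryLaw S n)).map ofEntries = inputLaw S n := by
  rw [← map_toEntries hS, Measure.map_map measurable_ofEntries measurable_toEntries]
  exact Measure.map_id

lemma Sample.IsModel.hasLaw_entries (hY : Y.IsModel P) (i) :
    HasLaw (Y.entries i) (entryLaw S n i) P := by
  rcases i with ⟨i, j | j⟩ | i | ⟨k, l⟩
  · exact hY.law_X i j
  · exact hY.law_Xk i j
  · exact hY.law_ξ i
  · exact hY.law_R k l

lemma Sample.IsModel.aemeasurable_entries (hY : Y.IsModel P) :
    AEMeasurable (fun ω i => Y.entries i ω) P :=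
  aemeasurable_pi_lambda _ fun i => (hY.hasLaw_entries i).aemeasurable

/-- Independence and the marginals determine the joint law, so all probabilities can be computed
under the explicit product law. -/
lemma Sample.IsModel.map_inputs [IsProbabilityMeasure P] (hY : Y.IsModel P) (hS : S.Standing) :
    P.map Y.inputs = inputLaw S n := by
  have h1 := hY.indep.map_fun_eq_pi_map fun i => (hY.hasLaw_entries i).aemeasurable
  have h2 : (fun i => P.map (Y.entries i)) = entryLaw S n := by
    ext1 i
    exact (hY.hasLaw_entries i).map_eq
  rw [h2] at h1
  rw [← map_ofEntries hS, ← h1, AEMeasurable.map_map_of_aemeasurable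
    measurable_ofEntries.aemeasurable hY.aemeasurable_entries]
  rfl

lemma Sample.IsModel.aemeasurable_inputs (hY : Y.IsModel P) : AEMeasurable Y.inputs P :=
  measurable_ofEntries.comp_aemeasurable hY.aemeasurable_entries

end Law

/-- Only an upper bound for the complement is transported, which needs no measurability of `E n`. -/
lemma WithHighProb.of_inputs {S : Params} (hS : S.Standing) {Ω : ℕ → Type*}
    [∀ n, MeasurableSpace (Ω n)] {P : ∀ n, Measure (Ω n)} [∀ n, IsProbabilityMeasure (P n)]
    {Y : ∀ n, Sample S n (Ω n)} (hY : ∀ n, (Y n).IsModel (P n))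
    {E : ∀ n, Set (Inputs n (S.p n) (S.r n))} (hE : WithHighProb (inputLaw S) E) :
    WithHighProb P fun n => (Y n).inputs ⁻¹' E n := by
  refine tendsto_of_tendsto_of_tendsto_of_le_of_le tendsto_const_nhds hE (fun _ => zero_le)
    fun n => ?_
  rw [← (hY n).map_inputs hS, ← preimage_compl]
  exact Measure.le_map_apply (hY n).aemeasurable_inputs _

/-! ### Counting with perturbed scores -/

lemma pairCount_eq_ncard {p : ℕ} (B : Fin p → Set (ℝ × ℝ)) (N : Cols p → ℝ) :
    pairCount B N = ({j | (N (Sum.inl j), N (Sum.inr j)) ∈ B j}.ncard : ℝ) := by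
  classical
  rw [pairCount, Finset.sum_boole, Set.ncard_eq_toFinset_card']
  congr 2
  ext j
  simp

lemma sum_ite_mem_const {p : ℕ} (J : Set (Fin p)) [DecidablePred (· ∈ J)] (c : ℝ) :
    (∑ j, if j ∈ J then c else 0) = J.ncard * c := by
  rw [← Finset.sum_filter, Finset.sum_const, nsmul_eq_mul, Set.ncard_eq_toFinset_card']
  congr 2
  congr 1
  ext j
  simp

lemma ncard_le_add_of_subset_union {p : ℕ} {A B C : Set (Fin p)} (h : A ⊆ B ∪ C) :
    (A.ncard : ℝ) ≤ B.ncard + C.ncard := by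
  exact_mod_cast (ncard_le_ncard h (toFinite _)).trans (ncard_union_le B C)

/-- Markov's inequality for the counting measure: a feature with a bad coordinate costs at least ε².
-/
lemma ncard_mul_sq_le {p : ℕ} (d : Cols p → ℝ) {ε : ℝ} (hε : 0 ≤ ε) :
    ({j | ε < |d (Sum.inl j)| ∨ ε < |d (Sum.inr j)|}.ncard : ℝ) * ε ^ 2 ≤ ∑ c, d c ^ 2 := by
  classical
  rw [← sum_ite_mem_const, Fintype.sum_sum_type, ← Finset.sum_add_distrib]
  refine Finset.sum_le_sum fun j _ => ?_
  split_ifs with h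
  · rcases h with h | h
    · have := pow_le_pow_left₀ hε h.le 2
      rw [sq_abs] at this
      nlinarith [sq_nonneg (d (Sum.inr j))]
    · have := pow_le_pow_left₀ hε h.le 2
      rw [sq_abs] at this
      nlinarith [sq_nonneg (d (Sum.inl j))]
  · positivity

lemma WithHighProb.of_ae {Ω : ℕ → Type*} [∀ n, MeasurableSpace (Ω n)] {P : ∀ n, Measure (Ω n)}
    {p : ∀ n, Ω n → Prop} (h : ∀ n, ∀ᵐ ω ∂P n, p n ω) : WithHighProb P fun n => {ω | p n ω} := by
  have : ∀ n, P n {ω | p n ω}ᶜ = 0 := fun n => h n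
  simp only [WithHighProb, this]
  exact tendsto_const_nhds

/-! ### Shifted regions for winning features and winning knockoffs -/

section Regions

variable {ν : Measure ℝ} [IsProbabilityMeasure ν] {δ t : ℝ} {g h : ℝ → ℝ}

lemma LowerClose.left_region (hν : LowerClose ν (gaussianReal 0 1) δ) (hg : AbsMono g)
    (hh : AbsMono h) (hgc : Continuous g) (hhc : Continuous h) (m : ℝ) :
    |(ν.prod ν).real {z | (m + z.1, z.2) ∈ JLKnockoff.gapSet t g h} -
      gaussShift m 0 (JLKnockoff.gapSet t g h)| ≤ 4 * δ := by
  simpa only [zero_add] using hν.gapSet (t := t) hg hh hgc hhc m 0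

/-- The coordinates are exchanged: when the knockoff wins, the shifted original score is the second
argument of the gap. -/
lemma LowerClose.right_region (hν : LowerClose ν (gaussianReal 0 1) δ) (hg : AbsMono g)
    (hh : AbsMono h) (hgc : Continuous g) (hhc : Continuous h) (m : ℝ) :
    |(ν.prod ν).real {z | (z.2, m + z.1) ∈ JLKnockoff.gapSet t g h} -
      gaussShift 0 m (JLKnockoff.gapSet t g h)| ≤ 4 * δ := by
  have hm := measurableSet_gapSet t hgc hhc
  have hm' : MeasurableSet {z : ℝ × ℝ | (z.2, m + z.1) ∈ JLKnockoff.gapSet t g h} :=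
    (by fun_prop : Measurable fun z : ℝ × ℝ => (z.2, m + z.1)) hm
  rw [← Measure.prod_swap, map_measureReal_apply measurable_swap hm']
  have := hν.gapSet (t := t) hg hh hgc hhc 0 m
  simp only [zero_add] at this
  exact this

end Regions

/-! ### Asymptotic counts of features and knockoffs that win by the threshold -/

section Main

variable {S : Params} {Ω : ℕ → Type*} [∀ n, MeasurableSpace (Ω n)] {P : ∀ n, Measure (Ω n)}
  [∀ n, IsProbabilityMeasure (P n)]

/-- The scores of the inputs of a sample. -/
noncomputable def sampleScore {n : ℕ} {Ω : Type*} (Y : Sample S n Ω) (ω : Ω) :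
    Cols (S.p n) → ℝ :=
  score (weights S n (Y.inputs ω).2) (Y.inputs ω).1

/-- Law of large numbers for a subfamily `J` of features and regions around the points `m`. -/
lemma withHighProb_count (hS : S.Standing) (hR : Params.Rates S)
    {Y : ∀ n, Sample S n (Ω n)} (hY : ∀ n, (Y n).IsModel (P n))
    (J : ∀ n, Set (Fin (S.p n))) {A : ℝ → Set (ℝ × ℝ)} {G : ℝ → ℝ}
    (hA : ∀ m, MeasurableSet (A m))
    (hAG : ∀ (ν : Measure ℝ) [IsProbabilityMeasure ν] (δ : ℝ), LowerClose ν (gaussianReal 0 1) δ →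
      ∀ m, |(ν.prod ν).real (A m) - G m| ≤ 4 * δ)
    (m : ∀ n, Fin (S.p n) → ℝ) {δ : ℝ} (hδ : 0 < δ) :
    open Classical in
    WithHighProb P fun n => {ω | |(({j | j ∈ J n ∧ (sampleScore (Y n) ω (Sum.inl j),
      sampleScore (Y n) ω (Sum.inr j)) ∈ A (m n j)}.ncard : ℝ)) -
        ∑ j, if j ∈ J n then G (m n j) else 0| ≤ δ * S.p n} := by
  classical
  have h := withHighProb_pairCount hS hR
    -- Features outside the subfamily get the empty region and target 0.
    (B := fun n j => if j ∈ J n then A (m n j) else ∅)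
    (fun n j => by split_ifs; exacts [hA _, MeasurableSet.empty])
    (T := fun n j => if j ∈ J n then G (m n j) else 0)
    (fun ν _ δ' hν hδ' n j => by
      split_ifs
      · exact hAG ν δ' hν _
      · simpa using hδ') hδ
  refine (WithHighProb.of_inputs hS hY h).mono (Eventually.of_forall fun n ω hω => ?_)
  have hω' : |pairCount (fun j => if j ∈ J n then A (m n j) else ∅) (sampleScore (Y n) ω) -
    ∑ j, if j ∈ J n then G (m n j) else 0| ≤ δ * S.p n := hω
  rw [pairCount_eq_ncard] at hω'
  have hset : {j | (sampleScore (Y n) ω (Sum.inl j), sampleScore (Y n) ω (Sum.inr j)) ∈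
      if j ∈ J n then A (m n j) else ∅} = {j | j ∈ J n ∧ (sampleScore (Y n) ω (Sum.inl j),
      sampleScore (Y n) ω (Sum.inr j)) ∈ A (m n j)} := by
    ext j
    by_cases hj : j ∈ J n <;> simp [hj]
  rwa [mem_ofPred_eq, ← hset]

/-- The normalized debiased estimate. -/
noncomputable def stat {n : ℕ} {Ω : Type*} (Y : Sample S n Ω) (θ : Cols (S.p n) → ℝ) (ω : Ω)
    (c : Cols (S.p n)) : ℝ := Y.debias ω θ c / (S.σ * S.ρ n)

/-- For most features the normalized debiased estimate is close to signal plus score. -/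
lemma withHighProb_approx (hS : S.Standing) (hR : Params.Rates S)
    {Y : ∀ n, Sample S n (Ω n)} (hY : ∀ n, (Y n).IsModel (P n))
    {θhat : ∀ n, Ω n → Cols (S.p n) → ℝ}
    (hθ : ∀ n, ∀ᵐ ω ∂P n, (Y n).IsLasso (S.lam 1 n) ω (θhat n ω))
    {ε δ : ℝ} (hε : 0 < ε) (hδ : 0 < δ) :
    WithHighProb P fun n => {ω | ({j |
      ε < |stat (Y n) (θhat n ω) ω (Sum.inl j) -
        (S.θ₀ n j / (S.σ * S.ρ n) + sampleScore (Y n) ω (Sum.inl j))| ∨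
      ε < |stat (Y n) (θhat n ω) ω (Sum.inr j) - sampleScore (Y n) ω (Sum.inr j)|}.ncard : ℝ) ≤
        δ * S.p n} := by
  have hσ := hS.σ_pos
  have h1 := WithHighProb.of_inputs hS hY (smallP_gramErr hS hR (1 / 4) (by norm_num))
  have h2 := WithHighProb.of_inputs hS hY (smallP_debiasErr hS hR (δ * S.σ ^ 2 * ε ^ 2)
    (by positivity))
  refine ((h1.inter h2).inter (WithHighProb.of_ae hθ)).mono ?_
  filter_upwards [eventually_params hS hR] with n ⟨hn, hr, hp, hv, hm⟩
  rintro ω ⟨⟨hω1, hω2⟩, hω3⟩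
  have hω1' : gramErr S n ((Y n).inputs ω) < 1 / 4 := hω1
  have hω2' : debiasErr S n ((Y n).inputs ω) / (S.p n * S.ρ n ^ 2) < δ * S.σ ^ 2 * ε ^ 2 := hω2
  have hp' : (0 : ℝ) < S.p n := by exact_mod_cast hp
  have hρ := Params.ρ_pos (S := S) hn hr
  have hs : 0 < S.σ * S.ρ n := by positivity
  have hlam : 0 ≤ S.lam 1 n := by unfold Params.lam; positivity
  obtain ⟨e, he, hesq⟩ := (Y n).exists_debias_eq hn hlam (hS.θ₀_norm n) hω3 hω1'.le
  change ∑ c, e c ^ 2 ≤ debiasErr S n ((Y n).inputs ω) at hesq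
  have hd : ∀ c, stat (Y n) (θhat n ω) ω c -
      (Sample.coef S n c / (S.σ * S.ρ n) + sampleScore (Y n) ω c) = e c / (S.σ * S.ρ n) := by
    intro c
    rw [stat, he c, lead_eq n hn _ hs.ne']
    simp only [sampleScore, score]
    field_simp
    ring
  have hset : {j | ε < |stat (Y n) (θhat n ω) ω (Sum.inl j) -
        (S.θ₀ n j / (S.σ * S.ρ n) + sampleScore (Y n) ω (Sum.inl j))| ∨
      ε < |stat (Y n) (θhat n ω) ω (Sum.inr j) - sampleScore (Y n) ω (Sum.inr j)|} =
      {j | ε < |(fun c => e c / (S.σ * S.ρ n)) (Sum.inl j)| ∨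
        ε < |(fun c => e c / (S.σ * S.ρ n)) (Sum.inr j)|} := by
    ext j
    simp only [mem_ofPred_eq, ← hd, Sample.coef, Sum.elim_inl, Sum.elim_inr, Pi.zero_apply,
      zero_div, zero_add]
  rw [mem_ofPred_eq, hset]
  have hcard := ncard_mul_sq_le (fun c => e c / (S.σ * S.ρ n)) hε.le
  have hsum : ∑ c, (e c / (S.σ * S.ρ n)) ^ 2 ≤ δ * S.p n * ε ^ 2 := by
    simp only [div_pow, ← Finset.sum_div]
    rw [div_le_iff₀ (by positivity)]
    rw [div_lt_iff₀ (by positivity)] at hω2'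
    refine hesq.trans (hω2'.le.trans (le_of_eq ?_))
    ring
  exact le_of_mul_le_mul_right (hcard.trans hsum) (by positivity)

section Counts

variable {Y : ∀ n, Sample S n (Ω n)} {θhat : ∀ n, Ω n → Cols (S.p n) → ℝ} {g : ℝ → ℝ} (t : ℝ)
  {J : ∀ n, Set (Fin (S.p n))} {m : ℝ} {m' : ∀ n, Fin (S.p n) → ℝ} {δ : ℝ}

/-- Signals of size at least `m` are selected at least as often as a Gaussian shifted by `m`. -/
lemma withHighProb_ge_lower (hS : S.Standing) (hR : Params.Rates S)
    (hY : ∀ n, (Y n).IsModel (P n))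
    (hθ : ∀ n, ∀ᵐ ω ∂P n, (Y n).IsLasso (S.lam 1 n) ω (θhat n ω))
    (hg : AbsMono g) (hgc : Continuous g) (hm : 0 ≤ m) (hm' : ∀ n j, j ∈ J n → m ≤ m' n j)
    (hmθ : ∀ ε > 0, ∀ᶠ n in atTop, ∀ j ∈ J n, |S.θ₀ n j / (S.σ * S.ρ n) - m' n j| ≤ ε)
    (hδ : 0 < δ) :
    WithHighProb P fun n => {ω | (J n).ncard * gaussShift m 0 (gapSet t g g) - δ * S.p n ≤
      ({j | j ∈ J n ∧ t ≤ g (stat (Y n) (θhat n ω) ω (Sum.inl j)) -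
        g (stat (Y n) (θhat n ω) ω (Sum.inr j))}.ncard : ℝ)} := by
  classical
  -- The budget δ is split in three: perturbation of the region, law of large numbers, and badly
  -- approximated features.
  obtain ⟨ε, hε, hεF⟩ := exists_inner_perturbation hg hgc (t := t) m 0
    (show 0 < δ / 3 by positivity)
  set F := gapSet t (shrink g ε) (grow g ε) with hF
  have hFm : MeasurableSet F :=
    measurableSet_gapSet t (continuous_shrink hgc ε) (continuous_grow hgc ε)
  have hc := withHighProb_count hS hR hY J (A := fun m => {z | (m + z.1, z.2) ∈ F})
    (G := fun m => gaussShift m 0 F)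
    (fun m => (by fun_prop : Measurable fun z : ℝ × ℝ => (m + z.1, z.2)) hFm)
    (fun ν _ δ hν m => hν.left_region (hg.shrink ε) (hg.grow hε.le) (continuous_shrink hgc ε)
      (continuous_grow hgc ε) m) m' (show 0 < δ / 3 by positivity)
  have ha := withHighProb_approx hS hR hY hθ (half_pos hε) (show 0 < δ / 3 by positivity)
  refine (hc.inter ha).mono ?_
  -- Half of ε covers the debiasing error, the other half the replacement of the normalized signal
  -- by m'.
  filter_upwards [hmθ (ε / 2) (half_pos hε)] with n hn ω ⟨h1, h2⟩
  rw [mem_ofPred_eq] at h1 h2 ⊢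
  have hT : (J n).ncard * gaussShift m 0 F ≤
      ∑ j, if j ∈ J n then gaussShift (m' n j) 0 F else 0 := by
    rw [← sum_ite_mem_const]
    refine Finset.sum_le_sum fun j _ => ?_
    split_ifs with hj
    · exact gaussShift_mono_left (hg.shrink ε) (continuous_shrink hgc ε) (continuous_grow hgc ε)
        hm (hm' n j hj) 0
    · rfl
  have hsub := ncard_le_add_of_subset_union (A := {j | j ∈ J n ∧
      (m' n j + sampleScore (Y n) ω (Sum.inl j), sampleScore (Y n) ω (Sum.inr j)) ∈ F})
    (B := {j | j ∈ J n ∧ t ≤ g (stat (Y n) (θhat n ω) ω (Sum.inl j)) -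
        g (stat (Y n) (θhat n ω) ω (Sum.inr j))})
    (C := {j | ε / 2 < |stat (Y n) (θhat n ω) ω (Sum.inl j) -
        (S.θ₀ n j / (S.σ * S.ρ n) + sampleScore (Y n) ω (Sum.inl j))| ∨
      ε / 2 < |stat (Y n) (θhat n ω) ω (Sum.inr j) - sampleScore (Y n) ω (Sum.inr j)|}) (by
    rintro j ⟨hj, hjF⟩
    by_contra hcon
    rw [mem_union, not_or] at hcon
    obtain ⟨c1, c2⟩ := hcon
    simp only [mem_ofPred_eq, not_or, not_lt] at c2
    refine c1 ⟨hj, ?_⟩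
    have hjF' : t ≤ shrink g ε (m' n j + sampleScore (Y n) ω (Sum.inl j)) -
      grow g ε (sampleScore (Y n) ω (Sum.inr j)) := hjF
    have d1 : |m' n j + sampleScore (Y n) ω (Sum.inl j) -
        stat (Y n) (θhat n ω) ω (Sum.inl j)| ≤ ε := by
      have := abs_le.1 c2.1
      have := abs_le.1 (hn j hj)
      rw [abs_le]; constructor <;> linarith
    have d2 : |sampleScore (Y n) ω (Sum.inr j) -
        stat (Y n) (θhat n ω) ω (Sum.inr j)| ≤ ε := by
      rw [abs_sub_comm]; linarith [c2.2]
    have k1 := hg.shrink_le d1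
    have k2 := hg.le_grow d2
    linarith)
  have hJ : ((J n).ncard : ℝ) ≤ S.p n := by
    have := ncard_le_card (J n)
    rw [Nat.card_fin] at this
    exact_mod_cast this
  have h1' := (abs_le.1 h1).1
  have hJδ : ((J n).ncard : ℝ) * (gaussShift m 0 (gapSet t g g) - δ / 3) ≤
      (J n).ncard * gaussShift m 0 F := by gcongr
  have hJδ' : ((J n).ncard : ℝ) * (δ / 3) ≤ S.p n * (δ / 3) := by gcongr
  linarith

/-- Null features are selected at most as often as in the Gaussian limit. -/
lemma withHighProb_ge_upper (hS : S.Standing) (hR : Params.Rates S)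
    (hY : ∀ n, (Y n).IsModel (P n))
    (hθ : ∀ n, ∀ᵐ ω ∂P n, (Y n).IsLasso (S.lam 1 n) ω (θhat n ω))
    (hg : AbsMono g) (hgc : Continuous g) (hJ0 : ∀ n j, j ∈ J n → S.θ₀ n j = 0)
    (hδ : 0 < δ) :
    WithHighProb P fun n => {ω | ({j | j ∈ J n ∧ t ≤ g (stat (Y n) (θhat n ω) ω (Sum.inl j)) -
        g (stat (Y n) (θhat n ω) ω (Sum.inr j))}.ncard : ℝ) ≤
      (J n).ncard * gaussShift 0 0 (gapSet t g g) + δ * S.p n} := by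
  classical
  obtain ⟨ε, hε, hεF⟩ := exists_outer_perturbation hg hgc (t := t) 0 0
    (show 0 < δ / 3 by positivity)
  set F := gapSet t (grow g ε) (shrink g ε) with hF
  have hFm : MeasurableSet F :=
    measurableSet_gapSet t (continuous_grow hgc ε) (continuous_shrink hgc ε)
  have hc := withHighProb_count hS hR hY J (A := fun m => {z | (m + z.1, z.2) ∈ F})
    (G := fun m => gaussShift m 0 F)
    (fun m => (by fun_prop : Measurable fun z : ℝ × ℝ => (m + z.1, z.2)) hFm)
    (fun ν _ δ hν m => hν.left_region (hg.grow hε.le) (hg.shrink ε) (continuous_grow hgc ε)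
      (continuous_shrink hgc ε) m) (fun _ _ => 0) (show 0 < δ / 3 by positivity)
  have ha := withHighProb_approx hS hR hY hθ (half_pos hε) (show 0 < δ / 3 by positivity)
  refine (hc.inter ha).mono ?_
  refine Eventually.of_forall ?_
  rintro n ω ⟨h1, h2⟩
  rw [mem_ofPred_eq] at h1 h2 ⊢
  rw [sum_ite_mem_const] at h1
  change |(({j | j ∈ J n ∧ (0 + sampleScore (Y n) ω (Sum.inl j),
    sampleScore (Y n) ω (Sum.inr j)) ∈ F}.ncard : ℝ)) - _| ≤ _ at h1
  have hsub := ncard_le_add_of_subset_union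
    (A := {j | j ∈ J n ∧ t ≤ g (stat (Y n) (θhat n ω) ω (Sum.inl j)) -
        g (stat (Y n) (θhat n ω) ω (Sum.inr j))})
    (B := {j | j ∈ J n ∧
      (0 + sampleScore (Y n) ω (Sum.inl j), sampleScore (Y n) ω (Sum.inr j)) ∈ F})
    (C := {j | ε / 2 < |stat (Y n) (θhat n ω) ω (Sum.inl j) -
        (S.θ₀ n j / (S.σ * S.ρ n) + sampleScore (Y n) ω (Sum.inl j))| ∨
      ε / 2 < |stat (Y n) (θhat n ω) ω (Sum.inr j) - sampleScore (Y n) ω (Sum.inr j)|}) (by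
    rintro j ⟨hj, hjF⟩
    by_contra hcon
    rw [mem_union, not_or] at hcon
    obtain ⟨c1, c2⟩ := hcon
    simp only [mem_ofPred_eq, not_or, not_lt] at c2
    refine c1 ⟨hj, ?_⟩
    rw [hJ0 n j hj, zero_div, abs_sub_comm] at c2
    rw [abs_sub_comm (stat _ _ _ (Sum.inr j))] at c2
    have k1 := hg.le_grow (c2.1.trans (half_le_self hε.le))
    have k2 := hg.shrink_le (c2.2.trans (half_le_self hε.le))
    have hjF' : t ≤ g (stat (Y n) (θhat n ω) ω (Sum.inl j)) -
      g (stat (Y n) (θhat n ω) ω (Sum.inr j)) := hjF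
    exact (show t ≤ grow g ε (0 + sampleScore (Y n) ω (Sum.inl j)) -
      shrink g ε (sampleScore (Y n) ω (Sum.inr j)) by linarith))
  have hJ : ((J n).ncard : ℝ) ≤ S.p n := by
    have := ncard_le_card (J n)
    rw [Nat.card_fin] at this
    exact_mod_cast this
  have h1' := (abs_le.1 h1).2
  have hJδ : (J n).ncard * gaussShift 0 0 F ≤
      ((J n).ncard : ℝ) * (gaussShift 0 0 (gapSet t g g) + δ / 3) := by gcongr
  have hJδ' : ((J n).ncard : ℝ) * (δ / 3) ≤ S.p n * (δ / 3) := by gcongr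
  linarith

/-- Knockoffs of signals of size at least `m` win at most as often as for a Gaussian shifted
by `m`. -/
lemma withHighProb_le_upper (hS : S.Standing) (hR : Params.Rates S)
    (hY : ∀ n, (Y n).IsModel (P n))
    (hθ : ∀ n, ∀ᵐ ω ∂P n, (Y n).IsLasso (S.lam 1 n) ω (θhat n ω))
    (hg : AbsMono g) (hgc : Continuous g) (hm : 0 ≤ m) (hm' : ∀ n j, j ∈ J n → m ≤ m' n j)
    (hmθ : ∀ ε > 0, ∀ᶠ n in atTop, ∀ j ∈ J n, |S.θ₀ n j / (S.σ * S.ρ n) - m' n j| ≤ ε)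
    (hδ : 0 < δ) :
    WithHighProb P fun n => {ω | ({j | j ∈ J n ∧ t ≤ g (stat (Y n) (θhat n ω) ω (Sum.inr j)) -
        g (stat (Y n) (θhat n ω) ω (Sum.inl j))}.ncard : ℝ) ≤
      (J n).ncard * gaussShift 0 m (gapSet t g g) + δ * S.p n} := by
  classical
  obtain ⟨ε, hε, hεF⟩ := exists_outer_perturbation hg hgc (t := t) 0 m
    (show 0 < δ / 3 by positivity)
  set F := gapSet t (grow g ε) (shrink g ε) with hF
  have hFm : MeasurableSet F :=
    measurableSet_gapSet t (continuous_grow hgc ε) (continuous_shrink hgc ε)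
  have hc := withHighProb_count hS hR hY J (A := fun m => {z | (z.2, m + z.1) ∈ F})
    (G := fun m => gaussShift 0 m F)
    (fun m => (by fun_prop : Measurable fun z : ℝ × ℝ => (z.2, m + z.1)) hFm)
    (fun ν _ δ hν m => hν.right_region (hg.grow hε.le) (hg.shrink ε) (continuous_grow hgc ε)
      (continuous_shrink hgc ε) m) m' (show 0 < δ / 3 by positivity)
  have ha := withHighProb_approx hS hR hY hθ (half_pos hε) (show 0 < δ / 3 by positivity)
  refine (hc.inter ha).mono ?_
  filter_upwards [hmθ (ε / 2) (half_pos hε)] with n hn ω ⟨h1, h2⟩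
  rw [mem_ofPred_eq] at h1 h2 ⊢
  have hT : (∑ j, if j ∈ J n then gaussShift 0 (m' n j) F else 0) ≤
      (J n).ncard * gaussShift 0 m F := by
    rw [← sum_ite_mem_const]
    refine Finset.sum_le_sum fun j _ => ?_
    split_ifs with hj
    · exact gaussShift_anti_right (hg.shrink ε) (continuous_grow hgc ε) (continuous_shrink hgc ε)
        hm (hm' n j hj) 0
    · rfl
  have hsub := ncard_le_add_of_subset_union
    (A := {j | j ∈ J n ∧ t ≤ g (stat (Y n) (θhat n ω) ω (Sum.inr j)) -
        g (stat (Y n) (θhat n ω) ω (Sum.inl j))})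
    (B := {j | j ∈ J n ∧
      (sampleScore (Y n) ω (Sum.inr j), m' n j + sampleScore (Y n) ω (Sum.inl j)) ∈ F})
    (C := {j | ε / 2 < |stat (Y n) (θhat n ω) ω (Sum.inl j) -
        (S.θ₀ n j / (S.σ * S.ρ n) + sampleScore (Y n) ω (Sum.inl j))| ∨
      ε / 2 < |stat (Y n) (θhat n ω) ω (Sum.inr j) - sampleScore (Y n) ω (Sum.inr j)|}) (by
    rintro j ⟨hj, hjF⟩
    by_contra hcon
    rw [mem_union, not_or] at hcon
    obtain ⟨c1, c2⟩ := hcon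
    simp only [mem_ofPred_eq, not_or, not_lt] at c2
    refine c1 ⟨hj, ?_⟩
    have d1 : |m' n j + sampleScore (Y n) ω (Sum.inl j) -
        stat (Y n) (θhat n ω) ω (Sum.inl j)| ≤ ε := by
      have := abs_le.1 c2.1
      have := abs_le.1 (hn j hj)
      rw [abs_le]; constructor <;> linarith
    have d2 : |sampleScore (Y n) ω (Sum.inr j) -
        stat (Y n) (θhat n ω) ω (Sum.inr j)| ≤ ε := by
      rw [abs_sub_comm]; linarith [c2.2]
    have k1 := hg.shrink_le d1
    have k2 := hg.le_grow d2
    exact (show t ≤ grow g ε (sampleScore (Y n) ω (Sum.inr j)) -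
      shrink g ε (m' n j + sampleScore (Y n) ω (Sum.inl j)) by linarith))
  have hJ : ((J n).ncard : ℝ) ≤ S.p n := by
    have := ncard_le_card (J n)
    rw [Nat.card_fin] at this
    exact_mod_cast this
  have h1' := (abs_le.1 h1).2
  have hJδ : (J n).ncard * gaussShift 0 m F ≤
      ((J n).ncard : ℝ) * (gaussShift 0 m (gapSet t g g) + δ / 3) := by gcongr
  have hJδ' : ((J n).ncard : ℝ) * (δ / 3) ≤ S.p n * (δ / 3) := by gcongr
  linarith

end Counts

end Main

/-! ### Conclusion -/

lemma probGe_mem_Icc (f : ℝ → ℝ → ℝ) (μ t : ℝ) : probGe f μ t ∈ Icc (0 : ℝ) 1 :=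
  ⟨measureReal_nonneg, measureReal_le_one⟩

lemma probLe_mem_Icc (f : ℝ → ℝ → ℝ) (μ t : ℝ) : probLe f μ t ∈ Icc (0 : ℝ) 1 :=
  ⟨measureReal_nonneg, measureReal_le_one⟩

lemma FeatureFun.scale {f : ℝ → ℝ → ℝ} (hf : FeatureFun f) {s : ℝ} (hs : 0 < s) (x : ℝ) :
    f x s = s * f (x / s) 1 := by
  rw [hf.homog s (x / s) 1 hs, mul_div_cancel₀ _ hs.ne', mul_one]

lemma FeatureFun.le_W_iff {f : ℝ → ℝ → ℝ} (hf : FeatureFun f) {S : Params} {n : ℕ} {Ω : Type*}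
    (Y : Sample S n Ω) (hs : 0 < S.σ * S.ρ n) (ω : Ω) (θ : Cols (S.p n) → ℝ) (t : ℝ)
    (j : Fin (S.p n)) :
    S.σ * S.ρ n * t ≤ Y.W f ω θ j ↔
      t ≤ f (stat Y θ ω (Sum.inl j)) 1 - f (stat Y θ ω (Sum.inr j)) 1 := by
  rw [Sample.W, hf.scale hs, hf.scale hs (Y.debias ω θ (Sum.inr j)), ← mul_sub,
    mul_le_mul_iff_right₀ hs]
  rfl

lemma FeatureFun.W_le_iff {f : ℝ → ℝ → ℝ} (hf : FeatureFun f) {S : Params} {n : ℕ} {Ω : Type*}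
    (Y : Sample S n Ω) (hs : 0 < S.σ * S.ρ n) (ω : Ω) (θ : Cols (S.p n) → ℝ) (t : ℝ)
    (j : Fin (S.p n)) :
    Y.W f ω θ j ≤ -(S.σ * S.ρ n * t) ↔
      t ≤ f (stat Y θ ω (Sum.inr j)) 1 - f (stat Y θ ω (Sum.inl j)) 1 := by
  have e : Y.W f ω θ j = -(S.σ * S.ρ n *
      (f (stat Y θ ω (Sum.inr j)) 1 - f (stat Y θ ω (Sum.inl j)) 1)) := by
    rw [Sample.W, hf.scale hs, hf.scale hs (Y.debias ω θ (Sum.inr j))]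
    simp only [stat]
    ring
  rw [e, neg_le_neg_iff, mul_le_mul_iff_right₀ hs]

lemma ncard_split {p : ℕ} (A B : Fin p → Prop) :
    ({j | B j}.ncard : ℝ) = {j | A j ∧ B j}.ncard + {j | ¬ A j ∧ B j}.ncard := by
  have h : {j | B j} = {j | A j ∧ B j} ∪ {j | ¬ A j ∧ B j} := by
    ext j; simp only [mem_union, mem_ofPred_eq]; tauto
  rw [h, ncard_union_eq (Set.disjoint_left.2 fun j h1 h2 => h2.1 h1.1) (toFinite _) (toFinite _)]
  push_cast
  rfl

/-! ### From counts to proportions -/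

section Ratios

variable {p c₀ s a₀ a₁ δ η : ℝ}

/-- G₀/(G₀ + G₁) increases in G₀ and decreases in G₁, so an upper bound for nulls and a lower bound
for signals suffice. If α + η ≥ 1 the claim is immediate from G₀ ≤ G. -/
lemma fdp_ratio_le {G₀ G₁ G : ℝ} (hp : 0 < p) (hG₀ : 0 ≤ G₀) (hG₁ : 0 ≤ G₁) (hG : G = G₀ + G₁)
    (hc₀ : 0 < c₀) (hc₁ : c₀ < 1) (ha₀ : 0 < a₀) (ha₁ : 0 ≤ a₁) (hη : 0 < η)
    (hδ : 2 * δ ≤ η * (c₀ * a₁ + (1 - c₀) * a₀))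
    (h0 : G₀ ≤ ((1 - c₀) * a₀ + δ) * p) (h1 : (c₀ * a₁ - δ) * p ≤ G₁) (hδ0 : 0 ≤ δ) :
    G₀ / max G 1 ≤ (1 - c₀) * a₀ / (c₀ * a₁ + (1 - c₀) * a₀) + η := by
  set A := (1 - c₀) * a₀ with hA
  set B := c₀ * a₁ with hB
  have hA0 : 0 < A := mul_pos (by linarith) ha₀
  have hB0 : 0 ≤ B := by positivity
  set α := A / (B + A) with hα
  have hα0 : 0 ≤ α := by positivity
  have hαA : α * (B + A) = A := by rw [hα]; field_simp
  have key : G₀ ≤ (α + η) * G := by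
    rw [hG]
    rcases le_total 1 (α + η) with hle | hle
    · nlinarith
    · have e1 : G₀ * (1 - (α + η)) ≤ (A + δ) * p * (1 - (α + η)) :=
        mul_le_mul_of_nonneg_right h0 (by linarith)
      have e2 : (α + η) * ((B - δ) * p) ≤ (α + η) * G₁ :=
        mul_le_mul_of_nonneg_left h1 (by linarith)
      have e3 : (A + δ) * (1 - (α + η)) ≤ (α + η) * (B - δ) := by nlinarith
      have e4 := mul_le_mul_of_nonneg_right e3 hp.le
      nlinarith
  rw [div_le_iff₀ (lt_of_lt_of_le one_pos (le_max_right _ _))]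
  exact key.trans (mul_le_mul_of_nonneg_left (le_max_left _ _) (by linarith))

/-- The added 1 in the numerator is absorbed by a second δp, as δp ≥ 1. -/
lemma fdphat_ratio_le {L G N M : ℝ} (hp : 0 < p) (hM : 0 < M) (hN : 0 ≤ N) (hη : 0 < η)
    (hδ : δ * (2 + N / M + η) ≤ η * M) (hδp : 1 ≤ δ * p)
    (hL : L ≤ (N + δ) * p) (hG : (M - δ) * p ≤ G) :
    (1 + L) / max G 1 ≤ N / M + η := by
  set α := N / M with hα
  have hα0 : 0 ≤ α := by positivity
  have hαM : α * M = N := by rw [hα]; field_simp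
  have key : 1 + L ≤ (α + η) * G := by
    have e2 : (α + η) * ((M - δ) * p) ≤ (α + η) * G :=
      mul_le_mul_of_nonneg_left hG (by linarith)
    have e3 : N + 2 * δ ≤ (α + η) * (M - δ) := by nlinarith
    have e4 := mul_le_mul_of_nonneg_right e3 hp.le
    nlinarith
  rw [div_le_iff₀ (lt_of_lt_of_le one_pos (le_max_right _ _))]
  exact key.trans (mul_le_mul_of_nonneg_left (le_max_left _ _) (by linarith))

/-- The number of signals is at most (c₀ + δ)p and at least about c₀a₁p of them are selected; for a₁
≤ η there is nothing to prove. -/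
lemma le_power_ratio {G₁ : ℝ} (hp : 0 < p) (hc₀ : 0 < c₀) (hs : 0 < s) (hG₁ : 0 ≤ G₁)
    (ha₁ : a₁ ≤ 1) (hδ0 : 0 ≤ δ) (hδ : 4 * δ ≤ η * c₀) (hη : 0 < η) (hsp : s ≤ (c₀ + δ) * p)
    (h1 : (c₀ * a₁ - δ) * p ≤ G₁) : a₁ - η ≤ G₁ / s := by
  rw [le_div_iff₀ hs]
  rcases le_total (a₁ - η) 0 with hle | hle
  · exact (mul_nonpos_of_nonpos_of_nonneg hle hs.le).trans hG₁
  · have e1 : (a₁ - η) * s ≤ (a₁ - η) * ((c₀ + δ) * p) := mul_le_mul_of_nonneg_left hsp hle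
    have e2 : (a₁ - η) * (c₀ + δ) ≤ c₀ * a₁ - δ := by nlinarith
    have e3 := mul_le_mul_of_nonneg_right e2 hp.le
    linarith

end Ratios

section Final

variable {S : Params} {Ω : ℕ → Type*} [∀ n, MeasurableSpace (Ω n)] {P : ∀ n, Measure (Ω n)}
  [∀ n, IsProbabilityMeasure (P n)] {Y : ∀ n, Sample S n (Ω n)}
  {θhat : ∀ n, Ω n → Cols (S.p n) → ℝ} {c₀ μ₀ : ℝ} {μ : ℕ → ℝ} {f : ℝ → ℝ → ℝ}

/-- The limiting proportions bound the counts of selected features. -/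
structure CountBounds (S : Params) (n : ℕ) (c₀ μ₀ t δ : ℝ) (f : ℝ → ℝ → ℝ)
    (W : Fin (S.p n) → ℝ) (τ : ℝ) : Prop where
  null_ge : (((1 - c₀) * probGe f 0 t - δ) * S.p n : ℝ) ≤ {j | S.θ₀ n j = 0 ∧ τ ≤ W j}.ncard
  null_le : ({j | S.θ₀ n j = 0 ∧ τ ≤ W j}.ncard : ℝ) ≤ ((1 - c₀) * probGe f 0 t + δ) * S.p n
  -- There is no matching upper bound: signals well above μ₀ may be selected more often.
  signal_ge : ((c₀ * probGe f μ₀ t - δ) * S.p n : ℝ) ≤ {j | S.θ₀ n j ≠ 0 ∧ τ ≤ W j}.ncard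
  null_neg : ({j | S.θ₀ n j = 0 ∧ W j ≤ -τ}.ncard : ℝ) ≤ ((1 - c₀) * probLe f 0 t + δ) * S.p n
  signal_neg : ({j | S.θ₀ n j ≠ 0 ∧ W j ≤ -τ}.ncard : ℝ) ≤ (c₀ * probLe f μ₀ t + δ) * S.p n

lemma withHighProb_countBounds (hS : S.Standing) (hR : Params.Rates S)
    (hY : ∀ n, (Y n).IsModel (P n))
    (hθ : ∀ n, ∀ᵐ ω ∂P n, (Y n).IsLasso (S.lam 1 n) ω (θhat n ω))
    (hs : Tendsto (fun n => (S.s₀ n : ℝ) / S.p n) atTop (𝓝 c₀))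
    (hμ : ∀ n, 0 < μ n) (hμθ : ∀ n j, S.θ₀ n j ≠ 0 → μ n ≤ S.θ₀ n j)
    (hμ₀ : Tendsto (fun n => μ n / (S.σ * S.ρ n)) atTop (𝓝 μ₀)) (hf : FeatureFun f) (t : ℝ)
    {δ : ℝ} (hδ : 0 < δ) :
    WithHighProb P fun n => {ω | CountBounds S n c₀ μ₀ t δ f ((Y n).W f ω (θhat n ω))
      (S.σ * S.ρ n * t)} := by
  have hσ := hS.σ_pos
  set g : ℝ → ℝ := fun x => f x 1 with hg
  have hgm : AbsMono g := hf.absMono 1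
  have hgc : Continuous g := hf.continuous_left 1
  -- Monotonicity in the shift is available only for nonnegative means.
  have hμ0 : 0 ≤ μ₀ := by
    refine ge_of_tendsto hμ₀ (Eventually.of_forall fun n => ?_)
    have : 0 ≤ S.ρ n := Real.sqrt_nonneg _
    have := (hμ n).le
    positivity
  set J₀ : ∀ n, Set (Fin (S.p n)) := fun n => {j | S.θ₀ n j = 0} with hJ₀
  set J₁ : ∀ n, Set (Fin (S.p n)) := fun n => {j | S.θ₀ n j ≠ 0} with hJ₁
  -- A normalized signal is at least μ₀ only in the limit. Raising it to μ₀ where necessary gives an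
  -- exact lower bound and moves it by at most ε eventually.
  set m' : ∀ n, Fin (S.p n) → ℝ := fun n j => max (S.θ₀ n j / (S.σ * S.ρ n)) μ₀ with hm'
  have hclose0 : ∀ ε > 0, ∀ᶠ n in atTop, ∀ j ∈ J₀ n,
      |S.θ₀ n j / (S.σ * S.ρ n) - (fun _ _ => 0 : ∀ n, Fin (S.p n) → ℝ) n j| ≤ ε := by
    intro ε hε
    refine Eventually.of_forall fun n j hj => ?_
    have : S.θ₀ n j = 0 := hj
    simp [this, hε.le]
  have hclose1 : ∀ ε > 0, ∀ᶠ n in atTop, ∀ j ∈ J₁ n,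
      |S.θ₀ n j / (S.σ * S.ρ n) - m' n j| ≤ ε := by
    intro ε hε
    filter_upwards [hμ₀.eventually (lt_mem_nhds (show μ₀ - ε < μ₀ by linarith)),
      eventually_params hS hR] with n hn ⟨h1, h2, _⟩ j hj
    have hρ := Params.ρ_pos (S := S) h1 h2
    have h3 : μ n / (S.σ * S.ρ n) ≤ S.θ₀ n j / (S.σ * S.ρ n) := by
      have := hμθ n j hj
      gcongr
    simp only [hm']
    rw [abs_le]
    rcases max_cases (S.θ₀ n j / (S.σ * S.ρ n)) μ₀ with ⟨h, _⟩ | ⟨h, h'⟩ <;> rw [h] <;>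
      constructor <;> linarith
  have hδ2 : 0 < δ / 2 := half_pos hδ
  have e1 := withHighProb_ge_lower t (J := J₀) (m := 0) (m' := fun _ _ => 0) hS hR hY hθ hgm hgc
    le_rfl (fun _ _ _ => le_rfl) hclose0 hδ2
  have e2 := withHighProb_ge_upper t (J := J₀) hS hR hY hθ hgm hgc (fun _ _ hj => hj) hδ2
  have e3 := withHighProb_ge_lower t (J := J₁) (m := μ₀) (m' := m') hS hR hY hθ hgm hgc
    hμ0 (fun _ _ _ => le_max_right _ _) hclose1 hδ2
  have e4 := withHighProb_le_upper t (J := J₀) (m := 0) (m' := fun _ _ => 0) hS hR hY hθ hgm hgc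
    le_rfl (fun _ _ _ => le_rfl) hclose0 hδ2
  have e5 := withHighProb_le_upper t (J := J₁) (m := μ₀) (m' := m') hS hR hY hθ hgm hgc
    hμ0 (fun _ _ _ => le_max_right _ _) hclose1 hδ2
  refine ((((e1.inter e2).inter e3).inter e4).inter e5).mono ?_
  filter_upwards [eventually_params hS hR, (Metric.tendsto_nhds.1 hs) (δ / 2) hδ2]
    with n ⟨hn, hr, hp, _⟩ hc
  rintro ω ⟨⟨⟨⟨k1, k2⟩, k3⟩, k4⟩, k5⟩
  rw [mem_ofPred_eq] at k1 k2 k3 k4 k5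
  have hp' : (0 : ℝ) < S.p n := by exact_mod_cast hp
  have hρ := Params.ρ_pos (S := S) hn hr
  have hsc : 0 < S.σ * S.ρ n := by positivity
  have hJ₁n : ((J₁ n).ncard : ℝ) = S.s₀ n := rfl
  have hJ₀n : ((J₀ n).ncard : ℝ) = S.p n - S.s₀ n := by
    have h := ncard_split (fun j => S.θ₀ n j ≠ 0) (fun _ : Fin (S.p n) => True)
    have h' : ({_j : Fin (S.p n) | True}.ncard : ℝ) = S.p n := by
      have : {_j : Fin (S.p n) | True} = univ := rfl
      rw [this, ncard_univ, Nat.card_fin]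
    rw [h'] at h
    simp only [and_true, not_not] at h
    have hs0 : (S.s₀ n : ℝ) = {j | S.θ₀ n j ≠ 0}.ncard := rfl
    have hj0 : ((J₀ n).ncard : ℝ) = {j | S.θ₀ n j = 0}.ncard := rfl
    rw [hs0, hj0]
    linarith
  rw [Real.dist_eq, div_sub' hp'.ne', abs_div, abs_of_pos hp', div_lt_iff₀ hp'] at hc
  have hc' := abs_lt.1 hc
  -- replacing `s₀` by `c₀ p` costs at most `δ p / 2`
  have rep : ∀ x ∈ Icc (0 : ℝ) 1, |S.s₀ n * x - c₀ * x * S.p n| ≤ δ / 2 * S.p n := by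
    intro x hx
    have : S.s₀ n * x - c₀ * x * S.p n = (S.s₀ n - S.p n * c₀) * x := by ring
    rw [this, abs_mul, abs_of_nonneg hx.1]
    calc |(S.s₀ n : ℝ) - S.p n * c₀| * x ≤ |(S.s₀ n : ℝ) - S.p n * c₀| * 1 := by
          gcongr; exact hx.2
      _ ≤ _ := by linarith
  have r1 := abs_le.1 (rep _ (probGe_mem_Icc f μ₀ t))
  have r0 := abs_le.1 (rep _ (probGe_mem_Icc f 0 t))
  have l1 := abs_le.1 (rep _ (probLe_mem_Icc f μ₀ t))
  have l0 := abs_le.1 (rep _ (probLe_mem_Icc f 0 t))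
  rw [hJ₀n, ← hf.probGe_eq] at k1 k2
  rw [hJ₁n, ← hf.probGe_eq] at k3
  rw [hJ₀n, ← hf.probLe_eq] at k4
  rw [hJ₁n, ← hf.probLe_eq] at k5
  have setGe : ∀ A : Fin (S.p n) → Prop,
      {j | A j ∧ S.σ * S.ρ n * t ≤ (Y n).W f ω (θhat n ω) j} =
      {j | A j ∧ t ≤ g (stat (Y n) (θhat n ω) ω (Sum.inl j)) -
        g (stat (Y n) (θhat n ω) ω (Sum.inr j))} := by
    intro A
    ext j
    simp only [mem_ofPred_eq, hf.le_W_iff (Y n) hsc, hg]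
  have setLe : ∀ A : Fin (S.p n) → Prop,
      {j | A j ∧ (Y n).W f ω (θhat n ω) j ≤ -(S.σ * S.ρ n * t)} =
      {j | A j ∧ t ≤ g (stat (Y n) (θhat n ω) ω (Sum.inr j)) -
        g (stat (Y n) (θhat n ω) ω (Sum.inl j))} := by
    intro A
    ext j
    simp only [mem_ofPred_eq, hf.W_le_iff (Y n) hsc, hg]
  refine ⟨?_, ?_, ?_, ?_, ?_⟩
  · rw [setGe]
    refine le_trans ?_ k1
    linarith
  · rw [setGe]
    refine k2.trans ?_
    linarith
  · rw [setGe]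
    refine le_trans ?_ k3
    linarith
  · rw [setLe]
    refine k4.trans ?_
    linarith
  · rw [setLe]
    refine k5.trans ?_
    linarith

lemma CountBounds.FDP_le {n : ℕ} {t δ η τ : ℝ} {W : Fin (S.p n) → ℝ}
    (h : CountBounds S n c₀ μ₀ t δ f W τ) (hf : FeatureFun f) (hc₀ : c₀ ∈ Ioo (0 : ℝ) 1)
    (hp : 0 < S.p n) (hδ0 : 0 ≤ δ) (hη : 0 < η)
    (hδ : 2 * δ ≤ η * (c₀ * probGe f μ₀ t + (1 - c₀) * probGe f 0 t)) :
    FDP (S.θ₀ n) W τ ≤ alpha f c₀ μ₀ t + η :=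
  fdp_ratio_le (by exact_mod_cast hp) (Nat.cast_nonneg _) (Nat.cast_nonneg _)
    (ncard_split (fun j => S.θ₀ n j = 0) fun j => τ ≤ W j) hc₀.1 hc₀.2 (hf.probGe_pos t)
    (probGe_mem_Icc f μ₀ t).1 hη hδ h.null_le h.signal_ge hδ0

lemma CountBounds.FDPhat_le {n : ℕ} {t δ η τ : ℝ} {W : Fin (S.p n) → ℝ}
    (h : CountBounds S n c₀ μ₀ t δ f W τ) (hp : 0 < S.p n)
    (hN : 0 ≤ c₀ * probLe f μ₀ t + (1 - c₀) * probLe f 0 t)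
    (hM : 0 < c₀ * probGe f μ₀ t + (1 - c₀) * probGe f 0 t) (hη : 0 < η)
    (hδ : 2 * δ * (2 + alphaHat f c₀ μ₀ t + η) ≤
      η * (c₀ * probGe f μ₀ t + (1 - c₀) * probGe f 0 t))
    (hδp : 1 ≤ 2 * δ * S.p n) :
    FDPhat W τ ≤ alphaHat f c₀ μ₀ t + η := by
  -- The null and signal counts are each off by δp, so the lemma is used with 2δ.
  refine fdphat_ratio_le (by exact_mod_cast hp) hM hN hη hδ hδp ?_ ?_
  · rw [ncard_split (fun j => S.θ₀ n j = 0)]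
    have h1 := h.null_neg
    have h2 := h.signal_neg
    simp only [ne_eq] at h2
    linarith
  · rw [ncard_split (fun j => S.θ₀ n j = 0)]
    have h1 := h.null_ge
    have h2 := h.signal_ge
    simp only [ne_eq] at h2
    linarith

end Final

end JLKnockoff

theorem mainTheorem2 :
    ∃ C : ℝ, 0 < C ∧
      ∀ S : JLKnockoff.Params, S.Standing → S.Debiasing C →
      ∀ (Ω : ℕ → Type*) [∀ n, MeasurableSpace (Ω n)]
        (P : ∀ n, Measure (Ω n)) [∀ n, IsProbabilityMeasure (P n)]
        (Y : ∀ n, JLKnockoff.Sample S n (Ω n)), (∀ n, (Y n).IsModel (P n)) →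
      ∀ θhat : ∀ n, Ω n → JLKnockoff.Cols (S.p n) → ℝ,
        (∀ n, ∀ᵐ ω ∂P n, (Y n).IsLasso (S.lam C n) ω (θhat n ω)) →
      ∀ c₀ ∈ Ioo (0 : ℝ) 1, Tendsto (fun n => (S.s₀ n : ℝ) / S.p n) atTop (𝓝 c₀) →
      ∀ (μ : ℕ → ℝ) (μ₀ : ℝ), (∀ n, 0 < μ n) →
        (∀ n j, S.θ₀ n j ≠ 0 → μ n ≤ S.θ₀ n j) →
        Tendsto (fun n => μ n / (S.σ * S.ρ n)) atTop (𝓝 μ₀) →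
      ∀ f : ℝ → ℝ → ℝ, JLKnockoff.FeatureFun f →
      ∀ t₀ > 0, ∀ η > 0,
        JLKnockoff.WithHighProb P (fun n => {ω |
          JLKnockoff.FDPhat ((Y n).W f ω (θhat n ω)) (S.σ * S.ρ n * t₀)
            ≤ JLKnockoff.alphaHat f c₀ μ₀ t₀ + η}) ∧
        JLKnockoff.WithHighProb P (fun n => {ω |
          JLKnockoff.FDP (S.θ₀ n) ((Y n).W f ω (θhat n ω)) (S.σ * S.ρ n * t₀)
            ≤ JLKnockoff.alpha f c₀ μ₀ t₀ + η}) ∧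
        JLKnockoff.WithHighProb P (fun n => {ω |
          JLKnockoff.beta f μ₀ t₀ - η
            ≤ JLKnockoff.Power (S.θ₀ n) ((Y n).W f ω (θhat n ω)) (S.σ * S.ρ n * t₀)}) := by
  -- The constant 1 works because λ is not required to dominate the noise correlations:
  -- `lasso_error_le` holds for any nonnegative penalty, and the rates use only λ ≥ σ/√n and λ ≥
  -- σ/√r.
  refine ⟨1, one_pos, ?_⟩
  intro S hS hD Ω _ P _ Y hY θhat hθ c₀ hc₀ hs μ μ₀ hμ hμθ hμ₀ f hf t₀ _ η hη
  have hR := JLKnockoff.Params.rates hS hD hc₀.1 hs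
  have hc₁ : 0 < 1 - c₀ := by linarith [hc₀.2]
  have hc := hc₀.1
  have hcount {δ : ℝ} (hδ : 0 < δ) := JLKnockoff.withHighProb_countBounds (c₀ := c₀) (μ₀ := μ₀)
    (μ := μ) (f := f) hS hR hY hθ hs hμ hμθ hμ₀ hf t₀ hδ
  have ha := JLKnockoff.probGe_mem_Icc f μ₀ t₀
  have ha1 := ha.1
  have hl1 := (JLKnockoff.probLe_mem_Icc f μ₀ t₀).1
  have hl0 := (JLKnockoff.probLe_mem_Icc f 0 t₀).1
  have ha0 := hf.probGe_pos t₀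
  have hN : 0 ≤ c₀ * JLKnockoff.probLe f μ₀ t₀ + (1 - c₀) * JLKnockoff.probLe f 0 t₀ := by
    positivity
  have hM : 0 < c₀ * JLKnockoff.probGe f μ₀ t₀ + (1 - c₀) * JLKnockoff.probGe f 0 t₀ := by
    positivity
  refine ⟨?_, ?_, ?_⟩
  · have hα : 0 ≤ JLKnockoff.alphaHat f c₀ μ₀ t₀ := div_nonneg hN hM.le
    -- Chosen to turn the smallness requirement of `CountBounds.FDPhat_le` into an equality; then
    -- 2δp ≥ 1 holds eventually as p → ∞.
    obtain ⟨δ, hδ, hδe⟩ : ∃ δ > 0, 2 * δ * (2 + JLKnockoff.alphaHat f c₀ μ₀ t₀ + η) =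
        η * (c₀ * JLKnockoff.probGe f μ₀ t₀ + (1 - c₀) * JLKnockoff.probGe f 0 t₀) := by
      refine ⟨η * (c₀ * JLKnockoff.probGe f μ₀ t₀ + (1 - c₀) * JLKnockoff.probGe f 0 t₀) /
        (2 * (2 + JLKnockoff.alphaHat f c₀ μ₀ t₀ + η)), by positivity, by field_simp⟩
    refine (hcount hδ).mono ?_
    filter_upwards [hS.p_tendsto.eventually_gt_atTop 0,
      (tendsto_natCast_atTop_atTop.comp hS.p_tendsto).eventually_ge_atTop (1 / (2 * δ))]
      with n hp hpn ω h
    refine h.FDPhat_le hp hN hM hη hδe.le ?_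
    rw [Function.comp_apply, div_le_iff₀ (by positivity)] at hpn
    linarith
  · refine (hcount (half_pos (mul_pos hη hM))).mono ?_
    filter_upwards [hS.p_tendsto.eventually_gt_atTop 0] with n hp ω h
    exact h.FDP_le hf hc₀ hp (by positivity) hη (by linarith)
  · have hδ : 0 < η * c₀ / 4 := by positivity
    refine (hcount hδ).mono ?_
    filter_upwards [hS.eventually_size hc hs,
      hs.eventually (ge_mem_nhds (lt_add_of_pos_right c₀ hδ))] with n ⟨_, _, hp, _, hsp⟩ hsn ω h
    have hp' : (0 : ℝ) < S.p n := by exact_mod_cast (show 0 < S.p n by omega)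
    exact JLKnockoff.le_power_ratio hp' hc (lt_of_lt_of_le (by positivity) hsp)
      (Nat.cast_nonneg _) ha.2 hδ.le (by linarith) hη ((div_le_iff₀ hp').1 hsn) h.signal_ge
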